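/- Let $\kappa,\nu,n,m\ge 0$ be integers. For real parameters $\hat\pi=(\hat\pi_1,\dots,\hat\pi_n)$, $\hat\theta=(\hat\theta_1,\dots,\hat\theta_m)$ put $$W^{(n,m)}(v,u)=\frac{e^{-1/u+1/v}}{u-v}\Big(\frac vu\Big)^{\nu+n-m}\prod_{k=1}^n\frac{u-\hat\pi_k}{v-\hat\pi_k}\prod_{l=1}^m\frac{v-\hat\theta_l}{u-\hat\theta_l}.$$ In what follows $\Gamma_0,\Gamma_{\rm in},\Gamma_{\rm out}$ are counter-clockwise circles in $\mathbb C$: $\Gamma_0$ encircles $0$; $\Gamma_{\rm in}$ encircles $0,\hat\theta_1,\dots,\hat\theta_m$; $\Gamma_{\rm out}$ encircles the contour $\Gamma_{\rm in}$ and $\hat\pi_1,\dots,\hat\pi_n$. Define for $y_1,y_2>0$ $$K_{\rm III}^{(n,m)}(y_1,y_2)=\oint_{\Gamma_{\rm out}}\frac{dv}{2\pi i}\oint_{\Gamma_{\rm in}}\frac{du}{2\pi i}\,e^{-y_1v+y_2u}\,W^{(n,m)}(v,u),$$ $$K_{\rm II}^{(n,m)}(y_1,y_2;\tau)=\frac2\tau\oint_{\Gamma_{\rm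 out}}\frac{dv}{2\pi i}\oint_{\Gamma_{\rm in}}\frac{du}{2\pi i}\,I_\kappa\!\Big(2\sqrt{(1-\tau v)y_1/\tau^2}\Big)K_\kappa\!\Big(2\sqrt{(1-\tau u)y_2/\tau^2}\Big)\frac{(1-\tau u)^{\kappa/2}}{(1-\tau v)^{\kappa/2}}\,W^{(n,m)}(v,u),$$ where $\tau>0$, $I_\kappa,K_\kappa$ are the modified Bessel functions, and $\Gamma_{\rm in}$ satisfies in addition $\operatorname{Re}u<1/\tau$; and $$K_{\rm I}^{(m)}(y_1,y_2)=\int_0^\infty dt\oint_{\Gamma_0}\frac{ds}{2\pi i}\,t^{\kappa-1}s^{-\kappa-1}e^{s-t}\oint_{\Gamma_{\rm out}}\frac{dv}{2\pi i}\oint_{\Gamma_{\rm in}}\frac{du}{2\pi i}\,e^{-\frac vs y_1+\frac ut y_2}\,W^{(0,m)}(v,u).$$ Writing $f(t)$ for the integrand of $\int_0^\infty dt$ in $K_{\rm I}^{(m)}$, this integral is understood as $\lim_{\varepsilon\to0+}\int_0^\infty e^{-\varepsilon/t}f(t)\,dt$, which is the ordinary integral whenever $f$ is absolutely integrable on $(0,\infty)$.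 Then, for all choices of the contours with the stated properties (which in $K_{\rm II}$ may depend on $\tau$), the following holds. a) Let $\hat\theta_l\le 0$ for all $l$, and for all sufficiently large $\tau$ let $\hat\pi_k=\hat\pi_k(\tau)\in[0,1/\tau)$ for all $k$. Then for all $x,y>0$ the function $e^{-\varepsilon/t}f(t)$ is integrable on $(0,\infty)$ for every $\varepsilon>0$ and the limit defining $K_{\rm I}^{(m)}(x,y)$ exists, and $$\lim_{\tau\to\infty}\tau K_{\rm II}^{(n,m)}(\tau x,\tau y;\tau)\Big(\frac yx\Big)^{\kappa/2}=K_{\rm I}^{(m)}(x,y)$$ uniformly for $(x,y)$ in every compact subset of $(0,\infty)^2$. b) Let $\hat\pi_k\ge0$ and $\hat\theta_l\le\hat\pi_k$ for all $k,l$ be fixed. Then $$\lim_{\tau\to0+}K_{\rm II}^{(n,m)}(x,y;\tau)\,e^{2(\sqrt y-\sqrt x)/\tau}=\tfrac12(xy)^{-1/4}K_{\rm III}^{(n,m)}(\sqrt x,\sqrt y)$$ uniformly for $(x,y)$ in every compact subset of $(0,\infty)^2$. -/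

import Mathlib

open Filter Topology Set MeasureTheory

noncomputable section

namespace HardEdge

/-- A positively oriented circle in the complex plane, used as an integration contour. -/
structure Contour where
  center : ℂ
  radius : ℝ

namespace Contour

/-- The points of the contour. -/
def points (Γ : Contour) : Set ℂ := Metric.sphere Γ.center Γ.radius

/-- The contour encircles the point `z` (once, counter-clockwise). -/
def Encloses (Γ : Contour) (z : ℂ) : Prop := dist z Γ.center < Γ.radius

/-- The normalised contour integral `∮_Γ f(z) dz / (2πi)`. -/
def integral (Γ : Contour) (f : ℂ → ℂ) : ℂ :=
  (2 * (Real.pi : ℂ) * Complex.I)⁻¹ * ∮ z in C(Γ.center, Γ.radius), f z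

end Contour

/-- Modified Bessel function of the first kind, of order `κ ∈ {0, 1, 2, …}`. -/
def besselI (κ : ℕ) (z : ℂ) : ℂ :=
  ∑' k : ℕ, (z / 2) ^ (2 * k + κ) / ((k.factorial : ℂ) * ((k + κ).factorial : ℂ))

/-- Modified Bessel function of the second kind, of order `κ ∈ {0, 1, 2, …}`, by the integral
`K_κ(z) = (1/2) (z/2)^(-κ) ∫_0^∞ t^(κ-1) exp(-t - z²/(4t)) dt`, which represents it for
`|arg z| < π/4`. Below it is only evaluated at arguments `z = 2 √w` with `0 < Re w`. -/
def besselK (κ : ℕ) (z : ℂ) : ℂ :=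
  (1 / 2) * ((z / 2) ^ κ)⁻¹ *
    ∫ t in Ioi (0 : ℝ), (t : ℂ) ^ ((κ : ℤ) - 1) * Complex.exp (-(t : ℂ) - z ^ 2 / (4 * (t : ℂ)))

/-- The factor common to all three kernels (outer variable `v`, inner variable `u`):
`e^{-1/u + 1/v} / (u - v) * (v/u)^(ν+n-m) * ∏ (u - π_k)/(v - π_k) * ∏ (v - θ_l)/(u - θ_l)`. -/
def commonFactor (ν : ℕ) {n m : ℕ} (p : Fin n → ℝ) (θ : Fin m → ℝ) (v u : ℂ) : ℂ :=
  Complex.exp (-1 / u + 1 / v) / (u - v) * (v / u) ^ ((ν : ℤ) + (n : ℤ) - (m : ℤ)) *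
    (∏ k : Fin n, (u - (p k : ℂ)) / (v - (p k : ℂ))) *
    (∏ l : Fin m, (v - (θ l : ℂ)) / (u - (θ l : ℂ)))

/-- `Γin` encircles `0` and all `θ_l`, and `Γout` encircles all `π_k` and the contour `Γin`. -/
structure Admissible {n m : ℕ} (p : Fin n → ℝ) (θ : Fin m → ℝ) (Γin Γout : Contour) : Prop where
  zero_in : Γin.Encloses 0
  theta_in : ∀ l, Γin.Encloses (θ l : ℂ)
  pi_out : ∀ k, Γout.Encloses (p k : ℂ)
  nested : ∀ z ∈ Γin.points, Γout.Encloses z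

/-- The additional requirement `Re u < 1/τ` on `Γin` for the interpolating kernel. -/
structure AdmissibleII {n m : ℕ} (p : Fin n → ℝ) (θ : Fin m → ℝ) (τ : ℝ) (Γin Γout : Contour) :
    Prop extends Admissible p θ Γin Γout where
  re_lt : ∀ u ∈ Γin.points, u.re < 1 / τ

/-- The kernel `K_III^{(n,m)}(y₁, y₂)`: Bessel kernel with finite rank perturbations. -/
def kernelIII (ν : ℕ) {n m : ℕ} (p : Fin n → ℝ) (θ : Fin m → ℝ) (Γin Γout : Contour)
    (y₁ y₂ : ℝ) : ℂ :=
  Γout.integral fun v => Γin.integral fun u =>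
    Complex.exp (-((y₁ : ℂ) * v) + (y₂ : ℂ) * u) * commonFactor ν p θ v u

/-- The interpolating kernel `K_II^{(n,m)}(y₁, y₂; τ)`. The square roots and powers are principal
branches; the power of the quotient `(1 - τu)/(1 - τv)` is the quotient of the powers, so that the
integrand is single-valued and analytic in `v` away from the poles. -/
def kernelII (κ ν : ℕ) {n m : ℕ} (p : Fin n → ℝ) (θ : Fin m → ℝ) (Γin Γout : Contour)
    (τ y₁ y₂ : ℝ) : ℂ :=
  (2 / (τ : ℂ)) * Γout.integral fun v => Γin.integral fun u =>
    besselI κ (2 * ((1 - (τ : ℂ) * v) * (y₁ : ℂ) / (τ : ℂ) ^ 2) ^ (1 / 2 : ℂ)) *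
    besselK κ (2 * ((1 - (τ : ℂ) * u) * (y₂ : ℂ) / (τ : ℂ) ^ 2) ^ (1 / 2 : ℂ)) *
    ((1 - (τ : ℂ) * u) ^ ((κ : ℂ) / 2) / (1 - (τ : ℂ) * v) ^ ((κ : ℂ) / 2)) *
    commonFactor ν p θ v u

/-- The integrand in the variable `t ∈ (0, ∞)` of the kernel `K_I^{(m)}(y₁, y₂)`: a contour
integral over `s`, containing the double contour integral over `v` and `u` without parameters
`π_k`. -/
def integrandI (κ ν : ℕ) {m : ℕ} (θ : Fin m → ℝ) (Γ₀ Γin Γout : Contour) (y₁ y₂ t : ℝ) : ℂ :=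
  Γ₀.integral fun s =>
    (t : ℂ) ^ ((κ : ℤ) - 1) * s ^ (-(κ : ℤ) - 1) * Complex.exp (s - (t : ℂ)) *
    Γout.integral fun v => Γin.integral fun u =>
      Complex.exp (-(v / s * (y₁ : ℂ)) + u / (t : ℂ) * (y₂ : ℂ)) *
      commonFactor ν (Fin.elim0 : Fin 0 → ℝ) θ v u

/-- `∫_0^∞ f(t) dt = a`, where oscillations of `f` at `t → 0` are summed in the sense of Abel:
`e^{-ε/t} f(t)` is integrable for every `ε > 0` and its integral tends to `a` as `ε → 0+`. -/
def HasAbelIntegral (f : ℝ → ℂ) (a : ℂ) : Prop :=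
  (∀ ε : ℝ, 0 < ε → IntegrableOn (fun t : ℝ => (Real.exp (-ε / t) : ℂ) * f t) (Ioi 0)) ∧
    Tendsto (fun ε : ℝ => ∫ t in Ioi (0 : ℝ), (Real.exp (-ε / t) : ℂ) * f t) (𝓝[>] 0) (𝓝 a)

/-- The value of `∫_0^∞ f(t) dt` in the above sense (unspecified if there is none). -/
def abelIntegral (f : ℝ → ℂ) : ℂ :=
  limUnder (𝓝[>] (0 : ℝ)) fun ε : ℝ => ∫ t in Ioi (0 : ℝ), (Real.exp (-ε / t) : ℂ) * f t

/-- An absolutely convergent integral has its ordinary value. -/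
theorem hasAbelIntegral_of_integrableOn {f : ℝ → ℂ} (hf : IntegrableOn f (Ioi 0)) :
    HasAbelIntegral f (∫ t in Ioi (0 : ℝ), f t) := by
  have hmeas : ∀ ε : ℝ, AEStronglyMeasurable (fun t : ℝ => (Real.exp (-ε / t) : ℂ) * f t)
      (volume.restrict (Ioi 0)) := by
    intro ε
    refine AEStronglyMeasurable.mul ?_ hf.aestronglyMeasurable
    exact (by fun_prop : Measurable fun t : ℝ => (Real.exp (-ε / t) : ℂ)).aestronglyMeasurable
  have hbd : ∀ ε : ℝ, 0 < ε →
      ∀ᵐ t ∂(volume.restrict (Ioi (0 : ℝ))), ‖(Real.exp (-ε / t) : ℂ) * f t‖ ≤ ‖f t‖ := by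
    intro ε hε
    filter_upwards [ae_restrict_mem measurableSet_Ioi] with t ht
    have ht' : (0 : ℝ) < t := ht
    have h1 : Real.exp (-ε / t) ≤ 1 := by
      rw [Real.exp_le_one_iff, neg_div]
      have := div_pos hε ht'
      linarith
    rw [norm_mul, Complex.norm_real, Real.norm_of_nonneg (Real.exp_pos _).le]
    exact mul_le_of_le_one_left (norm_nonneg _) h1
  refine ⟨fun ε hε => Integrable.mono hf (hmeas ε) (hbd ε hε), ?_⟩
  refine tendsto_integral_filter_of_dominated_convergence (fun t => ‖f t‖)
    (Eventually.of_forall hmeas) ?_ hf.norm ?_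
  · filter_upwards [self_mem_nhdsWithin] with ε hε using hbd ε hε
  · refine Eventually.of_forall fun t => ?_
    have h : Continuous fun ε : ℝ => (Real.exp (-ε / t) : ℂ) * f t := by fun_prop
    have h2 := (h.tendsto 0).mono_left (nhdsWithin_le_nhds (s := Ioi (0 : ℝ)))
    simpa using h2

theorem HasAbelIntegral.abelIntegral_eq {f : ℝ → ℂ} {a : ℂ} (h : HasAbelIntegral f a) :
    abelIntegral f = a :=
  h.2.limUnder_eq

/-- The kernel `K_I^{(m)}(y₁, y₂)`: Meijer G-kernel with finite rank perturbations. The integral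
over `t` is the ordinary one where it converges absolutely. -/
def kernelI (κ ν : ℕ) {m : ℕ} (θ : Fin m → ℝ) (Γ₀ Γin Γout : Contour) (y₁ y₂ : ℝ) : ℂ :=
  abelIntegral (integrandI κ ν θ Γ₀ Γin Γout y₁ y₂)

theorem kernelI_eq_integral (κ ν : ℕ) {m : ℕ} (θ : Fin m → ℝ) (Γ₀ Γin Γout : Contour) (y₁ y₂ : ℝ)
    (h : IntegrableOn (integrandI κ ν θ Γ₀ Γin Γout y₁ y₂) (Ioi 0)) :
    kernelI κ ν θ Γ₀ Γin Γout y₁ y₂ =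
      ∫ t in Ioi (0 : ℝ), integrandI κ ν θ Γ₀ Γin Γout y₁ y₂ t :=
  (hasAbelIntegral_of_integrableOn h).abelIntegral_eq

end HardEdge

end

/-! Both limits rest on removing the branches from the Bessel factors: `I_κ(2√w) = w^(κ/2) S(w)`
with `S = besselSeries κ` entire, and `K_κ(2√w) = ½ w^(-κ/2) ∫ t^(κ-1) e^(-t-w/t) dt`. In the
product the powers of `1 - τv` and `1 - τu` cancel. After Fubini, `K_II` at `(x, y)` equals
`(1/τ)(x/y)^(κ/2)` times an integral of `t^(κ-1) e^(-t-E/t)` against a double contour integral at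
`(y/τ)/t`, with `E = y/τ²` (`AdmissibleII.kernelII_eq`). That contour integral involves functions
holomorphic off the enclosed poles, so it does not depend on the contours
(`Admissible.integral_eq`), and contours varying with `τ` are harmless.

Limit a). After rescaling, `E = y/τ`, so `e^(-E/t)` is exactly the Abel regulator of `K_I`. Doing
the `s`-integral in `K_I` gives the same heat integral, with `E = ε`, shift `δ = 0` and all `π̂_k =
0`. It therefore suffices that the heat integral has a limit as `E → 0+`, `δ → 0`, `π̂ → 0`, `(x, y)
→ z` jointly (`exists_tendsto_besselHeatIntegral`); `K_I` and the limit of `K_II` are both that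
limit. The danger is `t → 0` when `E` vanishes. For each `t` the inner contour is taken to be the
circle through the saddle points `±i√s` of `u/s - 1/u`, `s = min(t,1)/y`. There the exponential has
modulus at most one and absorbs negative powers of `|u|`, leaving a bound polynomial in `1/t`.
Powers `t^k`, or `E^b e^(-E/t) ≤ b! t^b`, then dominate once `b + k` is large. Integration by parts
in `t` gives a recurrence which raises `b + k` faster than it worsens the pole at `u = 0`, and
induction reaches every `b`, `k`, `l`.

Limit b). Laplace's method gives `I_κ(z) ~ e^z/√(2πz)` and `K_κ(z) ~ √(π/(2z)) e^(-z)` as `Re z → ∞`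
with bounded imaginary part. The arguments are `2√x/τ - √x v + o(1)` and `2√y/τ - √y u + o(1)`, so
the integrand converges jointly on fixed compact contours to that of `K_III` with the stated
prefactor. In both parts joint convergence at each point of a compact set yields uniformity. -/

noncomputable section

namespace HardEdge

/-! ### Integrals over circles: deformation and Fubini. -/

/-- Two circles inside a convex open set `U`, both surrounding the set `K`, give the same integral
of a function that is holomorphic on `U \ K`. -/
theorem circleIntegral_eq_of_convex {U K : Set ℂ} (hU : IsOpen U) (hUc : Convex ℝ U)
    (hK : IsClosed K) {f : ℂ → ℂ} (hf : DifferentiableOn ℂ f (U \ K)) {c₁ c₂ : ℂ} {r₁ r₂ : ℝ}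
    (hr₁ : 0 ≤ r₁) (hr₂ : 0 ≤ r₂)
    (h₁ : Metric.sphere c₁ r₁ ⊆ U) (h₂ : Metric.sphere c₂ r₂ ⊆ U)
    (hK₁ : K ⊆ Metric.ball c₁ r₁) (hK₂ : K ⊆ Metric.ball c₂ r₂) :
    (∮ z in C(c₁, r₁), f z) = ∮ z in C(c₂, r₂), f z := by
  have hO : IsOpen (U \ K) := hU.sdiff hK
  -- The straight-line homotopy between the parametrised circles stays in `U` by convexity. It
  -- misses `K`: for `z` on it, `(1 - s)(z - c₁) + s(z - c₂)` has norm `(1 - s)r₁ + s r₂`, while a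
  -- point of `K` is strictly closer than `r₁` to `c₁` and than `r₂` to `c₂`.
  let γ : ℝ × ℝ → ℂ := fun q =>
    (c₁ + q.1 * (c₂ - c₁)) + (r₁ + q.1 * (r₂ - r₁)) * Complex.exp (q.2 * Complex.I)
  have hγmem : ∀ q : ℝ × ℝ, q.1 ∈ Icc (0 : ℝ) 1 → γ q ∈ U \ K := by
    rintro ⟨s, a⟩ ⟨hs0, hs1⟩
    have hs0' : 0 ≤ s := hs0
    have hs1' : 0 ≤ 1 - s := by have : s ≤ 1 := hs1; linarith
    refine ⟨?_, fun hmem => ?_⟩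
    · have e : γ (s, a) = (1 - s) • circleMap c₁ r₁ a + s • circleMap c₂ r₂ a := by
        simp only [γ, circleMap, Complex.real_smul]; push_cast; ring
      rw [e]
      exact hUc (h₁ (circleMap_mem_sphere _ hr₁ _)) (h₂ (circleMap_mem_sphere _ hr₂ _))
        hs1' hs0' (by ring)
    · have d₁ := Metric.mem_ball.1 (hK₁ hmem)
      have d₂ := Metric.mem_ball.1 (hK₂ hmem)
      rw [dist_eq_norm] at d₁ d₂
      have e : ((r₁ + s * (r₂ - r₁)) : ℂ) * Complex.exp (a * Complex.I) =
          ((1 - s : ℝ) : ℂ) * (γ (s, a) - c₁) + (s : ℂ) * (γ (s, a) - c₂) := by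
        simp only [γ]; push_cast; ring
      have n1 : ‖((r₁ + s * (r₂ - r₁)) : ℂ) * Complex.exp (a * Complex.I)‖ =
          (1 - s) * r₁ + s * r₂ := by
        rw [norm_mul, Complex.norm_exp_ofReal_mul_I, mul_one]
        have : ((r₁ + s * (r₂ - r₁)) : ℂ) = (((1 - s) * r₁ + s * r₂ : ℝ) : ℂ) := by
          push_cast; ring
        rw [this, Complex.norm_real, Real.norm_of_nonneg (by positivity)]
      have n2 := norm_add_le (((1 - s : ℝ) : ℂ) * (γ (s, a) - c₁)) ((s : ℂ) * (γ (s, a) - c₂))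
      rw [← e, n1, norm_mul, norm_mul, Complex.norm_real, Complex.norm_real,
        Real.norm_of_nonneg hs1', Real.norm_of_nonneg hs0'] at n2
      rcases hs0'.eq_or_lt with h | h
      · subst h; norm_num at n2; linarith
      · nlinarith [mul_le_mul_of_nonneg_left d₁.le hs1', mul_lt_mul_of_pos_left d₂ h]
  have hγc : Continuous γ := by fun_prop
  -- `D` and `T` are the partial derivatives of `γ` in `s` and in the angle.
  let D : ℝ × ℝ → ℂ := fun q => (c₂ - c₁) + (r₂ - r₁) * Complex.exp (q.2 * Complex.I)
  let T : ℝ × ℝ → ℂ := fun q =>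
    (r₁ + q.1 * (r₂ - r₁)) * (Complex.exp (q.2 * Complex.I) * Complex.I)
  let ds : ℝ × ℝ →L[ℝ] ℂ := Complex.ofRealCLM.comp (ContinuousLinearMap.fst ℝ ℝ ℝ)
  let da : ℝ × ℝ →L[ℝ] ℂ := Complex.ofRealCLM.comp (ContinuousLinearMap.snd ℝ ℝ ℝ)
  have hds : ∀ q, HasFDerivAt (fun q : ℝ × ℝ => (q.1 : ℂ)) ds q := fun q => ds.hasFDerivAt
  have hda : ∀ q, HasFDerivAt (fun q : ℝ × ℝ => (q.2 : ℂ)) da q := fun q => da.hasFDerivAt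
  have hexp : ∀ q : ℝ × ℝ, HasFDerivAt (fun q : ℝ × ℝ => Complex.exp (q.2 * Complex.I))
      (Complex.exp (q.2 * Complex.I) • (Complex.I • da)) q := fun q => by
    simpa using ((hda q).mul_const Complex.I).cexp
  have hγ : ∀ q, HasFDerivAt γ (D q • ds + T q • da) q := fun q => by
    have h := (((hds q).mul_const (c₂ - c₁)).const_add c₁).add
      ((((hds q).mul_const ((r₂ : ℂ) - r₁)).const_add (r₁ : ℂ)).mul (hexp q))
    refine h.congr_fderiv ?_
    ext <;> simp [D, T, ds, da] <;> ring
  have hD : ∀ q, HasFDerivAt D (((r₂ - r₁) * (Complex.exp (q.2 * Complex.I) * Complex.I)) • da) q :=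
    fun q => by
      refine (((hexp q).const_mul ((r₂ : ℂ) - r₁)).const_add (c₂ - c₁)).congr_fderiv ?_
      ext <;> simp [da]
  have hT : ∀ q, HasFDerivAt T (((r₂ - r₁) * (Complex.exp (q.2 * Complex.I) * Complex.I)) • ds +
      ((r₁ + q.1 * (r₂ - r₁)) * (Complex.exp (q.2 * Complex.I) * Complex.I * Complex.I)) • da) q :=
    fun q => by
      refine ((((hds q).mul_const ((r₂ : ℂ) - r₁)).const_add (r₁ : ℂ)).mul
        ((hexp q).mul_const Complex.I)).congr_fderiv ?_
      ext <;> simp [ds, da] <;> first | ring1 | (ring_nf; simp)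
  have hfγ : ∀ q : ℝ × ℝ, q.1 ∈ Icc (0 : ℝ) 1 →
      HasFDerivAt (fun q => f (γ q)) (deriv f (γ q) • (D q • ds + T q • da)) q := fun q hq => by
    have h := (hf.differentiableAt (hO.mem_nhds (hγmem q hq))).hasDerivAt
    exact h.comp_hasFDerivAt q (hγ q)
  have hfγc : ContinuousOn (fun q => f (γ q)) (uIcc 0 1 ×ˢ uIcc 0 (2 * Real.pi)) := by
    refine hf.continuousOn.comp hγc.continuousOn ?_
    rintro q ⟨hq, -⟩
    rw [uIcc_of_le zero_le_one] at hq
    exact hγmem q hq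
  have hTc : Continuous T := by fun_prop
  have hDc : Continuous D := by fun_prop
  let P' : ℝ × ℝ → ℝ × ℝ →L[ℝ] ℂ := fun q =>
    f (γ q) • (((r₂ - r₁) * (Complex.exp (q.2 * Complex.I) * Complex.I)) • ds +
      ((r₁ + q.1 * (r₂ - r₁)) * (Complex.exp (q.2 * Complex.I) * Complex.I * Complex.I)) • da) +
    T q • (deriv f (γ q) • (D q • ds + T q • da))
  let Q' : ℝ × ℝ → ℝ × ℝ →L[ℝ] ℂ := fun q =>
    -(f (γ q) • (((r₂ - r₁) * (Complex.exp (q.2 * Complex.I) * Complex.I)) • da) +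
    D q • (deriv f (γ q) • (D q • ds + T q • da)))
  -- The pullback of `f dz` is closed, since `∂T/∂s = ∂D/∂a`. The divergence theorem then compares
  -- the two circles, and the sides at angles `0` and `2π` cancel by periodicity.
  have hzero : ∀ q, P' q (1, 0) + Q' q (0, 1) = 0 := fun q => by
    simp [P', Q', ds, da]; ring
  have hmain := integral2_divergence_prod_of_hasFDerivAt
    (fun q => f (γ q) * T q) (fun q => -(f (γ q) * D q)) P' Q' 0 0 1 (2 * Real.pi)
    (hfγc.mul hTc.continuousOn) (hfγc.mul hDc.continuousOn).neg ?_ ?_ ?_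
  · simp only [hzero] at hmain
    have hper : ∀ x : ℝ, γ (x, 2 * Real.pi) = γ (x, 0) ∧ D (x, 2 * Real.pi) = D (x, 0) := by
      intro x
      simp [γ, D, Complex.exp_two_pi_mul_I]
    simp only [(hper _).1, (hper _).2, sub_self, zero_add, intervalIntegral.integral_zero] at hmain
    rw [eq_comm, sub_eq_zero] at hmain
    simp only [circleIntegral, deriv_circleMap, smul_eq_mul]
    have e1 : ∀ y : ℝ, f (γ (0, y)) * T (0, y) =
        circleMap 0 r₁ y * Complex.I * f (circleMap c₁ r₁ y) := fun y => by
      simp [γ, T, circleMap]; ring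
    have e2 : ∀ y : ℝ, f (γ (1, y)) * T (1, y) =
        circleMap 0 r₂ y * Complex.I * f (circleMap c₂ r₂ y) := fun y => by
      simp [γ, T, circleMap]; ring
    simp only [e1, e2] at hmain
    exact hmain.symm
  · rintro q ⟨hq, -⟩
    rw [min_eq_left zero_le_one, max_eq_right zero_le_one] at hq
    exact (hfγ q ⟨hq.1.le, hq.2.le⟩).mul (hT q)
  · rintro q ⟨hq, -⟩
    rw [min_eq_left zero_le_one, max_eq_right zero_le_one] at hq
    exact ((hfγ q ⟨hq.1.le, hq.2.le⟩).mul (hD q)).neg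
  · simp only [hzero]
    exact integrableOn_zero

/-- The measure space of angles parametrising a circle. -/
abbrev angles : Measure ℝ := volume.restrict (Ioc 0 (2 * Real.pi))

namespace Contour

/-- The point of the contour with angle `a`. -/
def pt (Γ : Contour) (a : ℝ) : ℂ := circleMap Γ.center Γ.radius a

/-- The density of the normalised contour integral with respect to the angle. -/
def weight (Γ : Contour) (a : ℝ) : ℂ := circleMap 0 Γ.radius a / (2 * Real.pi)

theorem continuous_pt (Γ : Contour) : Continuous Γ.pt := continuous_circleMap _ _

theorem continuous_weight (Γ : Contour) : Continuous Γ.weight :=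
  (continuous_circleMap _ _).div_const _

theorem integral_eq (Γ : Contour) (f : ℂ → ℂ) :
    Γ.integral f = ∫ a, Γ.weight a * f (Γ.pt a) ∂angles := by
  simp only [Contour.integral, circleIntegral, deriv_circleMap, smul_eq_mul]
  rw [intervalIntegral.integral_of_le (by positivity), ← integral_const_mul]
  refine integral_congr_ae (Eventually.of_forall fun a => ?_)
  simp only [weight, pt]
  have : (Real.pi : ℂ) ≠ 0 := by exact_mod_cast Real.pi_ne_zero
  field_simp

theorem pt_mem {Γ : Contour} (h : 0 ≤ Γ.radius) (a : ℝ) : Γ.pt a ∈ Γ.points :=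
  circleMap_mem_sphere _ h _

theorem norm_weight (Γ : Contour) (a : ℝ) : ‖Γ.weight a‖ = |Γ.radius| / (2 * Real.pi) := by
  rw [weight, norm_div, norm_circleMap_zero]
  congr 1
  rw [norm_mul, Complex.norm_real, Real.norm_of_nonneg Real.pi_pos.le]; simp

theorem isCompact_points (Γ : Contour) : IsCompact Γ.points := isCompact_sphere _ _

theorem integral_congr {Γ : Contour} (h : 0 ≤ Γ.radius) {f g : ℂ → ℂ}
    (hfg : ∀ z ∈ Γ.points, f z = g z) : Γ.integral f = Γ.integral g := by
  simp only [integral_eq]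
  congr 1; ext a; rw [hfg _ (pt_mem h a)]

theorem integral_const_mul (Γ : Contour) (c : ℂ) (f : ℂ → ℂ) :
    Γ.integral (fun z => c * f z) = c * Γ.integral f := by
  simp only [integral_eq, ← MeasureTheory.integral_const_mul]
  congr 1; ext a; ring

theorem integral_eq_of_convex {U K : Set ℂ} (hU : IsOpen U) (hUc : Convex ℝ U)
    (hK : IsClosed K) {f : ℂ → ℂ} (hf : DifferentiableOn ℂ f (U \ K)) {Γ₁ Γ₂ : Contour}
    (hr₁ : 0 ≤ Γ₁.radius) (hr₂ : 0 ≤ Γ₂.radius) (h₁ : Γ₁.points ⊆ U) (h₂ : Γ₂.points ⊆ U)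
    (hK₁ : ∀ z ∈ K, Γ₁.Encloses z) (hK₂ : ∀ z ∈ K, Γ₂.Encloses z) :
    Γ₁.integral f = Γ₂.integral f := by
  unfold Contour.integral
  rw [circleIntegral_eq_of_convex hU hUc hK hf hr₁ hr₂ h₁ h₂ hK₁ hK₂]

/-- The product of the two weights and of a function on a pair of contours. -/
def density (Γ Γ' : Contour) (H : ℂ → ℂ → ℂ) (q : ℝ × ℝ) : ℂ :=
  Γ.weight q.1 * (Γ'.weight q.2 * H (Γ.pt q.1) (Γ'.pt q.2))

theorem norm_density_le (Γ Γ' : Contour) (H : ℂ → ℂ → ℂ) (q : ℝ × ℝ) :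
    ‖density Γ Γ' H q‖ ≤ |Γ.radius| * |Γ'.radius| * ‖H (Γ.pt q.1) (Γ'.pt q.2)‖ := by
  have hpi : (1 : ℝ) ≤ 2 * Real.pi := by linarith [Real.pi_gt_three]
  rw [density, norm_mul, norm_mul, norm_weight, norm_weight, ← mul_assoc]
  gcongr
  · exact div_le_self (abs_nonneg _) hpi
  · exact div_le_self (abs_nonneg _) hpi

theorem integral_integral {Γ Γ' : Contour} {H : ℂ → ℂ → ℂ}
    (h : Integrable (density Γ Γ' H) (angles.prod angles)) :
    (Γ.integral fun v => Γ'.integral fun u => H v u) =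
      ∫ q, density Γ Γ' H q ∂(angles.prod angles) := by
  rw [integral_prod _ h]
  simp only [integral_eq, ← MeasureTheory.integral_const_mul, density]

theorem continuous_density {Γ Γ' : Contour} {H : ℂ → ℂ → ℂ} (hr : 0 ≤ Γ.radius)
    (hr' : 0 ≤ Γ'.radius) (hH : ContinuousOn (fun q : ℂ × ℂ => H q.1 q.2) (Γ.points ×ˢ Γ'.points)) :
    Continuous (density Γ Γ' H) := by
  have h1 : Continuous fun q : ℝ × ℝ => H (Γ.pt q.1) (Γ'.pt q.2) :=
    hH.comp_continuous (f := fun q : ℝ × ℝ => (Γ.pt q.1, Γ'.pt q.2))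
      ((Γ.continuous_pt.comp continuous_fst).prodMk (Γ'.continuous_pt.comp continuous_snd))
      fun q => ⟨pt_mem hr _, pt_mem hr' _⟩
  exact (Γ.continuous_weight.comp continuous_fst).mul
    ((Γ'.continuous_weight.comp continuous_snd).mul h1)

theorem integrable_density {Γ Γ' : Contour} {H : ℂ → ℂ → ℂ} (hr : 0 ≤ Γ.radius)
    (hr' : 0 ≤ Γ'.radius) (hH : ContinuousOn (fun q : ℂ × ℂ => H q.1 q.2) (Γ.points ×ˢ Γ'.points)) :
    Integrable (density Γ Γ' H) (angles.prod angles) := by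
  obtain ⟨C, hC⟩ := (Γ.isCompact_points.prod Γ'.isCompact_points).exists_bound_of_continuousOn hH
  refine Integrable.of_bound (continuous_density hr hr' hH).aestronglyMeasurable
    (|Γ.radius| * |Γ'.radius| * C) (Eventually.of_forall fun q => ?_)
  refine (norm_density_le _ _ _ _).trans ?_
  gcongr
  exact hC (Γ.pt q.1, Γ'.pt q.2) ⟨pt_mem hr _, pt_mem hr' _⟩

theorem integral_comm {Γ Γ' : Contour} {H : ℂ → ℂ → ℂ} (hr : 0 ≤ Γ.radius)
    (hr' : 0 ≤ Γ'.radius) (hH : ContinuousOn (fun q : ℂ × ℂ => H q.1 q.2) (Γ.points ×ˢ Γ'.points)) :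
    (Γ.integral fun v => Γ'.integral fun u => H v u) =
      Γ'.integral fun u => Γ.integral fun v => H v u := by
  have h1 := integrable_density hr hr' hH
  have h2 : Integrable (density Γ' Γ fun u v => H v u) (angles.prod angles) := by
    refine h1.swap.congr (Eventually.of_forall fun q => ?_)
    simp only [Function.comp, density, Prod.swap]; ring
  rw [integral_integral h1, integral_integral h2, ← integral_prod_swap]
  refine integral_congr_ae (Eventually.of_forall fun q => ?_)
  simp only [density, Prod.swap]; ring

end Contour

/-! ### The common factor and independence of the contours. -/

section
/-- The pairs of points at which `commonFactor` is holomorphic. -/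
structure Regular {n m : ℕ} (p : Fin n → ℝ) (θ : Fin m → ℝ) (v u : ℂ) : Prop where
  left_ne : v ≠ 0
  right_ne : u ≠ 0
  ne : u ≠ v
  left_sub : ∀ k, v - (p k : ℂ) ≠ 0
  right_sub : ∀ l, u - (θ l : ℂ) ≠ 0

variable {n m : ℕ} {p : Fin n → ℝ} {θ : Fin m → ℝ}

theorem Regular.differentiableAt (ν : ℕ) {v u : ℂ} (h : Regular p θ v u) :
    DifferentiableAt ℂ (fun q : ℂ × ℂ => commonFactor ν p θ q.1 q.2) (v, u) := by
  have h1 : u - v ≠ 0 := sub_ne_zero.2 h.ne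
  have hv := h.left_ne
  have hu := h.right_ne
  unfold commonFactor
  have h1' : AnalyticAt ℂ (fun q : ℂ × ℂ => q.1) (v, u) := analyticAt_fst
  have h2' : AnalyticAt ℂ (fun q : ℂ × ℂ => q.2) (v, u) := analyticAt_snd
  have hz : AnalyticAt ℂ (fun q : ℂ × ℂ => (q.1 / q.2) ^ ((ν : ℤ) + (n : ℤ) - (m : ℤ)))
      (v, u) := (h1'.fun_div h2' hu).fun_zpow (div_ne_zero hv hu)
  have hp : AnalyticAt ℂ (fun q : ℂ × ℂ => ∏ k : Fin n, (q.2 - (p k : ℂ)) / (q.1 - (p k : ℂ)))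
      (v, u) := Finset.analyticAt_fun_prod _ fun k _ =>
        (h2'.fun_sub analyticAt_const).fun_div (h1'.fun_sub analyticAt_const) (h.left_sub k)
  have hq : AnalyticAt ℂ (fun q : ℂ × ℂ => ∏ k : Fin m, (q.1 - (θ k : ℂ)) / (q.2 - (θ k : ℂ)))
      (v, u) := Finset.analyticAt_fun_prod _ fun k _ =>
        (h1'.fun_sub analyticAt_const).fun_div (h2'.fun_sub analyticAt_const) (h.right_sub k)
  have he : AnalyticAt ℂ (fun q : ℂ × ℂ => Complex.exp (-1 / q.2 + 1 / q.1) / (q.2 - q.1))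
      (v, u) :=
    ((analyticAt_const.fun_div h2' hu).fun_add (analyticAt_const.fun_div h1' hv)).cexp.fun_div
      (h2'.fun_sub h1') h1
  exact (((he.fun_mul hz).fun_mul hp).fun_mul hq).differentiableAt

section
variable {Γin Γout : Contour}

theorem Contour.Encloses.radius_pos {Γ : Contour} {z : ℂ} (h : Γ.Encloses z) : 0 < Γ.radius :=
  dist_nonneg.trans_lt h

theorem Admissible.radius_in_pos (h : Admissible p θ Γin Γout) : 0 < Γin.radius :=
  h.zero_in.radius_pos

theorem Admissible.radius_out_pos (h : Admissible p θ Γin Γout) : 0 < Γout.radius :=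
  (h.nested _ (Contour.pt_mem h.radius_in_pos.le 0)).radius_pos

theorem Admissible.encloses_closedBall (h : Admissible p θ Γin Γout) {z : ℂ}
    (hz : dist z Γin.center ≤ Γin.radius) : Γout.Encloses z := by
  have hs : Metric.sphere Γin.center Γin.radius ⊆ Metric.ball Γout.center Γout.radius := h.nested
  have h1 := convexHull_min hs (convex_ball _ _)
  rw [convexHull_sphere_eq_closedBall Γin.center h.radius_in_pos.le] at h1
  exact h1 hz

theorem Admissible.regular (h : Admissible p θ Γin Γout) {v u : ℂ} (hv : v ∈ Γout.points)
    (hu : u ∈ Γin.points) : Regular p θ v u := by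
  have hv' : dist v Γout.center = Γout.radius := hv
  have hu' : dist u Γin.center = Γin.radius := hu
  refine ⟨?_, ?_, ?_, fun k hk => ?_, fun l hl => ?_⟩
  · rintro rfl
    have := h.encloses_closedBall h.zero_in.le
    exact this.ne hv'
  · rintro rfl
    exact h.zero_in.ne hu'
  · rintro rfl
    exact (h.nested _ hu).ne hv'
  · rw [sub_eq_zero] at hk
    exact (h.pi_out k).ne (hk ▸ hv')
  · rw [sub_eq_zero] at hl
    exact (h.theta_in l).ne (hl ▸ hu')

theorem Admissible.continuousOn (h : Admissible p θ Γin Γout) (ν : ℕ) :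
    ContinuousOn (fun q : ℂ × ℂ => commonFactor ν p θ q.1 q.2) (Γout.points ×ˢ Γin.points) :=
  fun _ hq => ((h.regular hq.1 hq.2).differentiableAt ν).continuousAt.continuousWithinAt

theorem Admissible.continuousOn_mul (h : Admissible p θ Γin Γout) (ν : ℕ) {F G : ℂ → ℂ}
    (hF : ContinuousOn F Γout.points) (hG : ContinuousOn G Γin.points) :
    ContinuousOn (fun q : ℂ × ℂ => F q.1 * G q.2 * commonFactor ν p θ q.1 q.2)
      (Γout.points ×ˢ Γin.points) :=
  ((hF.comp continuousOn_fst fun _ h => h.1).mul (hG.comp continuousOn_snd fun _ h => h.2)).mul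
    (h.continuousOn ν)

variable {Γin' Γout' : Contour}

/-- With the order of integration exchanged, `u` is fixed on the inner circle, and the singularities
in `v` are `0`, `u` and the `p k`, all inside both outer circles. -/
theorem Admissible.integral_eq_of_out (h : Admissible p θ Γin Γout) (h' : Admissible p θ Γin Γout')
    (ν : ℕ) {F G : ℂ → ℂ} (hF : Differentiable ℂ F) (hG : ContinuousOn G Γin.points) :
    (Γout.integral fun v => Γin.integral fun u => F v * G u * commonFactor ν p θ v u) =
      Γout'.integral fun v => Γin.integral fun u => F v * G u * commonFactor ν p θ v u := by
  rw [Contour.integral_comm h.radius_out_pos.le h.radius_in_pos.le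
      (h.continuousOn_mul ν hF.continuous.continuousOn hG),
    Contour.integral_comm h'.radius_out_pos.le h'.radius_in_pos.le
      (h'.continuousOn_mul ν hF.continuous.continuousOn hG)]
  refine Contour.integral_congr h.radius_in_pos.le fun u hu => ?_
  refine Contour.integral_eq_of_convex (U := univ)
    (K := {0} ∪ {u} ∪ range fun k => (p k : ℂ)) isOpen_univ convex_univ
    (((finite_singleton _).union (finite_singleton _)).union (finite_range _)).isClosed ?_
    h.radius_out_pos.le h'.radius_out_pos.le (subset_univ _) (subset_univ _) ?_ ?_
  · rintro v ⟨-, hv⟩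
    simp only [mem_union, mem_singleton_iff, mem_range, not_or, not_exists] at hv
    have hu' : dist u Γin.center = Γin.radius := hu
    have hreg : Regular p θ v u := by
      refine ⟨hv.1.1, ?_, fun e => hv.1.2 e.symm, fun k hk => hv.2 k (sub_eq_zero.1 hk).symm,
        fun l hl => ?_⟩
      · rintro rfl; exact h.zero_in.ne hu'
      · exact (h.theta_in l).ne (sub_eq_zero.1 hl ▸ hu')
    have hd := hreg.differentiableAt ν
    have hc : DifferentiableAt ℂ (fun v => commonFactor ν p θ v u) v :=
      hd.comp (f := fun v : ℂ => (v, u)) v (by fun_prop)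
    exact (((hF v).mul_const _).mul hc).differentiableWithinAt
  · rintro z ((rfl | rfl) | ⟨k, rfl⟩)
    exacts [h.encloses_closedBall h.zero_in.le, h.nested _ hu, h.pi_out k]
  · rintro z ((rfl | rfl) | ⟨k, rfl⟩)
    exacts [h'.encloses_closedBall h.zero_in.le, h'.nested _ hu, h'.pi_out k]

/-- For `v` on the common outer circle, the pole `u = v` and the zeros of `v - p k` play no role in
the open disc, where only `0` and the `θ l` are singular. The disc is the convex set in which the
inner circle moves. -/
theorem Admissible.integral_eq_of_in (h : Admissible p θ Γin Γout) (h' : Admissible p θ Γin' Γout)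
    (ν : ℕ) {F G : ℂ → ℂ} (hG : ∀ u, u ≠ 0 → DifferentiableAt ℂ G u) :
    (Γout.integral fun v => Γin.integral fun u => F v * G u * commonFactor ν p θ v u) =
      Γout.integral fun v => Γin'.integral fun u => F v * G u * commonFactor ν p θ v u := by
  refine Contour.integral_congr h.radius_out_pos.le fun v hv => ?_
  have hv' : dist v Γout.center = Γout.radius := hv
  refine Contour.integral_eq_of_convex (U := Metric.ball Γout.center Γout.radius)
    (K := {0} ∪ range fun k => (θ k : ℂ)) Metric.isOpen_ball (convex_ball _ _)
    ((finite_singleton _).union (finite_range _)).isClosed ?_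
    h.radius_in_pos.le h'.radius_in_pos.le h.nested h'.nested ?_ ?_
  · rintro u ⟨hu, hu2⟩
    simp only [mem_union, mem_singleton_iff, mem_range, not_or, not_exists] at hu2
    have hu' : dist u Γout.center < Γout.radius := hu
    have hreg : Regular p θ v u := by
      refine ⟨?_, hu2.1, ?_, fun k hk => ?_, fun l hl => hu2.2 l (sub_eq_zero.1 hl).symm⟩
      · rintro rfl
        exact (h.encloses_closedBall h.zero_in.le).ne hv'
      · rintro rfl; exact hu'.ne hv'
      · exact (h.pi_out k).ne (sub_eq_zero.1 hk ▸ hv')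
    have hc : DifferentiableAt ℂ (fun u => commonFactor ν p θ v u) u :=
      (hreg.differentiableAt ν).comp (f := fun u : ℂ => (v, u)) u (by fun_prop)
    exact (((hG u hu2.1).const_mul _).mul hc).differentiableWithinAt
  · rintro z (rfl | ⟨k, rfl⟩)
    exacts [h.zero_in, h.theta_in k]
  · rintro z (rfl | ⟨k, rfl⟩)
    exacts [h'.zero_in, h'.theta_in k]

/-- The iterated integral does not depend on the choice of the contours. -/
theorem Admissible.integral_eq (h : Admissible p θ Γin Γout) (h' : Admissible p θ Γin' Γout')
    (ν : ℕ) {F G : ℂ → ℂ} (hF : Differentiable ℂ F) (hG : ∀ u, u ≠ 0 → DifferentiableAt ℂ G u) :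
    (Γout.integral fun v => Γin.integral fun u => F v * G u * commonFactor ν p θ v u) =
      Γout'.integral fun v => Γin'.integral fun u => F v * G u * commonFactor ν p θ v u := by
  -- A circle about `0` large enough for both inner contours and all `p k`. Two nested pairs are
  -- joined by enlarging the outer circle to it, moving the inner circle inside, and shrinking back.
  set R : ℝ := dist Γin.center 0 + Γin.radius + (dist Γin'.center 0 + Γin'.radius) +
    ∑ k, |p k| + 1 with hR
  have hsum : 0 ≤ ∑ k, |p k| := Finset.sum_nonneg fun _ _ => abs_nonneg _
  have r1 := h.radius_in_pos
  have r2 := h'.radius_in_pos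
  have d1 : 0 ≤ dist Γin.center 0 := dist_nonneg
  have d2 : 0 ≤ dist Γin'.center 0 := dist_nonneg
  have hp : ∀ k, (⟨0, R⟩ : Contour).Encloses (p k : ℂ) := fun k => by
    have := Finset.single_le_sum (f := fun k => |p k|) (fun _ _ => abs_nonneg _) (Finset.mem_univ k)
    simp only [Contour.Encloses, dist_zero_right, Complex.norm_real, Real.norm_eq_abs]
    linarith
  have hb : Admissible p θ Γin ⟨0, R⟩ := by
    refine ⟨h.zero_in, h.theta_in, hp, fun z hz => ?_⟩
    have hz' : dist z Γin.center = Γin.radius := hz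
    have := dist_triangle z Γin.center 0
    simp only [Contour.Encloses]; linarith
  have hb' : Admissible p θ Γin' ⟨0, R⟩ := by
    refine ⟨h'.zero_in, h'.theta_in, hp, fun z hz => ?_⟩
    have hz' : dist z Γin'.center = Γin'.radius := hz
    have := dist_triangle z Γin'.center 0
    simp only [Contour.Encloses]; linarith
  have hGc : ∀ {Γ Δ : Contour}, Admissible p θ Γ Δ → ContinuousOn G Γ.points :=
    fun hΓ u hu => (hG u (hΓ.regular (Contour.pt_mem hΓ.radius_out_pos.le 0) hu).right_ne)
      |>.continuousAt.continuousWithinAt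
  rw [h.integral_eq_of_out hb ν hF (hGc h), hb.integral_eq_of_in hb' ν hG,
    hb'.integral_eq_of_out h' ν hF (hGc h')]

end

/-! ### The Bessel function `I_κ` as an entire series and as a contour integral. -/

/-- The entire function `∑ w^k / (k! (k + κ)!)`. -/
def besselSeries (κ : ℕ) (w : ℂ) : ℂ :=
  ∑' k : ℕ, w ^ k / ((k.factorial : ℂ) * ((k + κ).factorial : ℂ))

theorem norm_besselSeries_term_le (κ k : ℕ) {w : ℂ} {R : ℝ} (hw : ‖w‖ ≤ R) :
    ‖w ^ k / ((k.factorial : ℂ) * ((k + κ).factorial : ℂ))‖ ≤ R ^ k / k.factorial := by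
  rw [norm_div, norm_mul, norm_pow, Complex.norm_natCast, Complex.norm_natCast]
  have h1 : (1 : ℝ) ≤ (k + κ).factorial := by exact_mod_cast Nat.one_le_iff_ne_zero.2 (Nat.factorial_ne_zero _)
  have h2 : (0 : ℝ) < k.factorial := by exact_mod_cast Nat.factorial_pos _
  have hR : 0 ≤ R := (norm_nonneg _).trans hw
  gcongr
  exact le_mul_of_one_le_right h2.le h1

theorem differentiable_besselSeries (κ : ℕ) : Differentiable ℂ (besselSeries κ) := by
  intro w
  have h := Complex.differentiableOn_tsum_of_summable_norm
    (Real.summable_pow_div_factorial (‖w‖ + 1))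
    (F := fun k w => w ^ k / ((k.factorial : ℂ) * ((k + κ).factorial : ℂ)))
    (U := Metric.ball 0 (‖w‖ + 1)) (fun k => by fun_prop) Metric.isOpen_ball
    (fun k z hz => norm_besselSeries_term_le κ k (mem_ball_zero_iff.1 hz).le)
  exact h.differentiableAt (Metric.isOpen_ball.mem_nhds (by simp))

theorem besselI_eq (κ : ℕ) (z : ℂ) : besselI κ z = (z / 2) ^ κ * besselSeries κ ((z / 2) ^ 2) := by
  rw [besselI, besselSeries, ← tsum_mul_left]
  congr 1; ext k
  rw [pow_add, pow_mul]; ring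

theorem Contour.integral_pow_mul_exp {r : ℝ} (hr : 0 < r) (j : ℕ) (a : ℂ) :
    (⟨0, r⟩ : Contour).integral (fun s => s ^ (-(j : ℤ) - 1) * Complex.exp (a * s)) =
      a ^ j / j.factorial := by
  have h := DifferentiableOn.circleIntegral_one_div_sub_center_pow_smul (c := 0) hr j
    (f := fun s => Complex.exp (a * s)) (by fun_prop)
  rw [iteratedDeriv_cexp_const_mul] at h
  simp only [Contour.integral]
  have e : ∀ s : ℂ, s ^ (-(j : ℤ) - 1) * Complex.exp (a * s) =
      (1 / (s - 0) ^ (j + 1)) • Complex.exp (a * s) := fun s => by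
    rw [sub_zero, smul_eq_mul, one_div, ← zpow_natCast, ← zpow_neg]; push_cast
    congr 2; ring
  simp only [e, h]
  have : (Real.pi : ℂ) ≠ 0 := by exact_mod_cast Real.pi_ne_zero
  have h2 : (j.factorial : ℂ) ≠ 0 := by exact_mod_cast Nat.factorial_ne_zero j
  simp only [mul_zero, Complex.exp_zero, mul_one, smul_eq_mul]
  have := Complex.I_ne_zero
  field_simp

/-- Expand `e^(b/s)` and integrate termwise: each term picks the Taylor coefficient of index `k + κ`
of `e^(as)`. The bound `e^‖a‖ ‖b‖^k / k!` on the unit circle justifies the exchange. -/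
theorem Contour.integral_unit_exp_add (κ : ℕ) (a b : ℂ) :
    (⟨0, 1⟩ : Contour).integral
      (fun s => s ^ (-(κ : ℤ) - 1) * Complex.exp (a * s + b / s)) =
      a ^ κ * besselSeries κ (a * b) := by
  have hterm : ∀ k : ℕ, (⟨0, 1⟩ : Contour).integral
      (fun s => s ^ (-(κ : ℤ) - 1) * Complex.exp (a * s) * ((b / s) ^ k / k.factorial)) =
      a ^ κ * ((a * b) ^ k / ((k.factorial : ℂ) * ((k + κ).factorial : ℂ))) := fun k => by
    have h := Contour.integral_pow_mul_exp one_pos (k + κ) a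
    rw [Contour.integral_congr (g := fun s => (b ^ k / k.factorial) *
      (s ^ (-((k + κ : ℕ) : ℤ) - 1) * Complex.exp (a * s))) zero_le_one,
      Contour.integral_const_mul, h]
    · rw [mul_pow, pow_add]; field_simp
    · intro s hs
      have hs0 : s ≠ 0 := by
        rintro rfl
        have : dist (0 : ℂ) 0 = 1 := hs
        simp at this
      have e : (s : ℂ) ^ (-((k + κ : ℕ) : ℤ) - 1) = s ^ (-(κ : ℤ) - 1) * (s ^ k)⁻¹ := by
        rw [← zpow_natCast, ← zpow_neg, ← zpow_add₀ hs0]; congr 1; push_cast; ring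
      rw [e, div_pow]; field_simp
  rw [besselSeries, ← tsum_mul_left]
  simp only [← hterm, Contour.integral_eq]
  have hs1 : ∀ t, ‖(⟨0, 1⟩ : Contour).pt t‖ = 1 := fun t => by
    simp [Contour.pt, circleMap]
  have hs0 : ∀ t, (⟨0, 1⟩ : Contour).pt t ≠ 0 := fun t h => by
    have := hs1 t; rw [h] at this; simp at this
  set C : Contour := ⟨0, 1⟩
  have hcont : Continuous fun t => C.weight t * (C.pt t ^ (-(κ : ℤ) - 1) *
      Complex.exp (a * C.pt t)) := by
    have h1 := C.continuous_weight
    have h2 := C.continuous_pt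
    exact h1.mul ((h2.zpow₀ _ fun t => Or.inl (hs0 t)).mul (by fun_prop))
  have hcont2 : ∀ k : ℕ, Continuous fun t => (b / C.pt t) ^ k / (k.factorial : ℂ) := fun k =>
    ((continuous_const.div C.continuous_pt hs0).pow k).div_const _
  have hbd : ∀ t, ‖C.weight t * (C.pt t ^ (-(κ : ℤ) - 1) * Complex.exp (a * C.pt t))‖ ≤
      Real.exp ‖a‖ := fun t => by
    rw [norm_mul, norm_mul, norm_zpow, hs1, one_zpow, one_mul, Contour.norm_weight]
    have h1 : ‖Complex.exp (a * C.pt t)‖ ≤ Real.exp ‖a‖ := by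
      refine (Complex.norm_exp_le_exp_norm _).trans ?_
      rw [norm_mul, hs1, mul_one]
    have h2 : |C.radius| / (2 * Real.pi) ≤ 1 := by
      rw [div_le_one (by positivity)]
      have : |C.radius| = 1 := by simp [C]
      rw [this]; linarith [Real.pi_gt_three]
    calc _ ≤ 1 * Real.exp ‖a‖ := by gcongr
      _ = _ := one_mul _
  symm
  refine (hasSum_integral_of_dominated_convergence
    (F := fun k t => C.weight t * (C.pt t ^ (-(κ : ℤ) - 1) * Complex.exp (a * C.pt t) *
      ((b / C.pt t) ^ k / (k.factorial : ℂ))))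
    (fun k _ => Real.exp ‖a‖ * (‖b‖ ^ k / k.factorial)) (fun k => ?_) (fun k => ?_) ?_ ?_ ?_).tsum_eq
  · refine ((hcont.mul (hcont2 k)).aestronglyMeasurable).congr (Eventually.of_forall fun t => ?_)
    simp only [Pi.mul_apply]; ring
  · refine Eventually.of_forall fun t => ?_
    rw [← mul_assoc, norm_mul]
    refine mul_le_mul (hbd t) ?_ (norm_nonneg _) (Real.exp_pos _).le
    rw [norm_div, norm_pow, norm_div, hs1, div_one, Complex.norm_natCast]
  · exact Eventually.of_forall fun t => (Real.summable_pow_div_factorial _).mul_left _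
  · exact integrable_const _
  · refine Eventually.of_forall fun t => ?_
    have h := NormedSpace.expSeries_div_hasSum_exp (b / C.pt t)
    rw [← Complex.exp_eq_exp_ℂ] at h
    have h2 : HasSum (fun k : ℕ => C.weight t * (C.pt t ^ (-(κ : ℤ) - 1) *
        Complex.exp (a * C.pt t)) * ((b / C.pt t) ^ k / (k.factorial : ℂ)))
        (C.weight t * (C.pt t ^ (-(κ : ℤ) - 1) * Complex.exp (a * C.pt t)) *
          Complex.exp (b / C.pt t)) := h.mul_left _
    simpa only [Complex.exp_add, mul_assoc] using h2

theorem Contour.integral_exp_add {Γ : Contour} (hΓ : Γ.Encloses 0) (κ : ℕ) (a b : ℂ) :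
    Γ.integral (fun s => s ^ (-(κ : ℤ) - 1) * Complex.exp (a * s + b / s)) =
      a ^ κ * besselSeries κ (a * b) := by
  rw [← Contour.integral_unit_exp_add]
  refine Contour.integral_eq_of_convex (K := {0}) isOpen_univ convex_univ isClosed_singleton ?_
    hΓ.radius_pos.le zero_le_one (subset_univ _) (subset_univ _) (by rintro z rfl; exact hΓ)
    (by rintro z rfl; simp [Contour.Encloses])
  rintro s ⟨-, hs⟩
  have hs0 : s ≠ 0 := hs
  refine DifferentiableAt.differentiableWithinAt ?_
  refine (differentiableAt_id.zpow (Or.inl hs0)).mul (DifferentiableAt.cexp ?_)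
  exact (by fun_prop : DifferentiableAt ℂ (fun s => a * s) s).add
    (DifferentiableAt.fun_div (by fun_prop) (by fun_prop) hs0)
end

/-! ### The function `K_κ` as a heat-type integral, its recurrence, and its pairing with contour
integrals. -/

section
theorem integrableOn_pow_mul_exp_neg (k : ℕ) :
    IntegrableOn (fun t : ℝ => t ^ k * Real.exp (-t)) (Ioi 0) := by
  have h := Real.GammaIntegral_convergent (s := k + 1) (by positivity)
  refine h.congr_fun (fun t _ => ?_) measurableSet_Ioi
  simp only [add_sub_cancel_right, Real.rpow_natCast]; ring

/-- The weight `t^(k-1) e^(-t-E/t)`. -/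
def heat (k : ℕ) (E t : ℝ) : ℂ := (t : ℂ) ^ ((k : ℤ) - 1) * Complex.exp (-(t : ℂ) - E / t)

theorem measurable_heat (k : ℕ) (E : ℝ) : Measurable (heat k E) := by
  unfold heat
  exact ((Complex.measurable_ofReal).pow_const _).mul (by fun_prop)

/-- The integral `∫_0^∞ t^(k-1) e^(-t-w/t) dt`. -/
def besselInt (k : ℕ) (w : ℂ) : ℂ :=
  ∫ t in Ioi (0 : ℝ), (t : ℂ) ^ ((k : ℤ) - 1) * Complex.exp (-(t : ℂ) - w / t)

theorem heat_mul_exp (k : ℕ) (E y : ℝ) (u : ℂ) (t : ℝ) :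
    heat k E t * Complex.exp (u * ((y / t : ℝ) : ℂ)) =
      (t : ℂ) ^ ((k : ℤ) - 1) * Complex.exp (-(t : ℂ) - (E - u * y) / t) := by
  rw [heat, mul_assoc, ← Complex.exp_add]; push_cast; congr 2; ring

/-- The inequality `e^(-η/t) ≤ t/η` supplies the factor `t` which cancels the possible `t^(-1)` at
the origin. -/
theorem norm_zpow_mul_exp_le (k : ℕ) {w : ℂ} {η t : ℝ} (ht : 0 < t) (hη : 0 < η) (hw : η ≤ w.re) :
    ‖(t : ℂ) ^ ((k : ℤ) - 1) * Complex.exp (-(t : ℂ) - w / t)‖ ≤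
      η⁻¹ * (t ^ k * Real.exp (-t)) := by
  rw [norm_mul, norm_zpow, Complex.norm_real, Real.norm_of_nonneg ht.le, Complex.norm_exp]
  have h1 : (-(t : ℂ) - w / t).re = -t - w.re / t := by
    simp [Complex.div_ofReal_re]
  rw [h1, sub_eq_add_neg (-t), Real.exp_add]
  have h2 : Real.exp (-(w.re / t)) ≤ t / η := by
    have h3 : η / t ≤ w.re / t := by gcongr
    have h4 : w.re / t ≤ Real.exp (w.re / t) := by linarith [Real.add_one_le_exp (w.re / t)]
    rw [Real.exp_neg, ← inv_div η t]
    exact inv_anti₀ (by positivity) (h3.trans h4)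
  calc t ^ ((k : ℤ) - 1) * (Real.exp (-t) * Real.exp (-(w.re / t)))
      ≤ t ^ ((k : ℤ) - 1) * (Real.exp (-t) * (t / η)) := by gcongr
    _ = η⁻¹ * (t ^ k * Real.exp (-t)) := by
      rw [zpow_sub₀ ht.ne', zpow_natCast, zpow_one]; field_simp

theorem integrableOn_besselInt (k : ℕ) {w : ℂ} (hw : 0 < w.re) :
    IntegrableOn (fun t : ℝ => (t : ℂ) ^ ((k : ℤ) - 1) * Complex.exp (-(t : ℂ) - w / t))
      (Ioi 0) := by
  refine Integrable.mono' ((integrableOn_pow_mul_exp_neg k).const_mul (w.re)⁻¹) ?_ ?_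
  · exact (((Complex.measurable_ofReal).pow_const _).mul (by fun_prop)).aestronglyMeasurable
  · filter_upwards [ae_restrict_mem measurableSet_Ioi] with t ht
    exact norm_zpow_mul_exp_le k ht hw le_rfl

/-- Integrate the derivative of `t^(k+1) e^(-t-w/t)`, which vanishes at both ends. -/
theorem besselInt_recurrence (k : ℕ) {w : ℂ} (hw : 0 < w.re) :
    (k + 1) * besselInt (k + 1) w - besselInt (k + 2) w + w * besselInt k w = 0 := by
  let g : ℝ → ℂ := fun t => (t : ℂ) ^ (k + 1) * Complex.exp (-(t : ℂ) - w / t)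
  have i0 := integrableOn_besselInt k hw
  have i1 := integrableOn_besselInt (k + 1) hw
  have i2 := integrableOn_besselInt (k + 2) hw
  have hbd : ∀ t : ℝ, 0 < t → ‖g t‖ ≤ w.re⁻¹ * (t ^ (k + 2) * Real.exp (-t)) := fun t ht => by
    have h := norm_zpow_mul_exp_le (k + 2) ht hw le_rfl
    have e : ((t : ℂ) ^ (((k + 2 : ℕ) : ℤ) - 1)) = (t : ℂ) ^ (k + 1) := by
      rw [← zpow_natCast]; congr 1; push_cast; ring
    rwa [e] at h
  have hderiv : ∀ t ∈ Ioi (0 : ℝ), HasDerivAt g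
      ((k + 1) * ((t : ℂ) ^ (((k + 1 : ℕ) : ℤ) - 1) * Complex.exp (-(t : ℂ) - w / t)) -
        (t : ℂ) ^ (((k + 2 : ℕ) : ℤ) - 1) * Complex.exp (-(t : ℂ) - w / t) +
        w * ((t : ℂ) ^ ((k : ℤ) - 1) * Complex.exp (-(t : ℂ) - w / t))) t := by
    intro t ht
    have ht0 : (t : ℂ) ≠ 0 := by exact_mod_cast (ne_of_gt ht)
    have hz : HasDerivAt (fun z : ℂ => z ^ (k + 1) * Complex.exp (-z - w / z))
        (((k + 1 : ℕ) : ℂ) * (t : ℂ) ^ k * Complex.exp (-(t : ℂ) - w / t) + (t : ℂ) ^ (k + 1) *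
          (Complex.exp (-(t : ℂ) - w / t) * (-1 - -(w / (t : ℂ) ^ 2)))) (t : ℂ) := by
      have h1 := hasDerivAt_pow (k + 1) (t : ℂ)
      have h2 : HasDerivAt (fun z : ℂ => -z - w / z) (-1 - -(w / (t : ℂ) ^ 2)) (t : ℂ) := by
        have h3 := (hasDerivAt_inv ht0).const_mul w
        simp only [div_eq_mul_inv]
        exact ((hasDerivAt_id' (t : ℂ)).fun_neg.fun_sub h3).congr_deriv (by ring)
      exact h1.mul h2.cexp
    refine hz.comp_ofReal.congr_deriv ?_
    have e1 : (t : ℂ) ^ (((k + 1 : ℕ) : ℤ) - 1) = (t : ℂ) ^ k := by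
      rw [← zpow_natCast]; congr 1; push_cast; ring
    have e2 : (t : ℂ) ^ (((k + 2 : ℕ) : ℤ) - 1) = (t : ℂ) ^ (k + 1) := by
      rw [← zpow_natCast]; congr 1; push_cast; ring
    have e3 : (t : ℂ) ^ ((k : ℤ) - 1) = (t : ℂ) ^ k / t := by
      rw [zpow_sub₀ ht0, zpow_natCast, zpow_one]
    rw [e1, e2, e3]
    push_cast
    field_simp
    ring
  have hg0 : g 0 = 0 := by simp [g]
  have hcont : ContinuousWithinAt g (Ici 0) 0 := by
    rw [ContinuousWithinAt, hg0]
    refine squeeze_zero_norm' (a := fun t : ℝ => w.re⁻¹ * (t ^ (k + 2) * Real.exp (-t))) ?_ ?_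
    · filter_upwards [self_mem_nhdsWithin] with t ht
      rcases (mem_Ici.1 ht).eq_or_lt with h | h
      · rw [← h, hg0]; simp
      · exact hbd t h
    · have hc : Continuous fun t : ℝ => w.re⁻¹ * (t ^ (k + 2) * Real.exp (-t)) := by fun_prop
      simpa using (hc.tendsto 0).mono_left nhdsWithin_le_nhds
  have htop : Tendsto g atTop (𝓝 0) := by
    refine squeeze_zero_norm' (a := fun t : ℝ => w.re⁻¹ * (t ^ (k + 2) * Real.exp (-t))) ?_ ?_
    · filter_upwards [eventually_gt_atTop 0] with t ht using hbd t ht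
    · simpa using (Real.tendsto_pow_mul_exp_neg_atTop_nhds_zero (k + 2)).const_mul w.re⁻¹
  have h := integral_Ioi_of_hasDerivAt_of_tendsto hcont hderiv
    (((i1.const_mul _).sub i2).add (i0.const_mul _)) htop
  rw [hg0, sub_zero] at h
  rw [← h, besselInt, besselInt, besselInt, ← integral_const_mul, ← integral_const_mul,
    ← integral_sub (i1.const_mul _) i2]
  exact (integral_add ((i1.const_mul _).sub i2) (i0.const_mul _)).symm

variable {n m : ℕ} {p : Fin n → ℝ} {θ : Fin m → ℝ} {Γin Γout : Contour}

/-- By compactness `E - y Re u` has a positive minimum `η` on the inner contour, so `e^(-η/t)` tames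
`t → 0` uniformly and Fubini applies on the product of the contours and the half line. -/
theorem integrable_density_heat {Γ Γ' : Contour} {X : ℂ → ℂ → ℂ} (hr : 0 ≤ Γ.radius)
    (hr' : 0 ≤ Γ'.radius) (hX : ContinuousOn (fun q : ℂ × ℂ => X q.1 q.2) (Γ.points ×ˢ Γ'.points))
    (k : ℕ) {E y : ℝ} (hE : ∀ u ∈ Γ'.points, u.re * y < E) :
    Integrable (fun z : (ℝ × ℝ) × ℝ => Contour.density Γ Γ' X z.1 *
      (heat k E z.2 * Complex.exp (Γ'.pt z.1.2 * ((y / z.2 : ℝ) : ℂ))))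
      ((angles.prod angles).prod (volume.restrict (Ioi 0))) := by
  obtain ⟨η, hη, hηu⟩ : ∃ η, 0 < η ∧ ∀ u ∈ Γ'.points, η ≤ E - u.re * y := by
    obtain ⟨u₀, hu₀, hmin⟩ := Γ'.isCompact_points.exists_isMinOn
      ⟨_, Contour.pt_mem hr' 0⟩ (f := fun u => E - u.re * y) (by fun_prop)
    exact ⟨E - u₀.re * y, by linarith [hE u₀ hu₀], fun u hu => hmin hu⟩
  have hD := Contour.integrable_density hr hr' hX
  refine Integrable.mono' (hD.norm.mul_prod ((integrableOn_pow_mul_exp_neg k).const_mul η⁻¹)) ?_ ?_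
  · have h1 : Measurable (Contour.density Γ Γ' X) :=
      (Contour.continuous_density hr hr' hX).measurable
    have h2 := measurable_heat k E
    have h3 := Γ'.continuous_pt.measurable
    exact ((h1.comp measurable_fst).mul ((h2.comp measurable_snd).mul
      (by fun_prop))).aestronglyMeasurable
  · have : ∀ᵐ z ∂((angles.prod angles).prod (volume.restrict (Ioi (0 : ℝ)))), z.2 ∈ Ioi (0 : ℝ) :=
      Measure.quasiMeasurePreserving_snd.ae (ae_restrict_mem measurableSet_Ioi)
    filter_upwards [this] with z hz
    rw [norm_mul, heat_mul_exp]
    gcongr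
    refine norm_zpow_mul_exp_le k hz hη ?_
    simpa using hηu _ (Contour.pt_mem hr' z.1.2)

theorem integrable_density_besselInt {Γ Γ' : Contour} {X : ℂ → ℂ → ℂ} (hr : 0 ≤ Γ.radius)
    (hr' : 0 ≤ Γ'.radius) (hX : ContinuousOn (fun q : ℂ × ℂ => X q.1 q.2) (Γ.points ×ˢ Γ'.points))
    (k : ℕ) {E y : ℝ} (hE : ∀ u ∈ Γ'.points, u.re * y < E) :
    Integrable (Contour.density Γ Γ' fun v u => X v u * besselInt k (E - u * y))
      (angles.prod angles) := by
  refine (integrable_density_heat hr hr' hX k hE).integral_prod_left.congr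
    (Eventually.of_forall fun q => ?_)
  simp only [heat_mul_exp, integral_const_mul, Contour.density, besselInt]; ring

theorem integral_heat_mul {Γ Γ' : Contour} {X : ℂ → ℂ → ℂ} (hr : 0 ≤ Γ.radius)
    (hr' : 0 ≤ Γ'.radius) (hX : ContinuousOn (fun q : ℂ × ℂ => X q.1 q.2) (Γ.points ×ˢ Γ'.points))
    (k : ℕ) {E y : ℝ} (hE : ∀ u ∈ Γ'.points, u.re * y < E) :
    IntegrableOn (fun t : ℝ => heat k E t * Γ.integral fun v => Γ'.integral fun u =>
      X v u * Complex.exp (u * ((y / t : ℝ) : ℂ))) (Ioi 0) ∧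
    ∫ t in Ioi (0 : ℝ), (heat k E t * Γ.integral fun v => Γ'.integral fun u =>
      X v u * Complex.exp (u * ((y / t : ℝ) : ℂ))) =
      ∫ q, Contour.density Γ Γ' (fun v u => X v u * besselInt k (E - u * y)) q
        ∂(angles.prod angles) := by
  have h := integrable_density_heat hr hr' hX k hE
  have e1 : ∀ t : ℝ, (heat k E t * Γ.integral fun v => Γ'.integral fun u =>
      X v u * Complex.exp (u * ((y / t : ℝ) : ℂ))) = ∫ q, Contour.density Γ Γ' X q *
      (heat k E t * Complex.exp (Γ'.pt q.2 * ((y / t : ℝ) : ℂ))) ∂(angles.prod angles) := by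
    intro t
    rw [Contour.integral_integral, ← integral_const_mul]
    · congr 1; ext q; simp only [Contour.density]; ring
    · exact Contour.integrable_density hr hr' (hX.mul (by fun_prop))
  simp only [e1]
  refine ⟨h.integral_prod_right, ?_⟩
  rw [integral_integral_swap (f := fun t q => Contour.density Γ Γ' X q *
    (heat k E t * Complex.exp (Γ'.pt q.2 * ((y / t : ℝ) : ℂ)))) h.swap]
  congr 1; ext q
  rw [integral_const_mul]
  simp only [heat_mul_exp, Contour.density, besselInt]; ring

/-- The double contour integral of `F(v) e^(uy) u^(-l)` against the common factor. -/
def loopIntegral (ν : ℕ) (p : Fin n → ℝ) (θ : Fin m → ℝ) (Γin Γout : Contour) (F : ℂ → ℂ) (l : ℕ)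
    (y : ℝ) : ℂ :=
  Γout.integral fun v => Γin.integral fun u =>
    F v * (Complex.exp (u * (y : ℂ)) * (u ^ l)⁻¹) * commonFactor ν p θ v u

theorem Admissible.loopIntegral_eq {Γin' Γout' : Contour} (h : Admissible p θ Γin Γout)
    (h' : Admissible p θ Γin' Γout') (ν : ℕ) {F : ℂ → ℂ} (hF : Differentiable ℂ F) (l : ℕ) (y : ℝ) :
    loopIntegral ν p θ Γin Γout F l y = loopIntegral ν p θ Γin' Γout' F l y :=
  h.integral_eq h' ν (G := fun u => Complex.exp (u * (y : ℂ)) * (u ^ l)⁻¹) hF fun u hu =>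
    DifferentiableAt.mul (by fun_prop) (DifferentiableAt.inv (by fun_prop) (pow_ne_zero _ hu))

/-- The integral of `loopIntegral` at `y/t` against the weight `t^(k-1) e^(-t-E/t)`. -/
def heatIntegral (ν : ℕ) (p : Fin n → ℝ) (θ : Fin m → ℝ) (Γin Γout : Contour) (F : ℂ → ℂ) (k l : ℕ)
    (E y : ℝ) : ℂ :=
  ∫ t in Ioi (0 : ℝ), heat k E t * loopIntegral ν p θ Γin Γout F l (y / t)

theorem Admissible.heatIntegral_eq {Γin' Γout' : Contour} (h : Admissible p θ Γin Γout)
    (h' : Admissible p θ Γin' Γout') (ν : ℕ) {F : ℂ → ℂ} (hF : Differentiable ℂ F) (k l : ℕ)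
    (E y : ℝ) :
    heatIntegral ν p θ Γin Γout F k l E y = heatIntegral ν p θ Γin' Γout' F k l E y := by
  simp only [heatIntegral, h.loopIntegral_eq h' ν hF]

theorem Admissible.continuousOn_pow (h : Admissible p θ Γin Γout) (ν : ℕ) {F : ℂ → ℂ}
    (hF : Continuous F) (l : ℕ) :
    ContinuousOn (fun q : ℂ × ℂ => F q.1 * (q.2 ^ l)⁻¹ * commonFactor ν p θ q.1 q.2)
      (Γout.points ×ˢ Γin.points) :=
  h.continuousOn_mul ν (G := fun u => (u ^ l)⁻¹) hF.continuousOn fun _ hu =>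
    ((continuous_pow l).continuousAt.inv₀ (pow_ne_zero _
      (h.regular (Contour.pt_mem h.radius_out_pos.le 0) hu).right_ne)).continuousWithinAt

theorem loopIntegral_eq_mul_exp (ν : ℕ) (p : Fin n → ℝ) (θ : Fin m → ℝ) (Γin Γout : Contour)
    (F : ℂ → ℂ) (l : ℕ) (y : ℝ) : loopIntegral ν p θ Γin Γout F l y =
      Γout.integral fun v => Γin.integral fun u =>
        F v * (u ^ l)⁻¹ * commonFactor ν p θ v u * Complex.exp (u * (y : ℂ)) := by
  rw [loopIntegral]
  congr 1; ext v; congr 1; ext u; ring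

theorem Admissible.integrableOn_heat_mul (h : Admissible p θ Γin Γout) (ν : ℕ) {F : ℂ → ℂ}
    (hF : Continuous F) (k l : ℕ) {E y : ℝ} (hE : ∀ u ∈ Γin.points, u.re * y < E) :
    IntegrableOn (fun t : ℝ => heat k E t * loopIntegral ν p θ Γin Γout F l (y / t)) (Ioi 0) := by
  simp only [loopIntegral_eq_mul_exp]
  exact (integral_heat_mul h.radius_out_pos.le h.radius_in_pos.le (h.continuousOn_pow ν hF l) k
    hE).1

theorem Admissible.heatIntegral_eq_integral (h : Admissible p θ Γin Γout) (ν : ℕ) {F : ℂ → ℂ}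
    (hF : Continuous F) (k l : ℕ) {E y : ℝ} (hE : ∀ u ∈ Γin.points, u.re * y < E) :
    heatIntegral ν p θ Γin Γout F k l E y = ∫ q, Contour.density Γout Γin (fun v u =>
      F v * (u ^ l)⁻¹ * commonFactor ν p θ v u * besselInt k (E - u * y)) q
        ∂(angles.prod angles) := by
  simp only [heatIntegral, loopIntegral_eq_mul_exp]
  exact (integral_heat_mul h.radius_out_pos.le h.radius_in_pos.le (h.continuousOn_pow ν hF l) k
    hE).2

/-- This is `besselInt_recurrence` at `w = E - uy`: the factor `u` in `uy` cancels one power of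
`u^(-1)`. Each term on the right carries a higher `k` or an extra factor `E`, at the price of a
single further power of `u^(-1)`. -/
theorem Admissible.heatIntegral_recurrence (h : Admissible p θ Γin Γout) (ν : ℕ) {F : ℂ → ℂ}
    (hF : Continuous F) (k l : ℕ) {E y : ℝ} (hE : ∀ u ∈ Γin.points, u.re * y < E) :
    y * heatIntegral ν p θ Γin Γout F k l E y =
      (k + 1) * heatIntegral ν p θ Γin Γout F (k + 1) (l + 1) E y -
        heatIntegral ν p θ Γin Γout F (k + 2) (l + 1) E y +
        E * heatIntegral ν p θ Γin Γout F k (l + 1) E y := by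
  have hi := fun k l => integrable_density_besselInt h.radius_out_pos.le h.radius_in_pos.le
    (X := fun v u => F v * (u ^ l)⁻¹ * commonFactor ν p θ v u) (h.continuousOn_pow ν hF l) k hE
  simp only [h.heatIntegral_eq_integral ν hF _ _ hE]
  rw [← integral_const_mul, ← integral_const_mul, ← integral_const_mul,
    ← integral_sub ((hi _ _).const_mul _) (hi _ _)]
  refine Eq.trans ?_ (integral_add (((hi _ _).const_mul _).sub (hi _ _)) ((hi _ _).const_mul _))
  congr 1; ext q
  have hu := Contour.pt_mem h.radius_in_pos.le q.2
  have hu0 := (h.regular (Contour.pt_mem h.radius_out_pos.le 0) hu).right_ne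
  have hrec := besselInt_recurrence k (w := E - Γin.pt q.2 * y)
    (by simpa using hE _ hu)
  simp only [Contour.density]
  set u := Γin.pt q.2
  have hpow : (u ^ l)⁻¹ = (u ^ (l + 1))⁻¹ * u := by rw [pow_succ]; field_simp
  rw [hpow]
  have hrec' : u * y * besselInt k (E - u * y) = (k + 1) * besselInt (k + 1) (E - u * y) -
      besselInt (k + 2) (E - u * y) + E * besselInt k (E - u * y) := by linear_combination -hrec
  linear_combination (Γout.weight q.1 * Γin.weight q.2 * F (Γout.pt q.1) * (u ^ (l + 1))⁻¹ *
    commonFactor ν p θ (Γout.pt q.1) u) * hrec'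
end

/-! ### Estimates on the saddle circle. -/

section
variable {n m : ℕ} {p : Fin n → ℝ} {θ : Fin m → ℝ}

theorem measurable_commonFactor (ν : ℕ) (p : Fin n → ℝ) (θ : Fin m → ℝ) :
    Measurable fun q : ℂ × ℂ => commonFactor ν p θ q.1 q.2 := by
  unfold commonFactor
  refine (((Measurable.mul (by fun_prop) ?_).mul ?_).mul ?_)
  · exact Measurable.pow_const (by fun_prop) _
  · exact Finset.measurable_prod _ fun k _ => by fun_prop
  · exact Finset.measurable_prod _ fun k _ => by fun_prop

theorem Regular.continuousAt (ν : ℕ) {v u : ℂ} (h : Regular p θ v u) :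
    ContinuousAt (fun q : (Fin n → ℝ) × ℂ × ℂ => commonFactor ν q.1 θ q.2.1 q.2.2) (p, v, u) := by
  have hv : ContinuousAt (fun q : (Fin n → ℝ) × ℂ × ℂ => q.2.1) (p, v, u) := by fun_prop
  have hu : ContinuousAt (fun q : (Fin n → ℝ) × ℂ × ℂ => q.2.2) (p, v, u) := by fun_prop
  unfold commonFactor
  refine ContinuousAt.mul (ContinuousAt.mul (ContinuousAt.mul ?_ ?_) ?_) ?_
  · refine ContinuousAt.div (ContinuousAt.cexp ?_) (hu.sub hv) (sub_ne_zero.2 h.ne)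
    exact (continuousAt_const.div hu h.right_ne).add (continuousAt_const.div hv h.left_ne)
  · exact (hv.div hu h.right_ne).zpow₀ _ (Or.inl (div_ne_zero h.left_ne h.right_ne))
  · refine tendsto_finsetProd _ fun k _ => ?_
    have hp : ContinuousAt (fun q : (Fin n → ℝ) × ℂ × ℂ => (q.1 k : ℂ)) (p, v, u) := by fun_prop
    exact (hu.sub hp).div (hv.sub hp) (h.left_sub k)
  · exact tendsto_finsetProd _ fun l _ =>
      (hv.sub continuousAt_const).div (hu.sub continuousAt_const) (h.right_sub l)

/-- The circle `|u + c|² = c² + s`. -/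
def saddleCircle (c s : ℝ) : Contour := ⟨-(c : ℂ), √(c ^ 2 + s)⟩

section saddle
variable {c s : ℝ} {u : ℂ}

theorem normSq_of_mem_saddleCircle (hs : 0 ≤ s) (hu : u ∈ (saddleCircle c s).points) :
    ‖u‖ ^ 2 + 2 * c * u.re = s := by
  have h : dist u (-(c : ℂ)) = √(c ^ 2 + s) := hu
  have h2 : ‖u + c‖ ^ 2 = c ^ 2 + s := by
    rw [dist_eq_norm, sub_neg_eq_add] at h
    rw [h, Real.sq_sqrt (by positivity)]
  rw [Complex.sq_norm, Complex.normSq_apply] at h2 ⊢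
  simp at h2
  nlinarith

theorem norm_le_of_mem_saddleCircle (hc : 0 ≤ c) (hu : u ∈ (saddleCircle c s).points) :
    ‖u‖ ≤ c + √(c ^ 2 + s) := by
  have h : dist u (-(c : ℂ)) = √(c ^ 2 + s) := hu
  rw [dist_eq_norm, sub_neg_eq_add] at h
  have h2 := norm_sub_le (u + c) c
  rw [h, add_sub_cancel_right, Complex.norm_real, Real.norm_of_nonneg hc] at h2
  linarith

theorem le_norm_sub_of_mem_saddleCircle (hc : 0 < c) (hs : 0 ≤ s)
    (hu : u ∈ (saddleCircle c s).points) {a : ℝ} (ha : -(2 * c) ≤ a) (ha0 : a ≤ 0) :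
    s / (c + √(c ^ 2 + s)) ≤ ‖u - a‖ := by
  have h : dist u (-(c : ℂ)) = √(c ^ 2 + s) := hu
  rw [dist_eq_norm, sub_neg_eq_add] at h
  have h2 := norm_sub_norm_le (u + c) ((a : ℂ) + c)
  have h3 : ‖(a : ℂ) + c‖ ≤ c := by
    rw [← Complex.ofReal_add, Complex.norm_real, Real.norm_eq_abs, abs_le]
    constructor <;> linarith
  have h4 : s / (c + √(c ^ 2 + s)) = √(c ^ 2 + s) - c := by
    have := Real.sq_sqrt (show 0 ≤ c ^ 2 + s by positivity)
    have h5 : 0 < c + √(c ^ 2 + s) := by positivity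
    rw [div_eq_iff h5.ne']; nlinarith
  rw [h, add_sub_add_right_eq_sub] at h2
  linarith

/-- With `Q = |u|²`, `Re (u/s - 1/u) = -(s - Q)²/(2csQ) ≤ 1/c - s/(2cQ)`. Then `e^(-X) ≤ N! X^(-N)`
at `X = s/(2cQ)` cancels `Q^(-N)` and leaves `s^(-N)`. Thus the essential singularity at `u = 0`
suppresses the pole there. -/
theorem exp_mul_inv_pow_le (hc : 0 < c) (hs : 0 < s) (hu : u ∈ (saddleCircle c s).points)
    (hu0 : u ≠ 0) (N : ℕ) :
    Real.exp (u / s - 1 / u).re * (‖u‖ ^ (2 * N))⁻¹ ≤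
      Real.exp (1 / c) * N.factorial * (2 * c) ^ N * (s ^ N)⁻¹ := by
  have hq := normSq_of_mem_saddleCircle hs.le hu
  have hQ : 0 < ‖u‖ ^ 2 := by positivity
  set Q := ‖u‖ ^ 2 with hQdef
  have hre : (u / s - 1 / u).re = -((s - Q) ^ 2 / (2 * c * (s * Q))) := by
    have h1 : (1 / u).re = u.re / Q := by
      rw [one_div, Complex.inv_re, Complex.normSq_eq_norm_sq]
    have h2 : u.re = (s - Q) / (2 * c) := by field_simp; linarith
    rw [Complex.sub_re, h1, Complex.div_ofReal_re, h2]
    field_simp; ring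
  have hle : (u / s - 1 / u).re ≤ 1 / c - s / Q / (2 * c) := by
    rw [hre]
    have : 1 / c - s / Q / (2 * c) - -((s - Q) ^ 2 / (2 * c * (s * Q))) = Q / (2 * c * s) := by
      field_simp; ring
    have h3 : 0 ≤ Q / (2 * c * s) := by positivity
    linarith
  have hpow : Real.exp (-(s / Q / (2 * c))) ≤ N.factorial * (2 * c) ^ N * (s ^ N)⁻¹ * Q ^ N := by
    have h := Real.pow_div_factorial_le_exp (s / Q / (2 * c)) (by positivity) N
    rw [Real.exp_neg]
    refine (inv_anti₀ (by positivity) h).trans (le_of_eq ?_)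
    rw [div_pow, div_pow]
    field_simp
  have hQN : ‖u‖ ^ (2 * N) = Q ^ N := by rw [hQdef, pow_mul]
  calc Real.exp (u / s - 1 / u).re * (‖u‖ ^ (2 * N))⁻¹
      ≤ Real.exp (1 / c - s / Q / (2 * c)) * (‖u‖ ^ (2 * N))⁻¹ := by gcongr
    _ = Real.exp (1 / c) * Real.exp (-(s / Q / (2 * c))) * (Q ^ N)⁻¹ := by
      rw [sub_eq_add_neg, Real.exp_add, hQN]
    _ ≤ Real.exp (1 / c) * (N.factorial * (2 * c) ^ N * (s ^ N)⁻¹ * Q ^ N) * (Q ^ N)⁻¹ := by gcongr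
    _ = _ := by field_simp

theorem admissible_saddleCircle (hc : 0 < c) (hs : 0 < s) (hθ : ∀ l, -(2 * c) ≤ θ l ∧ θ l ≤ 0)
    {R : ℝ} (hR : c + √(c ^ 2 + s) < R) (hp : ∀ k, |p k| < R) :
    Admissible p θ (saddleCircle c s) ⟨0, R⟩ := by
  have hlt : c < √(c ^ 2 + s) := Real.lt_sqrt_of_sq_lt (by linarith)
  refine ⟨?_, fun l => ?_, fun k => ?_, fun z hz => ?_⟩
  · simp only [Contour.Encloses, saddleCircle, dist_eq_norm, sub_neg_eq_add, zero_add,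
      Complex.norm_real, Real.norm_of_nonneg hc.le]
    exact hlt
  · simp only [Contour.Encloses, saddleCircle, dist_eq_norm, sub_neg_eq_add]
    rw [← Complex.ofReal_add, Complex.norm_real, Real.norm_eq_abs]
    refine lt_of_le_of_lt (abs_le.2 ?_) hlt
    constructor <;> linarith [(hθ l).1, (hθ l).2]
  · simpa [Contour.Encloses] using hp k
  · simpa [Contour.Encloses] using (norm_le_of_mem_saddleCircle hc.le hz).trans_lt hR

/-- As `|v/u| ≥ 1`, the `-m` in the exponent can be dropped. Each `u - θ l` costs `1/s`, the circle
being at distance at least `s/R` from `[-2c, 0]`. The powers of `1/|u|` are kept for the exponential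
to absorb. -/
theorem norm_commonFactor_le (ν : ℕ) (hc : 0 < c) (hs : 0 < s)
    (hθ : ∀ l, -(2 * c) ≤ θ l ∧ θ l ≤ 0) {R : ℝ} (hR2 : 2 ≤ R) (hR : 2 * (c + √(c ^ 2 + s)) ≤ R)
    (hp : ∀ k, |p k| ≤ 1) {v : ℂ} (hv : ‖v‖ = R) (hu : u ∈ (saddleCircle c s).points)
    (hu0 : u ≠ 0) :
    ‖commonFactor ν p θ v u‖ ≤ Real.exp (-(1 / u)).re * Real.exp 1 * (R ^ (ν + n) * R ^ n *
      (2 * R * R) ^ m) * ((‖u‖ ^ (ν + n))⁻¹ * (s ^ m)⁻¹) := by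
  have hun := norm_le_of_mem_saddleCircle hc.le hu
  have hsq : 0 < √(c ^ 2 + s) := Real.sqrt_pos.2 (by positivity)
  have hcs : c < √(c ^ 2 + s) := Real.lt_sqrt_of_sq_lt (by linarith)
  have hu' : 0 < ‖u‖ := norm_pos_iff.2 hu0
  have hv0 : v ≠ 0 := by rw [← norm_pos_iff, hv]; linarith
  have hR0 : 0 < R := by linarith
  have hsub : 1 ≤ ‖u - v‖ := by
    have := norm_sub_norm_le v u
    rw [norm_sub_rev] at this; linarith
  have e1 : ‖Complex.exp (-1 / u + 1 / v) / (u - v)‖ ≤ Real.exp (-(1 / u)).re * Real.exp 1 := by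
    rw [norm_div, Complex.norm_exp]
    refine (div_le_self (Real.exp_pos _).le hsub).trans ?_
    rw [← Real.exp_add, Complex.add_re, neg_div]
    gcongr
    refine (Complex.re_le_norm _).trans ?_
    rw [norm_div, norm_one, hv, div_le_one hR0]; linarith
  have e2 : ‖(v / u) ^ ((ν : ℤ) + (n : ℤ) - (m : ℤ))‖ ≤ R ^ (ν + n) * (‖u‖ ^ (ν + n))⁻¹ := by
    have h1 : 0 < ‖v / u‖ := norm_pos_iff.2 (div_ne_zero hv0 hu0)
    have h2 : 1 ≤ ‖v / u‖ := by
      rw [norm_div, hv, one_le_div hu']; linarith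
    rw [norm_zpow]
    calc ‖v / u‖ ^ ((ν : ℤ) + (n : ℤ) - (m : ℤ)) ≤ ‖v / u‖ ^ (((ν + n : ℕ) : ℤ)) := by
          refine zpow_le_zpow_right₀ h2 ?_
          push_cast; linarith
      _ = _ := by rw [zpow_natCast, norm_div, hv, div_pow, div_eq_mul_inv]
  have e3 : ‖∏ k : Fin n, (u - (p k : ℂ)) / (v - (p k : ℂ))‖ ≤ R ^ n := by
    rw [norm_prod]
    calc ∏ k : Fin n, ‖(u - (p k : ℂ)) / (v - (p k : ℂ))‖ ≤ ∏ k : Fin n, R := by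
          refine Finset.prod_le_prod (fun _ _ => norm_nonneg _) fun k _ => ?_
          have hpk : ‖(p k : ℂ)‖ ≤ 1 := by
            rw [Complex.norm_real]; exact hp k
          have h1 := norm_sub_le u (p k : ℂ)
          have h2 := norm_sub_norm_le v (p k : ℂ)
          rw [norm_div]
          refine (div_le_self (norm_nonneg _) (by linarith)).trans (by linarith)
      _ = R ^ n := by simp
  have e4 : ‖∏ l : Fin m, (v - (θ l : ℂ)) / (u - (θ l : ℂ))‖ ≤ (2 * R * R) ^ m * (s ^ m)⁻¹ := by
    rw [norm_prod]
    calc ∏ l : Fin m, ‖(v - (θ l : ℂ)) / (u - (θ l : ℂ))‖ ≤ ∏ l : Fin m, (2 * R * R / s) := by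
          refine Finset.prod_le_prod (fun _ _ => norm_nonneg _) fun l _ => ?_
          have hθl : ‖(θ l : ℂ)‖ ≤ 2 * c := by
            rw [Complex.norm_real, Real.norm_eq_abs, abs_le]
            constructor <;> linarith [(hθ l).1, (hθ l).2]
          have h1 := norm_sub_le v (θ l : ℂ)
          have h2 := le_norm_sub_of_mem_saddleCircle hc hs.le hu (hθ l).1 (hθ l).2
          have h3 : s / R ≤ ‖u - (θ l : ℂ)‖ := by
            refine le_trans ?_ h2
            gcongr; linarith
          rw [norm_div]
          calc ‖v - (θ l : ℂ)‖ / ‖u - (θ l : ℂ)‖ ≤ (2 * R) / (s / R) := by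
                gcongr; linarith
            _ = _ := by field_simp
      _ = _ := by simp [div_eq_mul_inv, mul_pow]
  unfold commonFactor
  rw [norm_mul, norm_mul, norm_mul]
  calc _ ≤ Real.exp (-(1 / u)).re * Real.exp 1 * (R ^ (ν + n) * (‖u‖ ^ (ν + n))⁻¹) * R ^ n *
        ((2 * R * R) ^ m * (s ^ m)⁻¹) := by gcongr
    _ = _ := by ring

/-- On the saddle circle the oscillating exponentials compensate each other. -/
theorem norm_exp_mul_commonFactor_le (ν : ℕ) (hc : 0 < c) (hs : 0 < s)
    (hθ : ∀ l, -(2 * c) ≤ θ l ∧ θ l ≤ 0) {R : ℝ} (hR2 : 2 ≤ R) (hR : 2 * (c + √(c ^ 2 + s)) ≤ R)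
    (hp : ∀ k, |p k| ≤ 1) {v : ℂ} (hv : ‖v‖ = R) (hu : u ∈ (saddleCircle c s).points)
    (hu0 : u ≠ 0) {l N : ℕ} (hN : l + (ν + n) ≤ 2 * N) :
    Real.exp (u / s).re * (‖u‖ ^ l)⁻¹ * ‖commonFactor ν p θ v u‖ ≤
      (Real.exp 1 * (R ^ (ν + n) * R ^ n * (2 * R * R) ^ m) * R ^ (2 * N - (l + (ν + n))) *
        (Real.exp (1 / c) * N.factorial * (2 * c) ^ N)) * (s ^ (N + m))⁻¹ := by
  have h1 := norm_commonFactor_le ν hc hs hθ hR2 hR hp hv hu hu0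
  have h2 := exp_mul_inv_pow_le hc hs hu hu0 N
  have hun := norm_le_of_mem_saddleCircle hc.le hu
  have hu' : 0 < ‖u‖ := norm_pos_iff.2 hu0
  have hsq : 0 < √(c ^ 2 + s) := Real.sqrt_pos.2 (by positivity)
  have huR : ‖u‖ ≤ R := by linarith
  have hR0 : 0 < R := by linarith
  -- Raises the pole order to the even number `2N` required by `exp_mul_inv_pow_le`, at the cost of
  -- powers of `|u| ≤ R`.
  have h3 : (‖u‖ ^ (l + (ν + n)))⁻¹ ≤ R ^ (2 * N - (l + (ν + n))) * (‖u‖ ^ (2 * N))⁻¹ := by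
    calc (‖u‖ ^ (l + (ν + n)))⁻¹ = ‖u‖ ^ (2 * N - (l + (ν + n))) * (‖u‖ ^ (2 * N))⁻¹ := by
          rw [← Nat.add_sub_of_le hN, pow_add ‖u‖ (l + (ν + n))]
          simp only [Nat.add_sub_cancel_left]
          field_simp
      _ ≤ _ := by gcongr
  set K := R ^ (ν + n) * R ^ n * (2 * R * R) ^ m with hK
  have hK0 : 0 ≤ K := by positivity
  calc Real.exp (u / s).re * (‖u‖ ^ l)⁻¹ * ‖commonFactor ν p θ v u‖
      ≤ Real.exp (u / s).re * (‖u‖ ^ l)⁻¹ * (Real.exp (-(1 / u)).re * Real.exp 1 * K *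
        ((‖u‖ ^ (ν + n))⁻¹ * (s ^ m)⁻¹)) := by gcongr
    _ = Real.exp 1 * K * (Real.exp (u / s - 1 / u).re * (‖u‖ ^ (l + (ν + n)))⁻¹) * (s ^ m)⁻¹ := by
      rw [sub_eq_add_neg (u / (s : ℂ)), Complex.add_re, Real.exp_add, pow_add ‖u‖ l, mul_inv]; ring
    _ ≤ Real.exp 1 * K * (Real.exp (u / s - 1 / u).re * (R ^ (2 * N - (l + (ν + n))) *
        (‖u‖ ^ (2 * N))⁻¹)) * (s ^ m)⁻¹ := by gcongr
    _ = Real.exp 1 * K * R ^ (2 * N - (l + (ν + n))) * (Real.exp (u / s - 1 / u).re *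
        (‖u‖ ^ (2 * N))⁻¹) * (s ^ m)⁻¹ := by ring
    _ ≤ Real.exp 1 * K * R ^ (2 * N - (l + (ν + n))) * (Real.exp (1 / c) * N.factorial *
        (2 * c) ^ N * (s ^ N)⁻¹) * (s ^ m)⁻¹ := by gcongr
    _ = _ := by rw [pow_add s N m, mul_inv]; ring

end saddle
end

/-! ### Domination over the contours and the half line. -/

section
variable {n m : ℕ} {p : Fin n → ℝ} {θ : Fin m → ℝ}

/-- From `X^b ≤ b! e^X` at `X = E/t`: a factor `E^b` is worth `t^b`, uniformly in `E ≥ 0`. -/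
theorem norm_pow_mul_heat_le (b k : ℕ) {E t : ℝ} (hE : 0 ≤ E) (ht : 0 < t) :
    ‖(E : ℂ) ^ b * heat k E t‖ ≤ b.factorial * (t ^ b * t ^ ((k : ℤ) - 1)) * Real.exp (-t) := by
  have h1 : (-(t : ℂ) - E / t).re = -t - E / t := by
    rw [← Complex.ofReal_neg, ← Complex.ofReal_div, ← Complex.ofReal_sub, Complex.ofReal_re]
  rw [heat, norm_mul, norm_mul, norm_pow, norm_zpow, Complex.norm_real, Complex.norm_real,
    Real.norm_of_nonneg hE, Real.norm_of_nonneg ht.le, Complex.norm_exp, h1,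
    sub_eq_add_neg (-t), Real.exp_add]
  have h2 : E ^ b * Real.exp (-(E / t)) ≤ b.factorial * t ^ b := by
    have h := Real.pow_div_factorial_le_exp (E / t) (by positivity) b
    rw [div_pow, div_div, div_le_iff₀ (by positivity)] at h
    rw [Real.exp_neg, ← div_eq_mul_inv, div_le_iff₀ (Real.exp_pos _)]
    linarith
  calc E ^ b * (t ^ ((k : ℤ) - 1) * (Real.exp (-t) * Real.exp (-(E / t))))
      = (E ^ b * Real.exp (-(E / t))) * (t ^ ((k : ℤ) - 1) * Real.exp (-t)) := by ring
    _ ≤ (b.factorial * t ^ b) * (t ^ ((k : ℤ) - 1) * Real.exp (-t)) := by gcongr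
    _ = _ := by ring

theorem pow_mul_zpow_mul_inv_min_pow_le {b k M : ℕ} (h : M + 1 ≤ b + k) {t : ℝ} (ht : 0 < t) :
    t ^ b * t ^ ((k : ℤ) - 1) * (min t 1 ^ M)⁻¹ ≤ 1 + t ^ (b + k) := by
  have e : t ^ b * t ^ ((k : ℤ) - 1) = t ^ (b + k - 1) := by
    rw [← zpow_natCast, ← zpow_natCast, ← zpow_add₀ ht.ne']
    congr 1; omega
  rw [e]
  rcases le_total t 1 with h1 | h1
  · rw [min_eq_left h1, ← Nat.sub_add_cancel (show M ≤ b + k - 1 by omega), pow_add,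
      mul_assoc, mul_inv_cancel₀ (by positivity), mul_one]
    have : t ^ (b + k - 1 - M) ≤ 1 := pow_le_one₀ ht.le h1
    have : 0 ≤ t ^ (b + k) := by positivity
    linarith
  · rw [min_eq_right h1, one_pow, inv_one, mul_one]
    have : t ^ (b + k - 1) ≤ t ^ (b + k) := pow_le_pow_right₀ h1 (by omega)
    linarith

/-- The integrand over the product of two circles and the half line. -/
def tripleIntegrand (ν : ℕ) (θ : Fin m → ℝ) (c R : ℝ) (F : ℂ → ℂ) (b k l : ℕ) (E : ℝ)
    (p : Fin n → ℝ) (y : ℝ) (z : (ℝ × ℝ) × ℝ) : ℂ :=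
  (E : ℂ) ^ b * heat k E z.2 * Contour.density ⟨0, R⟩ (saddleCircle c (min z.2 1 / y))
    (fun v u => F v * (Complex.exp (u * ((y / z.2 : ℝ) : ℂ)) * (u ^ l)⁻¹) * commonFactor ν p θ v u)
    z.1

theorem measurable_tripleIntegrand (ν : ℕ) (θ : Fin m → ℝ) (c R : ℝ) {F : ℂ → ℂ}
    (hF : Measurable F) (b k l : ℕ) (E : ℝ) (p : Fin n → ℝ) (y : ℝ) :
    Measurable (tripleIntegrand ν θ c R F b k l E p y) := by
  unfold tripleIntegrand Contour.density Contour.weight Contour.pt saddleCircle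
  have h1 := measurable_heat k E
  have hv : Measurable fun z : (ℝ × ℝ) × ℝ => circleMap 0 R z.1.1 := by fun_prop
  have hu : Measurable fun z : (ℝ × ℝ) × ℝ =>
      circleMap (-(c : ℂ)) (√(c ^ 2 + min z.2 1 / y)) z.1.2 := by
    unfold circleMap; fun_prop
  have hw : Measurable fun z : (ℝ × ℝ) × ℝ =>
      circleMap 0 (√(c ^ 2 + min z.2 1 / y)) z.1.2 := by
    unfold circleMap; fun_prop
  have hW := (measurable_commonFactor ν p θ).comp (hv.prodMk hu)
  refine (measurable_const.mul (h1.comp measurable_snd)).mul ?_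
  refine (hv.div_const _).mul ((hw.div_const _).mul (Measurable.mul ?_ hW))
  exact (hF.comp hv).mul ((hu.mul (by fun_prop)).cexp.mul (hu.pow_const l).inv)

/-- Collects the estimates into one bound independent of `E`, `p` and `y`. The condition `N + m + 1
≤ b + k` says that `t^(b+k-1)` beats the `t^(-(N+m))` coming from the saddle circle. -/
theorem exists_norm_tripleIntegrand_le (ν : ℕ) {c R : ℝ} (hc : 0 < c)
    (hθ : ∀ l, -(2 * c) ≤ θ l ∧ θ l ≤ 0) {y₁ y₂ A : ℝ} (hy₁ : 0 < y₁) (hR2 : 2 ≤ R)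
    (hR : 2 * (c + √(c ^ 2 + 1 / y₁)) ≤ R) {b k l N : ℕ} (hN : l + (ν + n) ≤ 2 * N)
    (hk : N + m + 1 ≤ b + k) :
    ∃ C : ℝ, ∀ (F : ℂ → ℂ) (E y : ℝ) (p : Fin n → ℝ) (z : (ℝ × ℝ) × ℝ),
      (∀ v, ‖v‖ = R → ‖F v‖ ≤ A) → 0 ≤ E → y₁ ≤ y → y ≤ y₂ → (∀ k, |p k| ≤ 1) → 0 < z.2 →
      ‖tripleIntegrand ν θ c R F b k l E p y z‖ ≤
        C * ((1 + z.2 ^ (b + k)) * Real.exp (-z.2)) := by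
  set K := Real.exp 1 * (R ^ (ν + n) * R ^ n * (2 * R * R) ^ m) * R ^ (2 * N - (l + (ν + n))) *
        (Real.exp (1 / c) * N.factorial * (2 * c) ^ N) with hK
  refine ⟨b.factorial * (R * R * (A * (Real.exp (R * y₂) * (K * y₂ ^ (N + m))))), ?_⟩
  rintro F E y p ⟨⟨α, β⟩, t⟩ hF hE hy1 hy2 hp ht
  have ht : 0 < t := ht
  have hy : 0 < y := hy₁.trans_le hy1
  have hR0 : 0 < R := by linarith
  set s := min t 1 / y with hs_def
  have hs : 0 < s := by positivity
  have hs1 : s ≤ 1 / y₁ := div_le_div₀ zero_le_one (min_le_right _ _) hy₁ hy1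
  have hsq : √(c ^ 2 + s) ≤ √(c ^ 2 + 1 / y₁) := by gcongr
  have hsq0 : 0 ≤ √(c ^ 2 + s) := Real.sqrt_nonneg _
  have hcs : c < √(c ^ 2 + s) := Real.lt_sqrt_of_sq_lt (by linarith)
  set v := (⟨0, R⟩ : Contour).pt α with hv_def
  set u := (saddleCircle c s).pt β with hu_def
  have hv : ‖v‖ = R := by
    simp [hv_def, Contour.pt, abs_of_pos hR0]
  have hu : u ∈ (saddleCircle c s).points := Contour.pt_mem hsq0 _
  have hadm : Admissible p θ (saddleCircle c s) ⟨0, R⟩ :=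
    admissible_saddleCircle hc hs hθ (by linarith) fun k => (hp k).trans_lt (by linarith)
  have hu0 : u ≠ 0 := (hadm.regular (Contour.pt_mem hR0.le α) hu).right_ne
  have hmain := norm_exp_mul_commonFactor_le ν hc hs hθ hR2 (by linarith) hp hv hu hu0 hN
  rw [← hK] at hmain
  have hun := norm_le_of_mem_saddleCircle hc.le hu
  have hexp : ‖Complex.exp (u * ((y / t : ℝ) : ℂ))‖ ≤
      Real.exp (R * y₂) * Real.exp (u / s).re := by
    rw [Complex.norm_exp, ← Real.exp_add]
    gcongr
    rw [Complex.div_ofReal_re, Complex.re_mul_ofReal]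
    have hre : |u.re| ≤ R := (Complex.abs_re_le_norm u).trans (by linarith)
    have hRy : R * y ≤ R * y₂ := by gcongr
    -- For `t ≤ 1` one has `y/t = 1/s` exactly. For `t ≥ 1` the parameter `s` is frozen at `1/y`,
    -- and the discrepancy in the exponent is at most `R y`.
    rcases le_total t 1 with h1 | h1
    · have : u.re / s = u.re * (y / t) := by rw [hs_def, min_eq_left h1]; field_simp
      rw [this]
      have : 0 ≤ R * y := by positivity
      linarith
    · have e : u.re / s = u.re * y := by rw [hs_def, min_eq_right h1]; field_simp
      have e2 : u.re * (y / t) = u.re * y + -u.re * (y * (1 - 1 / t)) := by field_simp; ring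
      rw [e, e2]
      have h3 : 0 ≤ y * (1 - 1 / t) := by
        have : 1 / t ≤ 1 := by rw [div_le_one ht]; exact h1
        exact mul_nonneg hy.le (by linarith)
      have h4 : y * (1 - 1 / t) ≤ y := by
        have : 0 ≤ 1 / t := by positivity
        nlinarith
      have h5 : -u.re * (y * (1 - 1 / t)) ≤ R * y := by
        refine mul_le_mul ((neg_le_abs _).trans hre) h4 h3 hR0.le
      linarith
  have hinv : (s ^ (N + m))⁻¹ ≤ y₂ ^ (N + m) * (min t 1 ^ (N + m))⁻¹ := by
    rw [hs_def, div_pow, inv_div, div_eq_mul_inv]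
    gcongr
  have hA : 0 ≤ A := (norm_nonneg _).trans (hF v hv)
  have hKn : 0 ≤ K := by positivity
  have hyy : 0 < y₂ := hy.trans_le hy2
  have hdens : ‖Contour.density ⟨0, R⟩ (saddleCircle c s) (fun v u => F v *
      (Complex.exp (u * ((y / t : ℝ) : ℂ)) * (u ^ l)⁻¹) * commonFactor ν p θ v u) (α, β)‖ ≤
      R * R * (A * (Real.exp (R * y₂) * (K * (y₂ ^ (N + m) * (min t 1 ^ (N + m))⁻¹)))) := by
    refine (Contour.norm_density_le _ _ _ _).trans ?_
    have r1 : |(⟨0, R⟩ : Contour).radius| ≤ R := (abs_of_pos hR0).le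
    have r2 : |(saddleCircle c s).radius| ≤ R := by
      simp only [saddleCircle]; rw [abs_of_nonneg hsq0]; linarith
    have r3 : ‖F v * (Complex.exp (u * ((y / t : ℝ) : ℂ)) * (u ^ l)⁻¹) *
        commonFactor ν p θ v u‖ ≤
        A * (Real.exp (R * y₂) * (K * (y₂ ^ (N + m) * (min t 1 ^ (N + m))⁻¹))) := by
      rw [norm_mul, norm_mul, norm_mul, norm_inv, norm_pow]
      calc ‖F v‖ * (‖Complex.exp (u * ((y / t : ℝ) : ℂ))‖ * (‖u‖ ^ l)⁻¹) *
            ‖commonFactor ν p θ v u‖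
          ≤ A * (Real.exp (R * y₂) * Real.exp (u / s).re * (‖u‖ ^ l)⁻¹) *
            ‖commonFactor ν p θ v u‖ := by gcongr; exact hF v hv
        _ = A * (Real.exp (R * y₂) * (Real.exp (u / s).re * (‖u‖ ^ l)⁻¹ *
            ‖commonFactor ν p θ v u‖)) := by ring
        _ ≤ A * (Real.exp (R * y₂) * (K * (s ^ (N + m))⁻¹)) := by gcongr
        _ ≤ _ := by gcongr
    calc _ ≤ R * R * ‖_‖ := by gcongr
      _ ≤ _ := by gcongr
  have hh := norm_pow_mul_heat_le b k hE ht
  have hp2 := pow_mul_zpow_mul_inv_min_pow_le hk ht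
  simp only [tripleIntegrand]
  rw [norm_mul]
  calc _ ≤ (b.factorial * (t ^ b * t ^ ((k : ℤ) - 1)) * Real.exp (-t)) *
        (R * R * (A * (Real.exp (R * y₂) * (K * (y₂ ^ (N + m) * (min t 1 ^ (N + m))⁻¹))))) := by
        gcongr
    _ = b.factorial * (R * R * (A * (Real.exp (R * y₂) * (K * y₂ ^ (N + m))))) *
        ((t ^ b * t ^ ((k : ℤ) - 1) * (min t 1 ^ (N + m))⁻¹) * Real.exp (-t)) := by ring
    _ ≤ _ := by gcongr

theorem integrable_tripleBound (C : ℝ) (j : ℕ) :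
    Integrable (fun z : (ℝ × ℝ) × ℝ => C * ((1 + z.2 ^ j) * Real.exp (-z.2)))
      ((angles.prod angles).prod (volume.restrict (Ioi 0))) := by
  have h : IntegrableOn (fun t : ℝ => (1 + t ^ j) * Real.exp (-t)) (Ioi 0) := by
    refine ((integrableOn_pow_mul_exp_neg 0).add (integrableOn_pow_mul_exp_neg j)).congr
      (Eventually.of_forall fun t => ?_)
    simp; ring
  exact (integrable_const C).mul_prod h

/-- For each separate `t`, contour independence allows the fixed contours to be exchanged for the
circle adapted to that `t`. -/
theorem integral_tripleIntegrand (ν : ℕ) {c R : ℝ} (hc : 0 < c)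
    (hθ : ∀ l, -(2 * c) ≤ θ l ∧ θ l ≤ 0) {F : ℂ → ℂ} (hF : Differentiable ℂ F) {b k l : ℕ} {E y : ℝ}
    (hy : 0 < y) (hR : c + √(c ^ 2 + 1 / y) < R) (hp : ∀ k, |p k| < R) {Γin Γout : Contour}
    (h : Admissible p θ Γin Γout)
    (hint : Integrable (tripleIntegrand ν θ c R F b k l E p y)
      ((angles.prod angles).prod (volume.restrict (Ioi 0)))) :
    ∫ z, tripleIntegrand ν θ c R F b k l E p y z
      ∂((angles.prod angles).prod (volume.restrict (Ioi 0))) =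
      (E : ℂ) ^ b * heatIntegral ν p θ Γin Γout F k l E y := by
  rw [integral_prod_symm _ hint, heatIntegral, ← integral_const_mul]
  refine setIntegral_congr_fun measurableSet_Ioi fun t ht => ?_
  have ht : 0 < t := ht
  have hs : 0 < min t 1 / y := by positivity
  have hadm : Admissible p θ (saddleCircle c (min t 1 / y)) ⟨0, R⟩ := by
    refine admissible_saddleCircle hc hs hθ (lt_of_le_of_lt ?_ hR) hp
    gcongr
    exact min_le_right _ _
  have hcont := hadm.continuousOn_mul ν
    (G := fun u => Complex.exp (u * ((y / t : ℝ) : ℂ)) * (u ^ l)⁻¹)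
    hF.continuous.continuousOn fun u hu => (ContinuousAt.mul (by fun_prop)
      ((continuous_pow l).continuousAt.inv₀ (pow_ne_zero _
      (hadm.regular (Contour.pt_mem hadm.radius_out_pos.le 0) hu).right_ne))).continuousWithinAt
  have hD := Contour.integral_integral
    (Contour.integrable_density hadm.radius_out_pos.le hadm.radius_in_pos.le
      (H := fun v u => F v * (Complex.exp (u * ((y / t : ℝ) : ℂ)) * (u ^ l)⁻¹) *
        commonFactor ν p θ v u) hcont)
  simp only [tripleIntegrand]
  rw [integral_const_mul, ← hD, h.loopIntegral_eq hadm ν hF, loopIntegral, mul_assoc]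

/-- The filter of parameters `(E, δ, p, x, y)` with `E → 0+`, `δ → 0`, `p → 0`, `(x, y) → z`. -/
def hardEdgeFilter (n : ℕ) (z : ℝ × ℝ) : Filter (ℝ × ℝ × (Fin n → ℝ) × ℝ × ℝ) :=
  𝓝[>] 0 ×ˢ 𝓝 0 ×ˢ 𝓝 0 ×ˢ 𝓝 z

theorem hardEdgeFilter_le (z : ℝ × ℝ) :
    hardEdgeFilter n z ≤ 𝓝 ((0 : ℝ), (0 : ℝ), (0 : Fin n → ℝ), z) := by
  simp only [nhds_prod_eq, hardEdgeFilter]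
  exact Filter.prod_mono nhdsWithin_le_nhds le_rfl

instance (z : ℝ × ℝ) : (hardEdgeFilter n z).IsCountablyGenerated := by
  unfold hardEdgeFilter; infer_instance

theorem continuousAt_tripleIntegrand (κ ν : ℕ) {c R : ℝ} (hc : 0 < c)
    (hθ : ∀ l, -(2 * c) ≤ θ l ∧ θ l ≤ 0) (b k l : ℕ) {x₀ y₀ : ℝ} (hy₀ : 0 < y₀)
    (hR : c + √(c ^ 2 + 1 / y₀) < R) {z : (ℝ × ℝ) × ℝ} (hz : 0 < z.2) :
    ContinuousAt (fun q : ℝ × ℝ × (Fin n → ℝ) × ℝ × ℝ => tripleIntegrand ν θ c R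
      (fun v => besselSeries κ ((q.2.1 - v) * q.2.2.2.1)) b k l q.1 q.2.2.1 q.2.2.2.2 z)
      (0, 0, 0, x₀, y₀) := by
  obtain ⟨⟨α, β⟩, t⟩ := z
  have ht : 0 < t := hz
  unfold tripleIntegrand Contour.density Contour.weight Contour.pt saddleCircle heat
  simp only
  have hy : ContinuousAt (fun q : ℝ × ℝ × (Fin n → ℝ) × ℝ × ℝ => q.2.2.2.2) (0, 0, 0, x₀, y₀) := by
    fun_prop
  have hs : ContinuousAt (fun q : ℝ × ℝ × (Fin n → ℝ) × ℝ × ℝ => √(c ^ 2 + min t 1 / q.2.2.2.2))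
      (0, 0, 0, x₀, y₀) :=
    (continuousAt_const.add (continuousAt_const.div hy hy₀.ne')).sqrt
  have hu : ContinuousAt (fun q : ℝ × ℝ × (Fin n → ℝ) × ℝ × ℝ =>
      circleMap (-(c : ℂ)) (√(c ^ 2 + min t 1 / q.2.2.2.2)) β) (0, 0, 0, x₀, y₀) := by
    unfold circleMap
    exact continuousAt_const.add
      ((Complex.continuous_ofReal.continuousAt.comp hs).mul continuousAt_const)
  have hw : ContinuousAt (fun q : ℝ × ℝ × (Fin n → ℝ) × ℝ × ℝ =>
      circleMap 0 (√(c ^ 2 + min t 1 / q.2.2.2.2)) β) (0, 0, 0, x₀, y₀) := by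
    unfold circleMap
    exact continuousAt_const.add
      ((Complex.continuous_ofReal.continuousAt.comp hs).mul continuousAt_const)
  have hs0 : 0 < min t 1 / y₀ := by positivity
  have hR0 : 0 < R := lt_of_le_of_lt (by positivity) hR
  have hadm : Admissible (0 : Fin n → ℝ) θ (saddleCircle c (min t 1 / y₀)) ⟨0, R⟩ := by
    refine admissible_saddleCircle hc hs0 hθ (lt_of_le_of_lt ?_ hR) (by simpa using fun _ => hR0)
    gcongr
    exact min_le_right _ _
  have hreg := hadm.regular (Contour.pt_mem hR0.le α) (Contour.pt_mem hadm.radius_in_pos.le β)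
  have hW : ContinuousAt (fun q : ℝ × ℝ × (Fin n → ℝ) × ℝ × ℝ => commonFactor ν q.2.2.1 θ
      (circleMap 0 R α) (circleMap (-(c : ℂ)) (√(c ^ 2 + min t 1 / q.2.2.2.2)) β))
      (0, 0, 0, x₀, y₀) :=
    ContinuousAt.comp_of_eq
      (f := fun q : ℝ × ℝ × (Fin n → ℝ) × ℝ × ℝ => (q.2.2.1, circleMap (0 : ℂ) R α,
        circleMap (-(c : ℂ)) (√(c ^ 2 + min t 1 / q.2.2.2.2)) β))
      (hreg.continuousAt ν) (ContinuousAt.prodMk (by fun_prop)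
        (continuousAt_const.prodMk hu)) rfl
  have hu0 : circleMap (-(c : ℂ)) (√(c ^ 2 + min t 1 / y₀)) β ≠ 0 := hreg.right_ne
  have hB := (differentiable_besselSeries κ).continuous
  refine ContinuousAt.mul (by fun_prop) ?_
  refine continuousAt_const.mul (ContinuousAt.mul (hw.div_const _) (ContinuousAt.mul ?_ hW))
  refine ContinuousAt.mul ?_ (ContinuousAt.mul (ContinuousAt.cexp (hu.mul (by fun_prop)))
    ((hu.pow l).inv₀ (pow_ne_zero _ hu0)))
  exact (hB.comp (by fun_prop :
    Continuous fun q : ℝ × ℝ × (Fin n → ℝ) × ℝ × ℝ =>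
      ((q.2.1 : ℂ) - circleMap 0 R α) * q.2.2.2.1)).continuousAt
end

/-! ### Existence of the hard edge limit of the heat integral. -/

section
variable {n m : ℕ} {p : Fin n → ℝ} {θ : Fin m → ℝ}

/-- The heat integral with the entire factor `v ↦ besselSeries κ ((δ - v) x)`, as a function of the
parameters `(E, δ, p, x, y)`. -/
def besselHeatIntegral (κ ν : ℕ) (θ : Fin m → ℝ) (Γin Γout : Contour) (k l : ℕ)
    (q : ℝ × ℝ × (Fin n → ℝ) × ℝ × ℝ) : ℂ :=
  heatIntegral ν q.2.2.1 θ Γin Γout (fun v => besselSeries κ ((q.2.1 - v) * q.2.2.2.1)) k l q.1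
    q.2.2.2.2

theorem differentiable_besselSeries_comp (κ : ℕ) (a x : ℂ) :
    Differentiable ℂ fun v => besselSeries κ ((a - v) * x) :=
  (differentiable_besselSeries κ).comp (by fun_prop)

theorem eventually_hardEdgeFilter {z : ℝ × ℝ} {ε : ℝ} (hε : 0 < ε) :
    ∀ᶠ q in hardEdgeFilter n z, 0 < q.1 ∧ |q.2.1| ≤ 1 ∧ (∀ k, |q.2.2.1 k| ≤ 1) ∧
      |q.2.2.2.1 - z.1| < ε ∧ |q.2.2.2.2 - z.2| < ε := by
  have h1 : ∀ᶠ q in hardEdgeFilter n z, 0 < q.1 := by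
    have : Tendsto (fun q : ℝ × ℝ × (Fin n → ℝ) × ℝ × ℝ => q.1) (hardEdgeFilter n z) (𝓝[>] 0) :=
      tendsto_fst
    exact this self_mem_nhdsWithin
  have h2 : ∀ᶠ q : ℝ × ℝ × (Fin n → ℝ) × ℝ × ℝ in 𝓝 ((0 : ℝ), (0 : ℝ), (0 : Fin n → ℝ), z),
      |q.2.1| < 1 ∧ (∀ k, |q.2.2.1 k| < 1) ∧ |q.2.2.2.1 - z.1| < ε ∧ |q.2.2.2.2 - z.2| < ε := by
    refine IsOpen.mem_nhds ?_ ?_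
    · refine IsOpen.and ?_ (IsOpen.and ?_ (IsOpen.and ?_ ?_))
      · exact isOpen_lt (by fun_prop) (by fun_prop)
      · simp only [Set.ofPred_forall]
        exact isOpen_iInter_of_finite fun k => isOpen_lt (by fun_prop) (by fun_prop)
      · exact isOpen_lt (by fun_prop) (by fun_prop)
      · exact isOpen_lt (by fun_prop) (by fun_prop)
    · simp [hε]
  filter_upwards [h1, (hardEdgeFilter_le z) h2] with q hq1 hq2
  exact ⟨hq1, hq2.1.le, fun k => (hq2.2.1 k).le, hq2.2.2.1, hq2.2.2.2⟩

/-- The absolutely convergent range: dominated convergence for `tripleIntegrand`, which at each `t >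
0` is continuous up to `E = 0`. -/
theorem exists_tendsto_besselHeatIntegral_of_le (κ ν : ℕ) {c : ℝ} (hc : 0 < c)
    (hθ : ∀ l, -(2 * c) ≤ θ l ∧ θ l ≤ 0) {Γin Γout : Contour}
    (hΓ : ∀ p : Fin n → ℝ, (∀ k, |p k| ≤ 1) → Admissible p θ Γin Γout) {z : ℝ × ℝ} (hz : 0 < z.2)
    {b k l N : ℕ} (hN : l + (ν + n) ≤ 2 * N) (hk : N + m + 1 ≤ b + k) :
    ∃ a, Tendsto (fun q => (q.1 : ℂ) ^ b * besselHeatIntegral κ ν θ Γin Γout k l q)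
      (hardEdgeFilter n z) (𝓝 a) := by
  obtain ⟨x₀, y₀⟩ := z
  have hz : 0 < y₀ := hz
  set R := 2 * (c + √(c ^ 2 + 1 / (y₀ / 2))) + 2 with hR
  have hsq : 0 ≤ √(c ^ 2 + 1 / (y₀ / 2)) := Real.sqrt_nonneg _
  -- The radius bounds `‖(δ - v) x‖` for `|δ| ≤ 1`, `‖v‖ = R` and `|x - x₀| < y₀/2`.
  obtain ⟨A, hA⟩ := (isCompact_closedBall (0 : ℂ) ((1 + R) * (|x₀| + y₀))).exists_bound_of_continuousOn
    (differentiable_besselSeries κ).continuous.continuousOn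
  obtain ⟨C, hC⟩ := exists_norm_tripleIntegrand_le (θ := θ) (n := n) ν hc hθ (y₁ := y₀ / 2)
    (y₂ := 2 * y₀) (A := A) (R := R) (b := b) (k := k) (l := l) (by positivity) (by linarith)
    (by linarith) hN hk
  set μ := (angles.prod angles).prod (volume.restrict (Ioi (0 : ℝ)))
  have hpos : ∀ᵐ z ∂μ, 0 < z.2 :=
    Measure.quasiMeasurePreserving_snd.ae (ae_restrict_mem measurableSet_Ioi)
  let Ψ : ℝ × ℝ × (Fin n → ℝ) × ℝ × ℝ → (ℝ × ℝ) × ℝ → ℂ := fun q => tripleIntegrand ν θ c R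
    (fun v => besselSeries κ ((q.2.1 - v) * q.2.2.2.1)) b k l q.1 q.2.2.1 q.2.2.2.2
  have hev := eventually_hardEdgeFilter (n := n) (z := (x₀, y₀)) (ε := y₀ / 2) (by positivity)
  have hmeas : ∀ q, AEStronglyMeasurable (Ψ q) μ := fun q =>
    (measurable_tripleIntegrand ν θ c R
      (differentiable_besselSeries_comp κ _ _).continuous.measurable b k l _ _ _).aestronglyMeasurable
  have hbd : ∀ᶠ q in hardEdgeFilter n (x₀, y₀), ∀ᵐ z ∂μ, ‖Ψ q z‖ ≤
      C * ((1 + z.2 ^ (b + k)) * Real.exp (-z.2)) := by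
    filter_upwards [hev] with q hq
    obtain ⟨h1, h2, h3, h4, h5⟩ := hq
    filter_upwards [hpos] with z hz0
    rw [abs_lt] at h5
    refine hC _ _ _ _ _ (fun v hv => hA _ ?_) h1.le (by linarith [h5.1]) (by linarith [h5.2]) h3 hz0
    rw [mem_closedBall_zero_iff, norm_mul]
    have e1 : ‖(q.2.1 : ℂ) - v‖ ≤ 1 + R := by
      refine (norm_sub_le _ _).trans ?_
      rw [Complex.norm_real, hv]; exact add_le_add h2 le_rfl
    have e2 : ‖(q.2.2.2.1 : ℂ)‖ ≤ |x₀| + y₀ := by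
      rw [Complex.norm_real, Real.norm_eq_abs]
      have := abs_sub_abs_le_abs_sub q.2.2.2.1 x₀
      have h4' : |q.2.2.2.1 - x₀| < y₀ / 2 := h4
      linarith
    gcongr
  have hbi := integrable_tripleBound C (b + k)
  refine ⟨∫ z, Ψ (0, 0, 0, x₀, y₀) z ∂μ, ?_⟩
  have hlim := tendsto_integral_filter_of_dominated_convergence
    (fun z : (ℝ × ℝ) × ℝ => C * ((1 + z.2 ^ (b + k)) * Real.exp (-z.2)))
    (Eventually.of_forall hmeas) hbd hbi (f := Ψ (0, 0, 0, x₀, y₀)) (by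
      filter_upwards [hpos] with z hz0
      have hRlt : c + √(c ^ 2 + 1 / y₀) < R := by
        have : √(c ^ 2 + 1 / y₀) ≤ √(c ^ 2 + 1 / (y₀ / 2)) := by gcongr; linarith
        linarith
      exact (continuousAt_tripleIntegrand κ ν hc hθ b k l (x₀ := x₀) hz hRlt
        hz0).tendsto.mono_left (hardEdgeFilter_le _))
  refine hlim.congr' ?_
  filter_upwards [hev, hbd] with q hq hb
  obtain ⟨h1, h2, h3, h4, h5⟩ := hq
  rw [abs_lt] at h5
  have hy : 0 < q.2.2.2.2 := by linarith [h5.1]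
  refine integral_tripleIntegrand ν hc hθ (differentiable_besselSeries_comp κ _ _) hy ?_
    (fun k => (h3 k).trans_lt (by linarith)) (hΓ _ h3) (hbi.mono' (hmeas q) hb)
  have : √(c ^ 2 + 1 / q.2.2.2.2) ≤ √(c ^ 2 + 1 / (y₀ / 2)) := by gcongr; linarith [h5.1]
  linarith

theorem exists_admissible_re_mul_lt {c : ℝ} (hc : 0 < c) (hθ : ∀ l, -(2 * c) ≤ θ l ∧ θ l ≤ 0)
    (hp : ∀ k, |p k| ≤ 1) {E y : ℝ} (hE : 0 < E) (hy : 0 < y) :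
    ∃ Γin Γout, Admissible p θ Γin Γout ∧ ∀ u ∈ Γin.points, u.re * y < E := by
  -- On this circle `2c Re u ≤ s = cE/y`, hence `y Re u ≤ E/2`.
  set s := c * E / y with hs_def
  have hs : 0 < s := by positivity
  refine ⟨saddleCircle c s, ⟨0, c + √(c ^ 2 + s) + 2⟩, admissible_saddleCircle hc hs hθ
    (by linarith) fun k => (hp k).trans_lt (by linarith [Real.sqrt_nonneg (c ^ 2 + s)]),
    fun u hu => ?_⟩
  have h1 := normSq_of_mem_saddleCircle hs.le hu
  have h2 : 2 * c * u.re ≤ s := by nlinarith [sq_nonneg ‖u‖]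
  have h3 : 2 * c * (u.re * y) ≤ c * E := by
    have : s * y = c * E := by rw [hs_def]; field_simp
    nlinarith
  have h4 : 2 * (u.re * y) ≤ E := by
    by_contra! hcon
    nlinarith
  linarith

/-- Induction on the deficiency `r`. In the recurrence each term raises `b + k` by at least one and
`l` by exactly one, so `2(b + k) - l` grows by at least one; `r = 0` is the dominated case. -/
theorem exists_tendsto_besselHeatIntegral (κ ν : ℕ) {c : ℝ} (hc : 0 < c)
    (hθ : ∀ l, -(2 * c) ≤ θ l ∧ θ l ≤ 0) {Γin Γout : Contour}
    (hΓ : ∀ p : Fin n → ℝ, (∀ k, |p k| ≤ 1) → Admissible p θ Γin Γout) {z : ℝ × ℝ} (hz : 0 < z.2)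
    (b k l : ℕ) :
    ∃ a, Tendsto (fun q => (q.1 : ℂ) ^ b * besselHeatIntegral κ ν θ Γin Γout k l q)
      (hardEdgeFilter n z) (𝓝 a) := by
  suffices H : ∀ r b k l : ℕ, l + (ν + n) + 2 * m + 4 ≤ 2 * (b + k) + r →
      ∃ a, Tendsto (fun q => (q.1 : ℂ) ^ b * besselHeatIntegral κ ν θ Γin Γout k l q)
        (hardEdgeFilter n z) (𝓝 a) from H _ b k l (Nat.le_add_left _ _)
  intro r
  induction r with
  | zero =>
    intro b k l h
    exact exists_tendsto_besselHeatIntegral_of_le κ ν hc hθ hΓ hz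
      (N := (l + (ν + n) + 1) / 2) (by omega) (by omega)
  | succ r ih =>
    intro b k l h
    obtain ⟨a₁, h₁⟩ := ih b (k + 1) (l + 1) (by omega)
    obtain ⟨a₂, h₂⟩ := ih b (k + 2) (l + 1) (by omega)
    obtain ⟨a₃, h₃⟩ := ih (b + 1) k (l + 1) (by omega)
    have hy : Tendsto (fun q : ℝ × ℝ × (Fin n → ℝ) × ℝ × ℝ => ((q.2.2.2.2 : ℝ) : ℂ)⁻¹)
        (hardEdgeFilter n z) (𝓝 ((z.2 : ℂ)⁻¹)) := by
      have hcont : ContinuousAt (fun q : ℝ × ℝ × (Fin n → ℝ) × ℝ × ℝ => ((q.2.2.2.2 : ℝ) : ℂ)⁻¹)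
          (0, 0, 0, z) :=
        ContinuousAt.inv₀ (by fun_prop) (by simpa using hz.ne')
      exact hcont.tendsto.mono_left (hardEdgeFilter_le z)
    refine ⟨(z.2 : ℂ)⁻¹ * ((k + 1) * a₁ - a₂ + a₃), ?_⟩
    refine (hy.mul (((h₁.const_mul _).sub h₂).add h₃)).congr' ?_
    filter_upwards [eventually_hardEdgeFilter hz] with q hq
    obtain ⟨hE, -, hp, -, hq5⟩ := hq
    rw [abs_lt] at hq5
    have hy0 : 0 < q.2.2.2.2 := by linarith [hq5.1]
    -- The recurrence needs `y Re u < E` on the inner contour, which therefore depends on `E`;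
    -- contour independence carries the identity back to the fixed contours.
    obtain ⟨Γ, Γ', hadm, hre⟩ := exists_admissible_re_mul_lt hc hθ hp hE hy0
    have hdiff := differentiable_besselSeries_comp κ q.2.1 q.2.2.2.1
    have hrec := hadm.heatIntegral_recurrence ν hdiff.continuous k l hre
    simp only [hadm.heatIntegral_eq (hΓ _ hp) ν hdiff] at hrec
    have hy1 : ((q.2.2.2.2 : ℝ) : ℂ) ≠ 0 := by exact_mod_cast hy0.ne'
    rw [inv_mul_eq_iff_eq_mul₀ hy1]
    simp only [besselHeatIntegral]
    linear_combination (-(q.1 : ℂ) ^ b) * hrec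
end

/-! ### Reduction of `K_I` and `K_II` to the heat integral. -/

section
variable {n m : ℕ} {p : Fin n → ℝ} {θ : Fin m → ℝ}

/-- Taking the limit in the index first shows that `f` is continuous on `C`. Joint convergence is
then locally uniform convergence, and compactness makes it uniform. -/
theorem tendstoUniformlyOn_of_forall_tendsto {ι α β : Type*} [TopologicalSpace α]
    [PseudoMetricSpace β] {l : Filter ι} [l.NeBot] {F : ι → α → β} {f : α → β} {C : Set α}
    (hC : IsCompact C)
    (h : ∀ z ∈ C, Tendsto (fun q : ι × α => F q.1 q.2) (l ×ˢ 𝓝[C] z) (𝓝 (f z))) :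
    TendstoUniformlyOn F f l C := by
  rw [← tendstoLocallyUniformlyOn_iff_tendstoUniformlyOn_of_compact hC,
    tendstoLocallyUniformlyOn_iff_forall_tendsto]
  intro x hx
  have hf : Tendsto f (𝓝[C] x) (𝓝 (f x)) := by
    rw [Metric.tendsto_nhds]
    intro ε hε
    obtain ⟨P, hP, Q, hQ, hPQ⟩ := eventually_prod_iff.1
      ((Metric.tendsto_nhds.1 (h x hx)) (ε / 2) (by positivity))
    filter_upwards [hQ, self_mem_nhdsWithin] with z hz hzC
    have hz' : Tendsto (fun i => F i z) l (𝓝 (f z)) :=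
      (h z hzC).comp (tendsto_id.prodMk (tendsto_const_pure.mono_right (pure_le_nhdsWithin hzC)))
    have := le_of_tendsto (hz'.dist (tendsto_const_nhds (x := f x)))
      (hP.mono fun i hi => (hPQ hi hz).le)
    linarith
  exact ((hf.comp tendsto_snd).prodMk_nhds (h x hx)).mono_right (nhds_le_uniformity _)

theorem Contour.integral_congr_of_ne {Γ : Contour} (h : 0 < Γ.radius) (z₀ : ℂ) {f g : ℂ → ℂ}
    (hfg : ∀ z ∈ Γ.points, z ≠ z₀ → f z = g z) : Γ.integral f = Γ.integral g := by
  simp only [Contour.integral_eq]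
  refine integral_congr_ae ?_
  have hc : (circleMap Γ.center Γ.radius ⁻¹' {z₀}).Countable :=
    (countable_singleton z₀).preimage_circleMap _ h.ne'
  have : ∀ᵐ a ∂angles, a ∉ circleMap Γ.center Γ.radius ⁻¹' {z₀} :=
    ae_restrict_of_ae (measure_eq_zero_iff_ae_notMem.1 (hc.measure_zero volume))
  filter_upwards [this] with a ha
  rw [hfg _ (Contour.pt_mem h.le a) ha]

theorem Contour.continuousOn_integral {Γ Γ' : Contour} {H : ℂ → ℂ → ℂ} (hr' : 0 ≤ Γ'.radius)
    (hH : ContinuousOn (fun q : ℂ × ℂ => H q.1 q.2) (Γ.points ×ˢ Γ'.points)) :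
    ContinuousOn (fun v => Γ'.integral fun u => H v u) Γ.points := by
  simp only [Contour.integral_eq]
  obtain ⟨C, hC⟩ := (Γ.isCompact_points.prod Γ'.isCompact_points).exists_bound_of_continuousOn hH
  have hu : ∀ v ∈ Γ.points, Continuous fun a => Γ'.weight a * H v (Γ'.pt a) := fun v hv =>
    Γ'.continuous_weight.mul (hH.comp_continuous (f := fun a => (v, Γ'.pt a))
      (continuous_const.prodMk Γ'.continuous_pt) fun a => ⟨hv, Contour.pt_mem hr' a⟩)
  refine continuousOn_of_dominated (bound := fun _ => |Γ'.radius| / (2 * Real.pi) * C)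
    (fun v hv => (hu v hv).aestronglyMeasurable) (fun v hv => Eventually.of_forall fun a => ?_)
    (integrable_const _) (Eventually.of_forall fun a => ?_)
  · rw [norm_mul, Contour.norm_weight]
    gcongr
    exact hC (v, Γ'.pt a) ⟨hv, Contour.pt_mem hr' a⟩
  · exact continuousOn_const.mul (hH.comp (continuousOn_id.prodMk continuousOn_const)
      fun v hv => ⟨hv, Contour.pt_mem hr' a⟩)

/-- Parameters equal to zero contribute `(u/v)^n`, which cancels the extra `(v/u)^n`. This lets
`K_I` be compared with kernels that carry `n` parameters tending to `0`. -/
theorem commonFactor_elim0_eq (ν n : ℕ) (θ : Fin m → ℝ) {v u : ℂ} (hv : v ≠ 0) (hu : u ≠ 0) :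
    commonFactor ν (Fin.elim0 : Fin 0 → ℝ) θ v u = commonFactor ν (0 : Fin n → ℝ) θ v u := by
  unfold commonFactor
  have h : (v / u) ^ ((ν : ℤ) + (n : ℤ) - (m : ℤ)) =
      (v / u) ^ ((ν : ℤ) + ((0 : ℕ) : ℤ) - (m : ℤ)) * (v / u) ^ n := by
    rw [← zpow_natCast, ← zpow_add₀ (div_ne_zero hv hu)]
    congr 1; push_cast; ring
  simp only [h, Pi.zero_apply, Complex.ofReal_zero, sub_zero, Finset.univ_eq_empty,
    Finset.prod_empty, Finset.prod_const, Finset.card_univ, Fintype.card_fin, mul_one]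
  rw [div_pow v u n, div_pow u v n]
  field_simp

section
variable {Γ₀ Γin Γout : Contour}

theorem Admissible.of_elim0 (h : Admissible (Fin.elim0 : Fin 0 → ℝ) θ Γin Γout) (n : ℕ) :
    Admissible (0 : Fin n → ℝ) θ Γin Γout :=
  ⟨h.zero_in, h.theta_in, fun k => by
    simpa using h.encloses_closedBall h.zero_in.le, h.nested⟩

/-- The `s`-integral of `s^(-κ-1) e^(s - vx/s)` is `besselSeries κ (-vx)`; Fubini moves it inside
the `v`-integral. -/
theorem integrandI_eq (κ ν n : ℕ) (h₀ : Γ₀.Encloses 0)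
    (h : Admissible (Fin.elim0 : Fin 0 → ℝ) θ Γin Γout) (x y t : ℝ) :
    integrandI κ ν θ Γ₀ Γin Γout x y t = heat κ 0 t *
      loopIntegral ν (0 : Fin n → ℝ) θ Γin Γout (fun v => besselSeries κ ((0 - v) * x)) 0 (y / t) := by
  set g : ℂ → ℂ := fun v => Γin.integral fun u =>
    Complex.exp (u * ((y / t : ℝ) : ℂ)) * commonFactor ν (Fin.elim0 : Fin 0 → ℝ) θ v u with hg_def
  have hr₀ := h₀.radius_pos
  have hg : ContinuousOn g Γout.points := by
    refine Contour.continuousOn_integral h.radius_in_pos.le ?_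
    simpa using h.continuousOn_mul ν (F := fun _ => 1)
      (G := fun u => Complex.exp (u * ((y / t : ℝ) : ℂ))) continuousOn_const (by fun_prop)
  have hs0 : ∀ s ∈ Γ₀.points, s ≠ 0 := fun s hs e => by
    have hs' : dist s Γ₀.center = Γ₀.radius := hs
    rw [e] at hs'
    exact h₀.ne hs'
  have hcont : ContinuousOn (fun q : ℂ × ℂ => q.1 ^ (-(κ : ℤ) - 1) *
      Complex.exp (1 * q.1 + (0 - q.2) * x / q.1) * g q.2) (Γ₀.points ×ˢ Γout.points) := by
    refine ContinuousOn.mul (ContinuousOn.mul ?_ (ContinuousOn.cexp ?_))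
      (hg.comp continuousOn_snd fun q hq => hq.2)
    · exact continuousOn_fst.zpow₀ _ fun q hq => Or.inl (hs0 _ hq.1)
    · exact ContinuousOn.add (by fun_prop)
        (ContinuousOn.div (by fun_prop) (by fun_prop) fun q hq => hs0 _ hq.1)
  have e1 : integrandI κ ν θ Γ₀ Γin Γout x y t = Γ₀.integral fun s => heat κ 0 t *
      Γout.integral fun v => s ^ (-(κ : ℤ) - 1) *
        Complex.exp (1 * s + (0 - v) * x / s) * g v := by
    unfold integrandI
    refine Contour.integral_congr hr₀.le fun s hs => ?_
    rw [← Contour.integral_const_mul, ← Contour.integral_const_mul]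
    refine Contour.integral_congr h.radius_out_pos.le fun v hv => ?_
    simp only [hg_def]
    rw [← Contour.integral_const_mul, ← Contour.integral_const_mul, ← Contour.integral_const_mul]
    refine Contour.integral_congr h.radius_in_pos.le fun u hu => ?_
    have e2 : Complex.exp (s - t) * Complex.exp (-(v / s * x) + u / t * y) =
        Complex.exp (-t - (0 : ℝ) / t) * (Complex.exp (1 * s + (0 - v) * x / s) *
          Complex.exp (u * ((y / t : ℝ) : ℂ))) := by
      rw [← Complex.exp_add, ← Complex.exp_add, ← Complex.exp_add]
      congr 1; push_cast; ring
    rw [heat]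
    linear_combination ((t : ℂ) ^ ((κ : ℤ) - 1) * s ^ (-(κ : ℤ) - 1) *
      commonFactor ν (Fin.elim0 : Fin 0 → ℝ) θ v u) * e2
  rw [e1, Contour.integral_const_mul, Contour.integral_comm hr₀.le h.radius_out_pos.le hcont,
    loopIntegral]
  congr 1
  refine Contour.integral_congr h.radius_out_pos.le fun v hv => ?_
  have e3 := Contour.integral_exp_add h₀ κ 1 ((0 - v) * x)
  rw [one_pow, one_mul, one_mul] at e3
  have e4 : (Γ₀.integral fun s => s ^ (-(κ : ℤ) - 1) *
      Complex.exp (1 * s + (0 - v) * x / s) * g v) =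
      g v * Γ₀.integral fun s => s ^ (-(κ : ℤ) - 1) * Complex.exp (1 * s + (0 - v) * x / s) := by
    rw [← Contour.integral_const_mul]
    congr 1; ext s; ring
  rw [e4, e3, mul_comm, hg_def, ← Contour.integral_const_mul]
  refine Contour.integral_congr h.radius_in_pos.le fun u hu => ?_
  have hreg := h.regular hv hu
  rw [commonFactor_elim0_eq ν n θ hreg.left_ne hreg.right_ne, pow_zero, inv_one, mul_one, mul_assoc]

/-- Abel's regulator is the parameter `E` of the heat weight. -/
theorem exp_mul_heat (κ : ℕ) (ε t : ℝ) :
    (Real.exp (-ε / t) : ℂ) * heat κ 0 t = heat κ ε t := by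
  rw [heat, heat, Complex.ofReal_exp, mul_left_comm, ← Complex.exp_add]
  congr 2; push_cast; ring

end

theorem ofReal_mul_cpow {r : ℝ} (hr : 0 < r) {x : ℂ} (hx : x ≠ 0) (a : ℂ) :
    ((r : ℂ) * x) ^ a = (r : ℂ) ^ a * x ^ a := by
  have hr' : (r : ℂ) ≠ 0 := by exact_mod_cast hr.ne'
  rw [Complex.cpow_def_of_ne_zero (mul_ne_zero hr' hx), Complex.cpow_def_of_ne_zero hr',
    Complex.cpow_def_of_ne_zero hx, Complex.log_ofReal_mul hr hx, ← Complex.exp_add,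
    Complex.ofReal_log hr.le]
  congr 1; ring

theorem sq_cpow_half (w : ℂ) : (w ^ (1 / 2 : ℂ)) ^ 2 = w := by
  simp

theorem cpow_half_mul (w : ℂ) (κ : ℕ) : w ^ ((κ : ℂ) / 2) = (w ^ (1 / 2 : ℂ)) ^ κ := by
  rw [← Complex.cpow_nat_mul]; congr 1; ring

theorem ofReal_cpow_half {r : ℝ} (hr : 0 ≤ r) : (r : ℂ) ^ (1 / 2 : ℂ) = (√r : ℝ) := by
  rw [Real.sqrt_eq_rpow, Complex.ofReal_cpow hr]; norm_num

theorem besselI_two_mul (κ : ℕ) (w : ℂ) :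
    besselI κ (2 * w ^ (1 / 2 : ℂ)) = (w ^ (1 / 2 : ℂ)) ^ κ * besselSeries κ w := by
  rw [besselI_eq, mul_div_cancel_left₀ _ two_ne_zero, sq_cpow_half]

theorem besselK_two_mul (κ : ℕ) (w : ℂ) :
    besselK κ (2 * w ^ (1 / 2 : ℂ)) = 1 / 2 * ((w ^ (1 / 2 : ℂ)) ^ κ)⁻¹ * besselInt κ w := by
  rw [besselK, mul_div_cancel_left₀ _ two_ne_zero, besselInt]
  congr 1
  have : (2 * w ^ (1 / 2 : ℂ)) ^ 2 = 4 * w := by rw [mul_pow, sq_cpow_half]; norm_num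
  rw [this]
  congr 1; ext t
  rw [mul_div_mul_left _ _ (by norm_num : (4 : ℂ) ≠ 0)]

/-- The half-integer powers cancel, so the branch choice disappears and the result is entire in `v`.
Positivity of `x` and `y` allows them to be split off the principal powers. -/
theorem besselI_mul_besselK (κ : ℕ) {x y : ℝ} {v u : ℂ} (hx : 0 < x) (hy : 0 < y)
    (hv : v ≠ 0) (hu : u ≠ 0) :
    besselI κ (2 * (v * x) ^ (1 / 2 : ℂ)) * besselK κ (2 * (u * y) ^ (1 / 2 : ℂ)) *
      (u ^ ((κ : ℂ) / 2) / v ^ ((κ : ℂ) / 2)) =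
      1 / 2 * (((√x / √y) ^ κ : ℝ) : ℂ) * (besselSeries κ (v * x) * besselInt κ (u * y)) := by
  have hv' : v ^ (1 / 2 : ℂ) ≠ 0 := by simp [Complex.cpow_eq_zero_iff, hv]
  have hu' : u ^ (1 / 2 : ℂ) ≠ 0 := by simp [Complex.cpow_eq_zero_iff, hu]
  have hys : ((√y : ℝ) : ℂ) ≠ 0 := by exact_mod_cast (Real.sqrt_pos.2 hy).ne'
  have hxs : ((√x : ℝ) : ℂ) ≠ 0 := by exact_mod_cast (Real.sqrt_pos.2 hx).ne'
  rw [besselI_two_mul, besselK_two_mul, cpow_half_mul, cpow_half_mul, mul_comm v, mul_comm u,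
    ofReal_mul_cpow hx hv, ofReal_mul_cpow hy hu, ofReal_cpow_half hx.le, ofReal_cpow_half hy.le]
  push_cast
  rw [mul_pow, mul_pow, div_pow]
  field_simp

theorem AdmissibleII.kernelII_eq {Γin Γout : Contour} {τ : ℝ} (hτ : 0 < τ)
    (h : AdmissibleII p θ τ Γin Γout) (κ ν : ℕ) {x y : ℝ} (hx : 0 < x) (hy : 0 < y) :
    kernelII κ ν p θ Γin Γout τ x y = 1 / τ * (((√x / √y) ^ κ : ℝ) : ℂ) *
      besselHeatIntegral κ ν θ Γin Γout κ 0 (y / τ ^ 2, 1 / τ, p, x / τ, y / τ) := by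
  have hτ' : (τ : ℂ) ≠ 0 := by exact_mod_cast hτ.ne'
  have hadm := h.toAdmissible
  have hdiff := differentiable_besselSeries_comp κ ((1 / τ : ℝ) : ℂ) ((x / τ : ℝ) : ℂ)
  have hre : ∀ u ∈ Γin.points, u.re * (y / τ) < y / τ ^ 2 := fun u hu => by
    have := mul_lt_mul_of_pos_right (h.re_lt u hu) (show 0 < y / τ by positivity)
    refine this.trans_eq ?_
    field_simp
  rw [besselHeatIntegral, hadm.heatIntegral_eq_integral ν hdiff.continuous κ 0 hre,
    ← Contour.integral_integral (integrable_density_besselInt hadm.radius_out_pos.le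
      hadm.radius_in_pos.le (hadm.continuousOn_pow ν hdiff.continuous 0) κ hre), kernelII,
    ← Contour.integral_const_mul, ← Contour.integral_const_mul]
  -- The outer circle may pass through `1/τ`. For `κ > 0` division by zero gives the integrand the
  -- value `0` there, but a single point of the circle does not affect the integral.
  refine Contour.integral_congr_of_ne hadm.radius_out_pos (1 / τ) fun v hv hv1 => ?_
  rw [← Contour.integral_const_mul, ← Contour.integral_const_mul]
  refine Contour.integral_congr hadm.radius_in_pos.le fun u hu => ?_
  have hv2 : 1 - (τ : ℂ) * v ≠ 0 := fun e => hv1 (by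
    rw [eq_div_iff hτ']; linear_combination -e)
  have hu2 : 1 - (τ : ℂ) * u ≠ 0 := fun e => (h.re_lt u hu).ne (by
    have : u = ((1 / τ : ℝ) : ℂ) := by
      push_cast; rw [eq_div_iff hτ']; linear_combination -e
    rw [this, Complex.ofReal_re])
  have hmain := besselI_mul_besselK κ (x := x / τ ^ 2) (y := y / τ ^ 2)
    (by positivity) (by positivity) hv2 hu2
  have hs : √(x / τ ^ 2) / √(y / τ ^ 2) = √x / √y := by
    rw [Real.sqrt_div hx.le, Real.sqrt_div hy.le, Real.sqrt_sq hτ.le]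
    field_simp
  rw [hs] at hmain
  have e1 : (1 - (τ : ℂ) * v) * ((x / τ ^ 2 : ℝ) : ℂ) =
      (((1 / τ : ℝ) : ℂ) - v) * ((x / τ : ℝ) : ℂ) := by push_cast; field_simp
  have e2 : (1 - (τ : ℂ) * u) * ((y / τ ^ 2 : ℝ) : ℂ) =
      ((y / τ ^ 2 : ℝ) : ℂ) - u * ((y / τ : ℝ) : ℂ) := by push_cast; field_simp
  have e3 : (1 - (τ : ℂ) * v) * (x : ℂ) / (τ : ℂ) ^ 2 = (1 - (τ : ℂ) * v) * ((x / τ ^ 2 : ℝ) : ℂ) := by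
    push_cast; ring
  have e4 : (1 - (τ : ℂ) * u) * (y : ℂ) / (τ : ℂ) ^ 2 = (1 - (τ : ℂ) * u) * ((y / τ ^ 2 : ℝ) : ℂ) := by
    push_cast; ring
  rw [e3, e4, hmain, e1, e2, pow_zero, inv_one]
  ring
end

/-! ### The limit `τ → ∞`. -/

section
variable {n m : ℕ} {p : Fin n → ℝ} {θ : Fin m → ℝ}

theorem exists_pos_forall_bounds (hθ : ∀ l, θ l ≤ 0) :
    ∃ c : ℝ, 0 < c ∧ ∀ l, -(2 * c) ≤ θ l ∧ θ l ≤ 0 := by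
  have h0 : 0 ≤ ∑ l, |θ l| := Finset.sum_nonneg fun _ _ => abs_nonneg _
  refine ⟨1 + ∑ l, |θ l|, by linarith, fun l => ⟨?_, hθ l⟩⟩
  have := Finset.single_le_sum (f := fun l => |θ l|) (fun _ _ => abs_nonneg _) (Finset.mem_univ l)
  have := neg_abs_le (θ l)
  linarith

/-- The limit of the kernels at the hard edge, which is also the Abel integral for `K_I`. -/
theorem exists_tendsto_and_hasAbelIntegral (κ ν n : ℕ) (hθ : ∀ l, θ l ≤ 0)
    {Γ₀ Γin Γout : Contour} (h₀ : Γ₀.Encloses 0)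
    (h : Admissible (Fin.elim0 : Fin 0 → ℝ) θ Γin Γout) :
    ∃ Δin Δout : Contour, (∀ p : Fin n → ℝ, (∀ k, |p k| ≤ 1) → Admissible p θ Δin Δout) ∧
      ∀ x y : ℝ, 0 < x → 0 < y →
        HasAbelIntegral (integrandI κ ν θ Γ₀ Γin Γout x y) (kernelI κ ν θ Γ₀ Γin Γout x y) ∧
        Tendsto (besselHeatIntegral κ ν θ Δin Δout κ 0) (hardEdgeFilter n (x, y))
          (𝓝 (kernelI κ ν θ Γ₀ Γin Γout x y)) := by
  obtain ⟨c, hc, hθc⟩ := exists_pos_forall_bounds hθ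
  have hΔ : ∀ p : Fin n → ℝ, (∀ k, |p k| ≤ 1) →
      Admissible p θ (saddleCircle c 1) ⟨0, c + √(c ^ 2 + 1) + 2⟩ := fun p hp =>
    admissible_saddleCircle hc one_pos hθc (by linarith) fun k =>
      (hp k).trans_lt (by linarith [Real.sqrt_nonneg (c ^ 2 + 1)])
  refine ⟨_, _, hΔ, fun x y hx hy => ?_⟩
  have hp0 : ∀ k, |(0 : Fin n → ℝ) k| ≤ 1 := by simp
  obtain ⟨a, ha⟩ := exists_tendsto_besselHeatIntegral κ ν hc hθc hΔ (z := (x, y)) hy 0 κ 0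
  simp only [pow_zero, one_mul] at ha
  have hdiff := differentiable_besselSeries_comp κ ((0 : ℝ) : ℂ) (x : ℂ)
  have hf : ∀ ε t : ℝ, (Real.exp (-ε / t) : ℂ) * integrandI κ ν θ Γ₀ Γin Γout x y t =
      heat κ ε t * loopIntegral ν (0 : Fin n → ℝ) θ Γin Γout
        (fun v => besselSeries κ ((((0 : ℝ) : ℂ) - v) * x)) 0 (y / t) := fun ε t => by
    rw [integrandI_eq κ ν n h₀ h, ← mul_assoc, exp_mul_heat, Complex.ofReal_zero]
  have hAbel : HasAbelIntegral (integrandI κ ν θ Γ₀ Γin Γout x y) a := by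
    constructor
    · intro ε hε
      obtain ⟨Γ, Γ', hadm, hre⟩ := exists_admissible_re_mul_lt hc hθc hp0 hε hy
      simp only [hf, (h.of_elim0 n).loopIntegral_eq hadm ν hdiff]
      exact hadm.integrableOn_heat_mul ν hdiff.continuous κ 0 hre
    · have hpath : Tendsto (fun ε : ℝ => (ε, (0 : ℝ), (0 : Fin n → ℝ), x, y)) (𝓝[>] 0)
          (hardEdgeFilter n (x, y)) :=
        tendsto_id.prodMk (tendsto_const_nhds.prodMk
          (tendsto_const_nhds.prodMk tendsto_const_nhds))
      refine (ha.comp hpath).congr fun ε => ?_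
      simp only [Function.comp, besselHeatIntegral, hf]
      rw [(hΔ 0 hp0).heatIntegral_eq (h.of_elim0 n) ν hdiff]
      rfl
  have hk : kernelI κ ν θ Γ₀ Γin Γout x y = a := hAbel.abelIntegral_eq
  rw [hk]
  exact ⟨hAbel, ha⟩

theorem tendstoUniformlyOn_kernelI (κ ν n : ℕ) (hθ : ∀ l, θ l ≤ 0) {p : ℝ → Fin n → ℝ}
    (hp : ∀ᶠ τ in atTop, ∀ k, 0 ≤ p τ k ∧ p τ k < 1 / τ)
    {Γ₀ Γin Γout : Contour} {Δin Δout : ℝ → Contour} (h₀ : Γ₀.Encloses 0)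
    (h : Admissible (Fin.elim0 : Fin 0 → ℝ) θ Γin Γout)
    (hΔ : ∀ᶠ τ in atTop, AdmissibleII (p τ) θ τ (Δin τ) (Δout τ)) {C : Set (ℝ × ℝ)}
    (hC : IsCompact C) (hC0 : C ⊆ Ioi 0 ×ˢ Ioi 0) :
    TendstoUniformlyOn
      (fun (τ : ℝ) (z : ℝ × ℝ) =>
        (τ : ℂ) * kernelII κ ν (p τ) θ (Δin τ) (Δout τ) τ (τ * z.1) (τ * z.2) *
          (((z.2 / z.1) ^ ((κ : ℝ) / 2) : ℝ) : ℂ))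
      (fun z => kernelI κ ν θ Γ₀ Γin Γout z.1 z.2) atTop C := by
  obtain ⟨Γ, Γ', hΓ, hlim⟩ := exists_tendsto_and_hasAbelIntegral κ ν n hθ h₀ h
  refine tendstoUniformlyOn_of_forall_tendsto hC fun z hz => ?_
  have hz0 := hC0 hz
  have hinv : Tendsto (fun τ : ℝ => 1 / τ) atTop (𝓝 0) := by
    simpa using tendsto_inv_atTop_zero (𝕜 := ℝ)
  have hp0 : Tendsto p atTop (𝓝 0) := by
    rw [tendsto_pi_nhds]
    intro k
    refine squeeze_zero' ?_ ?_ hinv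
    · filter_upwards [hp] with τ hτ using (hτ k).1
    · filter_upwards [hp] with τ hτ using (hτ k).2.le
  have hmono : (atTop : Filter ℝ) ×ˢ 𝓝[C] z ≤ atTop ×ˢ 𝓝 z :=
    Filter.prod_mono le_rfl nhdsWithin_le_nhds
  have hpos : ∀ᶠ q : ℝ × ℝ × ℝ in atTop ×ˢ 𝓝[C] z, 0 < q.2.1 ∧ 0 < q.2.2 :=
    Filter.Eventually.filter_mono hmono (tendsto_snd.eventually
      (((isOpen_Ioi.prod isOpen_Ioi).mem_nhds hz0)))
  have hτ : ∀ᶠ q : ℝ × ℝ × ℝ in atTop ×ˢ 𝓝[C] z, 1 ≤ q.1 ∧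
      (∀ k, 0 ≤ p q.1 k ∧ p q.1 k < 1 / q.1) ∧ AdmissibleII (p q.1) θ q.1 (Δin q.1) (Δout q.1) :=
    tendsto_fst.eventually ((eventually_ge_atTop 1).and (hp.and hΔ))
  have hfst : Tendsto (fun q : ℝ × ℝ × ℝ => q.1) (atTop ×ˢ 𝓝[C] z) atTop := tendsto_fst
  have hsnd : Tendsto (fun q : ℝ × ℝ × ℝ => q.2) (atTop ×ˢ 𝓝[C] z) (𝓝 z) :=
    tendsto_snd.mono_right nhdsWithin_le_nhds
  -- At `(τx, τy)` the parameters of `kernelII_eq` become `E = y/τ`, `δ = 1/τ`, `x` and `y`.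
  have hpath : Tendsto (fun q : ℝ × ℝ × ℝ => (q.2.2 * (1 / q.1), 1 / q.1, p q.1, q.2))
      (atTop ×ˢ 𝓝[C] z) (hardEdgeFilter n z) := by
    refine Tendsto.prodMk ?_ ((hinv.comp hfst).prodMk ((hp0.comp hfst).prodMk hsnd))
    refine tendsto_nhdsWithin_iff.2 ⟨?_, ?_⟩
    · simpa using ((continuous_snd.tendsto z).comp hsnd).mul (hinv.comp hfst)
    · filter_upwards [hpos, hτ] with q h1 h2
      have : 0 < q.1 := by linarith [h2.1]
      exact mul_pos h1.2 (by positivity)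
  refine ((hlim z.1 z.2 hz0.1 hz0.2).2.comp hpath).congr' ?_
  filter_upwards [hpos, hτ] with q hq1 hq2
  obtain ⟨τ, x, y⟩ := q
  obtain ⟨hx, hy⟩ : 0 < x ∧ 0 < y := hq1
  obtain ⟨h1, h2, h3⟩ : 1 ≤ τ ∧ (∀ k, 0 ≤ p τ k ∧ p τ k < 1 / τ) ∧
    AdmissibleII (p τ) θ τ (Δin τ) (Δout τ) := hq2
  have hτ0 : 0 < τ := by linarith
  have hpa : ∀ k, |p τ k| ≤ 1 := fun k => by
    rw [abs_of_nonneg (h2 k).1]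
    refine (h2 k).2.le.trans ?_
    rw [div_le_one hτ0]; exact h1
  have hdiff := differentiable_besselSeries_comp κ ((1 / τ : ℝ) : ℂ) (x : ℂ)
  simp only [Function.comp]
  rw [h3.kernelII_eq hτ0 κ ν (mul_pos hτ0 hx) (mul_pos hτ0 hy)]
  have e1 : τ * y / τ ^ 2 = y * (1 / τ) := by field_simp
  have e2 : τ * x / τ = x := by field_simp
  have e3 : τ * y / τ = y := by field_simp
  have e4 : √(τ * x) / √(τ * y) = √x / √y := by
    rw [Real.sqrt_mul hτ0.le, Real.sqrt_mul hτ0.le]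
    have := Real.sqrt_pos.2 hτ0
    field_simp
  have e5 : (y / x) ^ ((κ : ℝ) / 2) = (√y / √x) ^ κ := by
    rw [← Real.sqrt_div hy.le, Real.sqrt_eq_rpow, ← Real.rpow_natCast, ← Real.rpow_mul (by positivity)]
    congr 1; ring
  have e6 : (√x / √y) ^ κ * (√y / √x) ^ κ = 1 := by
    have := Real.sqrt_pos.2 hx
    have := Real.sqrt_pos.2 hy
    rw [← mul_pow]
    field_simp
    exact one_pow _
  rw [e1, e2, e3, e4, e5]
  have e7 : besselHeatIntegral κ ν θ (Δin τ) (Δout τ) κ 0 (y * (1 / τ), 1 / τ, p τ, x, y) =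
      besselHeatIntegral κ ν θ Γ Γ' κ 0 (y * (1 / τ), 1 / τ, p τ, x, y) :=
    h3.toAdmissible.heatIntegral_eq (hΓ _ hpa) ν hdiff κ 0 _ _
  have e6' : (((√x / √y) ^ κ : ℝ) : ℂ) * (((√y / √x) ^ κ : ℝ) : ℂ) = 1 := by
    rw [← Complex.ofReal_mul, e6, Complex.ofReal_one]
  rw [e7]
  have hτ' : (τ : ℂ) ≠ 0 := by exact_mod_cast hτ0.ne'
  have e8 : (τ : ℂ) * (1 / τ) = 1 := by field_simp
  linear_combination (-(τ : ℂ) * (1 / τ) * besselHeatIntegral κ ν θ Γ Γ' κ 0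
    (y * (1 / τ), 1 / τ, p τ, x, y)) * e6' -
    besselHeatIntegral κ ν θ Γ Γ' κ 0 (y * (1 / τ), 1 / τ, p τ, x, y) * e8
end

/-! ### Bessel asymptotics for large real part and bounded imaginary part. -/

section
-- Put `s = e^(iφ)` and `a = b = z/2` in the contour formula. Periodicity centres the range at the
-- maximum of `cos`, ready for Laplace's method.
theorem besselI_eq_integral (κ : ℕ) (z : ℂ) :
    besselI κ z = 1 / (2 * Real.pi) * ∫ φ in (-Real.pi)..Real.pi,
      Complex.exp (-(κ * φ * Complex.I)) * Complex.exp (z * Real.cos φ) := by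
  have h := Contour.integral_unit_exp_add κ (z / 2) (z / 2)
  rw [besselI_eq, sq, ← h, Contour.integral_eq]
  have hper : Function.Periodic (fun φ : ℝ => Complex.exp (-(κ * φ * Complex.I)) *
      Complex.exp (z * Real.cos φ)) (2 * Real.pi) := fun φ => by
    have e : Complex.exp (-(κ * ((φ + 2 * Real.pi : ℝ) : ℂ) * Complex.I)) =
        Complex.exp (-(κ * φ * Complex.I)) := by
      rw [Complex.exp_eq_exp_iff_exists_int]
      exact ⟨-κ, by push_cast; ring⟩
    simp only [e, Real.cos_add_two_pi]
  have h2 := hper.intervalIntegral_add_eq (-Real.pi) 0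
  rw [show -Real.pi + 2 * Real.pi = Real.pi by ring, zero_add] at h2
  rw [h2, intervalIntegral.integral_of_le (by positivity), ← integral_const_mul]
  congr 1; ext φ
  have hs : (⟨0, 1⟩ : Contour).pt φ = Complex.exp (φ * Complex.I) := by
    simp [Contour.pt, circleMap]
  have e1 : Complex.exp (φ * Complex.I) ^ (-(κ : ℤ) - 1) =
      Complex.exp (-(κ * φ * Complex.I)) * Complex.exp (-(φ * Complex.I)) := by
    rw [← Complex.exp_int_mul, ← Complex.exp_add]; congr 1; push_cast; ring
  have e2 : z / 2 * Complex.exp (φ * Complex.I) + z / 2 / Complex.exp (φ * Complex.I) =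
      z * Real.cos φ := by
    rw [div_eq_mul_inv (z / 2) (Complex.exp _), ← Complex.exp_neg, Complex.ofReal_cos, Complex.cos,
      neg_mul]
    ring
  have e3 : Complex.exp (φ * Complex.I) * Complex.exp (-(φ * Complex.I)) = 1 := by
    rw [← Complex.exp_add, add_neg_cancel, Complex.exp_zero]
  rw [hs, e1, e2, Contour.weight, circleMap]
  simp only [Complex.ofReal_one, one_mul, zero_add]
  linear_combination (1 / (2 * (Real.pi : ℂ)) * Complex.exp (-(κ * φ * Complex.I)) *
    Complex.exp (z * Real.cos φ)) * e3

theorem integral_exp_neg_half_sq :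
    ∫ ψ : ℝ, Complex.exp (-((ψ ^ 2 / 2 : ℝ) : ℂ)) = ((√(2 * Real.pi) : ℝ) : ℂ) := by
  have h := integral_gaussian (1 / 2)
  rw [show Real.pi / (1 / 2) = 2 * Real.pi by ring] at h
  rw [← h, ← integral_complex_ofReal]
  congr 1; ext ψ
  rw [Complex.ofReal_exp]; congr 1; push_cast; ring

section
variable {ι : Type*} {l : Filter ι} {z : ι → ℂ}

theorem tendsto_sqrt_mul_besselI [l.IsCountablyGenerated] (κ : ℕ)
    (hre : Tendsto (fun i => (z i).re) l atTop) {M : ℝ} (him : ∀ᶠ i in l, |(z i).im| ≤ M) :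
    Tendsto (fun i => ((√(z i).re : ℝ) : ℂ) * Complex.exp (-z i) * besselI κ (z i)) l
      (𝓝 (1 / (2 * Real.pi) * ((√(2 * Real.pi) : ℝ) : ℂ))) := by
  -- The variable `φ = ψ/√(Re z)` turns `z(1 - cos φ)` into `ψ²/2 + o(1)`; the Gaussian majorant
  -- comes from `cos φ ≤ 1 - 2φ²/π²` on `[-π, π]`.
  let f : ι → ℝ → ℂ := fun i ψ => (Ioc (-(Real.pi * √(z i).re)) (Real.pi * √(z i).re)).indicator
    (fun ψ => Complex.exp (-(κ * ((ψ / √(z i).re : ℝ) : ℂ) * Complex.I)) *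
      Complex.exp (-(z i * ((1 - Real.cos (ψ / √(z i).re) : ℝ) : ℂ)))) ψ
  have hsq : Tendsto (fun i => √(z i).re) l atTop := Real.tendsto_sqrt_atTop.comp hre
  have hf : ∀ᶠ i in l, 1 / (2 * Real.pi) * ∫ ψ, f i ψ =
      ((√(z i).re : ℝ) : ℂ) * Complex.exp (-z i) * besselI κ (z i) := by
    filter_upwards [hsq.eventually_gt_atTop 0] with i hi
    have h := intervalIntegral.integral_comp_div (a := -(Real.pi * √(z i).re))
      (b := Real.pi * √(z i).re) (fun φ : ℝ => Complex.exp (-(κ * φ * Complex.I)) *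
        Complex.exp (-(z i * ((1 - Real.cos φ : ℝ) : ℂ)))) hi.ne'
    rw [neg_div, mul_div_cancel_right₀ _ hi.ne'] at h
    simp only [f]
    rw [integral_indicator measurableSet_Ioc, ← intervalIntegral.integral_of_le
      (by nlinarith [Real.pi_pos]), h, besselI_eq_integral, Complex.real_smul]
    have e : ∀ φ : ℝ, Complex.exp (-(κ * φ * Complex.I)) *
        Complex.exp (-(z i * ((1 - Real.cos φ : ℝ) : ℂ))) = Complex.exp (-z i) *
        (Complex.exp (-(κ * φ * Complex.I)) * Complex.exp (z i * Real.cos φ)) := fun φ => by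
      rw [← Complex.exp_add, ← Complex.exp_add, ← Complex.exp_add]
      congr 1; push_cast; ring
    simp only [e, intervalIntegral.integral_const_mul]
    ring
  refine Tendsto.congr' hf (Tendsto.const_mul _ ?_)
  rw [← integral_exp_neg_half_sq]
  refine tendsto_integral_filter_of_dominated_convergence
    (fun ψ => Real.exp (-(2 / Real.pi ^ 2) * ψ ^ 2)) ?_ ?_ ?_ ?_
  · refine Eventually.of_forall fun i => ?_
    refine (Measurable.indicator ?_ measurableSet_Ioc).aestronglyMeasurable
    fun_prop
  · filter_upwards [hsq.eventually_gt_atTop 0] with i hi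
    refine Eventually.of_forall fun ψ => ?_
    simp only [f]
    by_cases hψ : ψ ∈ Ioc (-(Real.pi * √(z i).re)) (Real.pi * √(z i).re)
    · rw [indicator_of_mem hψ, norm_mul, Complex.norm_exp, Complex.norm_exp, ← Real.exp_add]
      gcongr
      have h1 : (-(κ * ((ψ / √(z i).re : ℝ) : ℂ) * Complex.I)).re = 0 := by simp
      have h2 : (-(z i * ((1 - Real.cos (ψ / √(z i).re) : ℝ) : ℂ))).re =
          -((z i).re * (1 - Real.cos (ψ / √(z i).re))) := by
        rw [Complex.neg_re, Complex.re_mul_ofReal]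
      rw [h1, h2, zero_add]
      have habs : |ψ / √(z i).re| ≤ Real.pi := by
        rw [abs_div, abs_of_pos hi, div_le_iff₀ hi]
        exact abs_le.2 ⟨hψ.1.le, hψ.2⟩
      have h3 := Real.cos_le_one_sub_mul_cos_sq habs
      have hpos : 0 < (z i).re := Real.sqrt_pos.1 hi
      have h4 : (z i).re * (2 / Real.pi ^ 2 * (ψ / √(z i).re) ^ 2) = 2 / Real.pi ^ 2 * ψ ^ 2 := by
        rw [div_pow, Real.sq_sqrt hpos.le]; field_simp
      nlinarith [mul_le_mul_of_nonneg_left h3 hpos.le]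
    · rw [indicator_of_notMem hψ, norm_zero]; positivity
  · exact integrable_exp_neg_mul_sq (by positivity)
  · refine Eventually.of_forall fun ψ => ?_
    have hh : Tendsto (fun i => ψ / √(z i).re) l (𝓝 0) := hsq.const_div_atTop ψ
    have hmem : ∀ᶠ i in l, ψ ∈ Ioc (-(Real.pi * √(z i).re)) (Real.pi * √(z i).re) := by
      filter_upwards [hsq.eventually_gt_atTop |ψ|] with i hi
      have h2 := Real.pi_gt_three
      have h3 := abs_nonneg ψ
      have h4 := abs_le.1 (le_refl |ψ|)
      constructor <;> nlinarith
    have hX : Tendsto (fun i => (z i).re * (1 - Real.cos (ψ / √(z i).re))) l (𝓝 (ψ ^ 2 / 2)) := by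
      rw [tendsto_iff_norm_sub_tendsto_zero]
      refine squeeze_zero' (g := fun i => (ψ / √(z i).re) ^ 2 * ψ ^ 2)
        (Eventually.of_forall fun _ => norm_nonneg _) ?_ ?_
      · filter_upwards [hsq.eventually_gt_atTop 0,
          hh.abs.eventually (ge_mem_nhds (show |(0 : ℝ)| < 1 by simp))] with i hi hi1
        have hpos : 0 < (z i).re := Real.sqrt_pos.1 hi
        have h1 := Real.cos_bound hi1
        set h := ψ / √(z i).re with hdef
        have hψ : ψ ^ 2 = (z i).re * h ^ 2 := by
          rw [hdef, div_pow, Real.sq_sqrt hpos.le]; field_simp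
        have e : (z i).re * (1 - Real.cos h) - ψ ^ 2 / 2 =
            -((z i).re * (Real.cos h - (1 - h ^ 2 / 2))) := by rw [hψ]; ring
        rw [e, norm_neg, norm_mul, Real.norm_of_nonneg hpos.le, Real.norm_eq_abs]
        have h4 : |h| ^ 4 = h ^ 4 := by rw [← abs_pow]; exact abs_of_nonneg (by positivity)
        rw [h4] at h1
        calc (z i).re * |Real.cos h - (1 - h ^ 2 / 2)| ≤ (z i).re * (h ^ 4 * (5 / 96)) := by gcongr
          _ ≤ (z i).re * (h ^ 4 * 1) := by gcongr; norm_num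
          _ = _ := by rw [hψ]; ring
      · simpa using (hh.pow 2).mul_const (ψ ^ 2)
    have hY : Tendsto (fun i => (z i).im * (1 - Real.cos (ψ / √(z i).re))) l (𝓝 0) := by
      refine bdd_le_mul_tendsto_zero' M ?_ ?_
      · exact him
      · have : Tendsto (fun h : ℝ => 1 - Real.cos h) (𝓝 0) (𝓝 (1 - Real.cos 0)) :=
          (by fun_prop : Continuous fun h : ℝ => 1 - Real.cos h).tendsto 0
        rw [Real.cos_zero, sub_self] at this
        exact this.comp hh
    have hlim : Tendsto (fun i => Complex.exp (-(κ * ((ψ / √(z i).re : ℝ) : ℂ) * Complex.I)) *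
        Complex.exp (-((((z i).re * (1 - Real.cos (ψ / √(z i).re)) : ℝ) : ℂ) +
          (((z i).im * (1 - Real.cos (ψ / √(z i).re)) : ℝ) : ℂ) * Complex.I))) l
        (𝓝 (Complex.exp (-(κ * ((0 : ℝ) : ℂ) * Complex.I)) *
          Complex.exp (-(((ψ ^ 2 / 2 : ℝ) : ℂ) + ((0 : ℝ) : ℂ) * Complex.I)))) := by
      have hh' := (Complex.continuous_ofReal.tendsto _).comp hh
      have hX' := (Complex.continuous_ofReal.tendsto _).comp hX
      have hY' := (Complex.continuous_ofReal.tendsto _).comp hY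
      exact (((hh'.const_mul _).mul_const _).neg.cexp).mul ((hX'.add (hY'.mul_const _)).neg.cexp)
    simp only [Complex.ofReal_zero, mul_zero, zero_mul, neg_zero, Complex.exp_zero, one_mul,
      add_zero] at hlim
    refine hlim.congr' ?_
    filter_upwards [hmem] with i hi
    simp only [f]
    rw [indicator_of_mem hi]
    congr 2
    have hri := Complex.re_add_im (z i)
    generalize 1 - Real.cos (ψ / √(z i).re) = c
    push_cast
    linear_combination (-(c : ℂ)) * hri

theorem tendsto_sqrt_mul_besselK [l.IsCountablyGenerated] (κ : ℕ)
    (hre : Tendsto (fun i => (z i).re) l atTop) {M : ℝ} (him : ∀ᶠ i in l, |(z i).im| ≤ M) :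
    Tendsto (fun i => ((√(z i).re : ℝ) : ℂ) * Complex.exp (z i) * besselK κ (z i)) l
      (𝓝 (1 / 2 * ((√(2 * Real.pi) : ℝ) : ℂ))) := by
  -- Complete the square, `-t - z²/(4t) = -z - (2t - z)²/(4t)`, and put `2t = Re z · e^(ψ/√(Re z))`,
  -- centring the peak at `ψ = 0`.
  let f : ι → ℝ → ℂ := fun i ψ =>
    ((z i).re / z i * ((Real.exp (ψ / √(z i).re) : ℝ) : ℂ)) ^ κ *
    Complex.exp (-(((√(z i).re * (Real.exp (ψ / √(z i).re) - 1) : ℝ) : ℂ) -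
      (((z i).im / √(z i).re : ℝ) : ℂ) * Complex.I) ^ 2 *
        ((Real.exp (-(ψ / √(z i).re)) / 2 : ℝ) : ℂ))
  have hsq : Tendsto (fun i => √(z i).re) l atTop := Real.tendsto_sqrt_atTop.comp hre
  have hf : ∀ᶠ i in l, 1 / 2 * ∫ ψ, f i ψ =
      ((√(z i).re : ℝ) : ℂ) * Complex.exp (z i) * besselK κ (z i) := by
    filter_upwards [hsq.eventually_gt_atTop 0] with i hi
    have hpos : 0 < (z i).re := Real.sqrt_pos.1 hi
    have hz : z i ≠ 0 := fun e => by rw [e] at hpos; simp at hpos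
    let t : ℝ → ℝ := fun ψ => (z i).re / 2 * Real.exp (ψ / √(z i).re)
    have ht : ∀ ψ, HasDerivAt t (t ψ / √(z i).re) ψ := fun ψ => by
      have h1 := (((hasDerivAt_id' ψ).div_const (√(z i).re)).exp).const_mul ((z i).re / 2)
      refine h1.congr_deriv ?_
      simp only [t]; ring
    have htpos : ∀ ψ, 0 < t ψ := fun ψ => by positivity
    have hrange : t '' univ = Ioi 0 := by
      ext x
      simp only [image_univ, mem_range, mem_Ioi]
      refine ⟨fun ⟨ψ, h⟩ => h ▸ htpos ψ, fun hx => ⟨√(z i).re * Real.log (x / ((z i).re / 2)), ?_⟩⟩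
      simp only [t]
      rw [mul_div_cancel_left₀ _ hi.ne', Real.exp_log (by positivity)]
      field_simp
    have hinj : InjOn t univ := by
      refine (StrictMono.injective fun a b hab => ?_).injOn
      simp only [t]
      gcongr
    have hsub := integral_image_eq_integral_abs_deriv_smul MeasurableSet.univ
      (fun ψ _ => (ht ψ).hasDerivWithinAt) hinj
      (fun t : ℝ => (t : ℂ) ^ ((κ : ℤ) - 1) * Complex.exp (-(t : ℂ) - z i ^ 2 / (4 * (t : ℂ))))
    rw [hrange, Measure.restrict_univ] at hsub
    rw [besselK, hsub]
    have e : ∀ ψ, |t ψ / √(z i).re| • (((t ψ : ℝ) : ℂ) ^ ((κ : ℤ) - 1) *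
        Complex.exp (-((t ψ : ℝ) : ℂ) - z i ^ 2 / (4 * ((t ψ : ℝ) : ℂ)))) =
        ((√(z i).re : ℝ) : ℂ)⁻¹ * (z i / 2) ^ κ * Complex.exp (-z i) * f i ψ := fun ψ => by
      have htp := htpos ψ
      have htc : ((t ψ : ℝ) : ℂ) ≠ 0 := by exact_mod_cast htp.ne'
      have hsc : ((√(z i).re : ℝ) : ℂ) ≠ 0 := by exact_mod_cast hi.ne'
      rw [abs_of_pos (div_pos htp hi), Complex.real_smul, zpow_sub₀ htc, zpow_natCast, zpow_one]
      have e1 : (((z i).re : ℂ) / z i * ((Real.exp (ψ / √(z i).re) : ℝ) : ℂ)) ^ κ * (z i / 2) ^ κ =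
          ((t ψ : ℝ) : ℂ) ^ κ := by
        rw [← mul_pow]; congr 1
        simp only [t]; push_cast; field_simp
      have e2 : Complex.exp (-z i) * Complex.exp (-(((√(z i).re * (Real.exp (ψ / √(z i).re) - 1) :
          ℝ) : ℂ) - (((z i).im / √(z i).re : ℝ) : ℂ) * Complex.I) ^ 2 *
          ((Real.exp (-(ψ / √(z i).re)) / 2 : ℝ) : ℂ)) =
          Complex.exp (-((t ψ : ℝ) : ℂ) - z i ^ 2 / (4 * ((t ψ : ℝ) : ℂ))) := by
        rw [← Complex.exp_add]; congr 1
        have hexp : ((Real.exp (-(ψ / √(z i).re)) / 2 : ℝ) : ℂ) =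
            ((z i).re : ℂ) / (4 * ((t ψ : ℝ) : ℂ)) := by
          rw [Real.exp_neg]; simp only [t]; push_cast
          have : (((z i).re : ℝ) : ℂ) ≠ 0 := by exact_mod_cast hpos.ne'
          field_simp; ring
        have hlin : ((√(z i).re : ℝ) : ℂ) * (((√(z i).re * (Real.exp (ψ / √(z i).re) - 1) : ℝ) : ℂ) -
            (((z i).im / √(z i).re : ℝ) : ℂ) * Complex.I) = 2 * ((t ψ : ℝ) : ℂ) - z i := by
          have hss : ((√(z i).re : ℝ) : ℂ) * ((√(z i).re : ℝ) : ℂ) = ((z i).re : ℂ) := by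
            rw [← Complex.ofReal_mul, Real.mul_self_sqrt hpos.le]
          have hreim := Complex.re_add_im (z i)
          simp only [t]; push_cast
          rw [mul_sub, ← mul_assoc, hss, ← mul_assoc, mul_div_cancel₀ _ hsc]
          linear_combination -hreim
        have hre2 : ((z i).re : ℂ) = ((√(z i).re : ℝ) : ℂ) ^ 2 := by
          rw [← Complex.ofReal_pow, Real.sq_sqrt hpos.le]
        rw [hexp, hre2, mul_div_assoc', neg_mul, ← mul_pow, mul_comm _ ((√(z i).re : ℝ) : ℂ), hlin]
        field_simp; ring
      rw [← e1, ← e2]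
      simp only [f]
      push_cast
      field_simp
    simp only [e, integral_const_mul]
    have h2 : (z i / 2) ^ κ ≠ 0 := pow_ne_zero _ (div_ne_zero hz two_ne_zero)
    have hsc : ((√(z i).re : ℝ) : ℂ) ≠ 0 := by exact_mod_cast hi.ne'
    have hee : Complex.exp (z i) * Complex.exp (-z i) = 1 := by
      rw [← Complex.exp_add, add_neg_cancel, Complex.exp_zero]
    have h3 : ((z i / 2) ^ κ)⁻¹ * (z i / 2) ^ κ = 1 := inv_mul_cancel₀ h2
    have h4 : ((√(z i).re : ℝ) : ℂ) * ((√(z i).re : ℝ) : ℂ)⁻¹ = 1 := mul_inv_cancel₀ hsc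
    symm
    calc _ = (((√(z i).re : ℝ) : ℂ) * ((√(z i).re : ℝ) : ℂ)⁻¹) *
          (Complex.exp (z i) * Complex.exp (-z i)) * (((z i / 2) ^ κ)⁻¹ * (z i / 2) ^ κ) *
          (1 / 2 * ∫ ψ, f i ψ) := by ring
      _ = _ := by rw [hee, h3, h4]; ring
  refine Tendsto.congr' hf (Tendsto.const_mul _ ?_)
  rw [← integral_exp_neg_half_sq]
  refine tendsto_integral_filter_of_dominated_convergence
    -- The exponential is at most `e^(M² - ψ²/4)`, the power at most `e^(κ|ψ|)`, and `κ|ψ| ≤ ψ²/8 +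
    -- 2κ²`.
    (fun ψ => Real.exp (M ^ 2 + 2 * κ ^ 2) * Real.exp (-(1 / 8) * ψ ^ 2)) ?_ ?_ ?_ ?_
  · refine Eventually.of_forall fun i => ?_
    refine Measurable.aestronglyMeasurable ?_
    fun_prop
  · filter_upwards [hre.eventually_ge_atTop (1 + 2 * M ^ 2), him] with i hi him
    refine Eventually.of_forall fun ψ => ?_
    have hX1 : 1 ≤ (z i).re := by nlinarith [sq_nonneg M]
    have hpos : 0 < (z i).re := by linarith
    have hs1 : 1 ≤ √(z i).re := Real.one_le_sqrt.2 hX1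
    have hs0 : 0 < √(z i).re := by linarith
    have hY : (z i).im ^ 2 ≤ M ^ 2 := sq_le_sq' (abs_le.1 him).1 (abs_le.1 him).2
    have hh1 : |ψ / √(z i).re| ≤ |ψ| := by
      rw [abs_div, abs_of_pos hs0]; exact div_le_self (abs_nonneg _) hs1
    have hψ : ψ ^ 2 = (z i).re * (ψ / √(z i).re) ^ 2 := by
      rw [div_pow, Real.sq_sqrt hpos.le]; field_simp
    simp only [f]
    set h := ψ / √(z i).re with hdef
    have hz : z i ≠ 0 := fun e => by rw [e] at hpos; simp at hpos
    have n1 : ‖((z i).re / z i * ((Real.exp h : ℝ) : ℂ)) ^ κ‖ ≤ Real.exp (κ * |ψ|) := by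
      rw [norm_pow, norm_mul, norm_div, Complex.norm_real, Complex.norm_real,
        Real.norm_of_nonneg hpos.le, Real.norm_of_nonneg (Real.exp_pos _).le, mul_comm (κ : ℝ),
        Real.exp_mul, Real.rpow_natCast]
      gcongr
      have : (z i).re / ‖z i‖ ≤ 1 := by
        rw [div_le_one (norm_pos_iff.2 hz)]; exact Complex.re_le_norm _
      calc (z i).re / ‖z i‖ * Real.exp h ≤ 1 * Real.exp |ψ| := by
            gcongr; exact (le_abs_self h).trans hh1
        _ = _ := one_mul _
    have n2 : ‖Complex.exp (-(((√(z i).re * (Real.exp h - 1) : ℝ) : ℂ) -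
      (((z i).im / √(z i).re : ℝ) : ℂ) * Complex.I) ^ 2 * ((Real.exp (-h) / 2 : ℝ) : ℂ))‖ ≤
        Real.exp (M ^ 2 - ψ ^ 2 / 4) := by
      rw [Complex.norm_exp]
      gcongr
      have hre' : (-(((√(z i).re * (Real.exp h - 1) : ℝ) : ℂ) -
          (((z i).im / √(z i).re : ℝ) : ℂ) * Complex.I) ^ 2).re =
          -((z i).re * (Real.exp h - 1) ^ 2 - (z i).im ^ 2 / (z i).re) := by
        rw [Complex.neg_re, sq, Complex.mul_re]
        simp only [Complex.sub_re, Complex.ofReal_re, Complex.mul_re, Complex.I_re,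
          Complex.ofReal_im, Complex.I_im, Complex.sub_im, Complex.mul_im]
        have e1 : (√(z i).re * (Real.exp h - 1)) * (√(z i).re * (Real.exp h - 1)) =
            (z i).re * (Real.exp h - 1) ^ 2 := by
          rw [mul_mul_mul_comm, Real.mul_self_sqrt hpos.le]; ring
        have e2 : ((z i).im / √(z i).re) * ((z i).im / √(z i).re) = (z i).im ^ 2 / (z i).re := by
          rw [div_mul_div_comm, Real.mul_self_sqrt hpos.le]; ring
        linear_combination -e1 + e2
      rw [Complex.re_mul_ofReal, hre']
      have hmul : Real.exp h * Real.exp (-h) = 1 := by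
        rw [← Real.exp_add, add_neg_cancel, Real.exp_zero]
      have hcosh : Real.cosh h = (Real.exp h + Real.exp (-h)) / 2 := Real.cosh_eq h
      have hc1 : 1 + h ^ 2 / 2 ≤ Real.cosh h := by
        have h1 := Real.self_le_sinh_iff.2 (show 0 ≤ |h| / 2 by positivity)
        have h2 := Real.cosh_two_mul (|h| / 2)
        rw [mul_div_cancel₀ _ two_ne_zero, Real.cosh_abs, Real.cosh_sq] at h2
        nlinarith [sq_abs h, abs_nonneg h]
      have e1 : -((z i).re * (Real.exp h - 1) ^ 2 - (z i).im ^ 2 / (z i).re) *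
          (Real.exp (-h) / 2) = -((z i).re * (Real.cosh h - 1)) +
          (z i).im ^ 2 / (z i).re * Real.exp (-h) / 2 := by
        rw [hcosh]
        linear_combination (-(z i).re * (Real.exp h / 2 - 1)) * hmul
      have hq : (z i).im ^ 2 / (z i).re ≤ M ^ 2 :=
        (div_le_self (sq_nonneg _) hX1).trans hY
      have hq2 : (z i).im ^ 2 / (z i).re ≤ (z i).re / 2 := by
        rw [div_le_iff₀ hpos]; nlinarith
      have hq0 : 0 ≤ (z i).im ^ 2 / (z i).re := by positivity
      have e2 : (z i).im ^ 2 / (z i).re * Real.exp (-h) / 2 ≤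
          (z i).im ^ 2 / (z i).re * Real.cosh h := by
        rw [hcosh]; nlinarith [Real.exp_pos h, mul_nonneg hq0 (Real.exp_pos h).le]
      rw [e1, hψ]
      have hc2 : 0 ≤ Real.cosh h - 1 := by linarith [Real.one_le_cosh h]
      nlinarith [mul_le_mul_of_nonneg_right hq2 hc2, mul_le_mul_of_nonneg_left hc1 hpos.le]
    rw [norm_mul]
    calc _ ≤ Real.exp (κ * |ψ|) * Real.exp (M ^ 2 - ψ ^ 2 / 4) := by gcongr
      _ ≤ _ := by
        rw [← Real.exp_add, ← Real.exp_add]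
        refine Real.exp_le_exp.2 ?_
        nlinarith [sq_nonneg (|ψ| - 4 * κ), sq_abs ψ]
  · exact (integrable_exp_neg_mul_sq (by norm_num)).const_mul _
  · refine Eventually.of_forall fun ψ => ?_
    have hh : Tendsto (fun i => ψ / √(z i).re) l (𝓝 0) := hsq.const_div_atTop ψ
    have hYs : Tendsto (fun i => (z i).im / √(z i).re) l (𝓝 0) := by
      simp only [div_eq_mul_inv]
      exact bdd_le_mul_tendsto_zero' M him (tendsto_inv_atTop_zero.comp hsq)
    have hYX : Tendsto (fun i => (z i).im / (z i).re) l (𝓝 0) := by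
      simp only [div_eq_mul_inv]
      exact bdd_le_mul_tendsto_zero' M him (tendsto_inv_atTop_zero.comp hre)
    have hratio : Tendsto (fun i => ((z i).re : ℂ) / z i) l (𝓝 1) := by
      have h1 : Tendsto (fun i => (1 + (((z i).im / (z i).re : ℝ) : ℂ) * Complex.I)⁻¹) l
          (𝓝 (1 + ((0 : ℝ) : ℂ) * Complex.I)⁻¹) :=
        ((((Complex.continuous_ofReal.tendsto _).comp hYX).mul_const _).const_add 1).inv₀ (by simp)
      simp only [Complex.ofReal_zero, zero_mul, add_zero, inv_one] at h1
      refine h1.congr' ?_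
      filter_upwards [hre.eventually_gt_atTop 0] with i hi
      have hi' : ((z i).re : ℂ) ≠ 0 := by exact_mod_cast hi.ne'
      have hz : z i ≠ 0 := fun e => by rw [e] at hi; simp at hi
      have e : 1 + (((z i).im / (z i).re : ℝ) : ℂ) * Complex.I = z i / (z i).re := by
        push_cast
        field_simp
        exact Complex.re_add_im (z i)
      rw [e, inv_div]
    have hlin : Tendsto (fun i => √(z i).re * (Real.exp (ψ / √(z i).re) - 1)) l (𝓝 ψ) := by
      rw [tendsto_iff_norm_sub_tendsto_zero]
      refine squeeze_zero' (g := fun i => |ψ| * |ψ / √(z i).re|)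
        (Eventually.of_forall fun _ => norm_nonneg _) ?_ ?_
      · filter_upwards [hsq.eventually_gt_atTop 0,
          hh.abs.eventually (ge_mem_nhds (show |(0 : ℝ)| < 1 by simp))] with i hi hi1
        have h1 := Real.abs_exp_sub_one_sub_id_le hi1
        set h := ψ / √(z i).re with hdef
        have hψ : ψ = √(z i).re * h := by rw [hdef]; field_simp
        have e : √(z i).re * (Real.exp h - 1) - ψ = √(z i).re * (Real.exp h - 1 - h) := by
          nth_rewrite 1 [hψ]; ring
        rw [e, norm_mul, Real.norm_of_nonneg hi.le, Real.norm_eq_abs]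
        calc √(z i).re * |Real.exp h - 1 - h| ≤ √(z i).re * h ^ 2 := by gcongr
          _ = |ψ| * |h| := by
            nth_rewrite 1 [hψ]
            rw [abs_mul, abs_of_pos hi, mul_assoc, ← sq, sq_abs]
      · simpa using hh.abs.const_mul |ψ|
    have hexp : Tendsto (fun i => Real.exp (ψ / √(z i).re)) l (𝓝 (Real.exp 0)) :=
      (Real.continuous_exp.tendsto _).comp hh
    have hexp' : Tendsto (fun i => Real.exp (-(ψ / √(z i).re)) / 2) l (𝓝 (Real.exp (-0) / 2)) :=
      ((Real.continuous_exp.tendsto _).comp hh.neg).div_const 2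
    have key := ((hratio.mul ((Complex.continuous_ofReal.tendsto _).comp hexp)).pow κ).mul
      (((((Complex.continuous_ofReal.tendsto _).comp hlin).sub
        (((Complex.continuous_ofReal.tendsto _).comp hYs).mul_const Complex.I)).pow 2).neg.mul
          ((Complex.continuous_ofReal.tendsto _).comp hexp')).cexp
    have e : (1 * ((Real.exp 0 : ℝ) : ℂ)) ^ κ * Complex.exp (-((ψ : ℂ) - ((0 : ℝ) : ℂ) *
        Complex.I) ^ 2 * ((Real.exp (-0) / 2 : ℝ) : ℂ)) = Complex.exp (-((ψ ^ 2 / 2 : ℝ) : ℂ)) := by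
      simp only [neg_zero, Real.exp_zero, Complex.ofReal_one, one_mul, one_pow, Complex.ofReal_zero,
        zero_mul, sub_zero]
      congr 1; push_cast; ring
    rw [e] at key
    exact key

end
end

/-! ### The limit `τ → 0+`. -/

section
theorem Contour.tendsto_integral_integral {ι : Type*} {l : Filter ι} [l.IsCountablyGenerated]
    {Γ Γ' : Contour} (hr : 0 ≤ Γ.radius) (hr' : 0 ≤ Γ'.radius) {H : ι → ℂ → ℂ → ℂ} {H₀ : ℂ → ℂ → ℂ}
    (hmeas : ∀ i, Measurable fun q : ℂ × ℂ => H i q.1 q.2)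
    (hH₀ : ContinuousOn (fun q : ℂ × ℂ => H₀ q.1 q.2) (Γ.points ×ˢ Γ'.points))
    (hlim : ∀ v ∈ Γ.points, ∀ u ∈ Γ'.points,
      Tendsto (fun w : ι × ℂ × ℂ => H w.1 w.2.1 w.2.2) (l ×ˢ 𝓝 (v, u)) (𝓝 (H₀ v u))) :
    Tendsto (fun i => Γ.integral fun v => Γ'.integral fun u => H i v u) l
      (𝓝 (Γ.integral fun v => Γ'.integral fun u => H₀ v u)) := by
  have hK := Γ.isCompact_points.prod Γ'.isCompact_points
  obtain ⟨C, hC⟩ := hK.exists_bound_of_continuousOn hH₀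
  have hbd : ∀ᶠ i in l, ∀ q ∈ Γ.points ×ˢ Γ'.points, ‖H i q.1 q.2‖ ≤ C + 1 := by
    -- Joint convergence at each point bounds the integrand nearby; compactness of the product of
    -- circles makes the bound uniform.
    have h1 : {w : ι × ℂ × ℂ | ‖H w.1 w.2.1 w.2.2‖ ≤ C + 1} ∈
        l ×ˢ 𝓝ˢ (Γ.points ×ˢ Γ'.points) := by
      refine hK.mem_prod_nhdsSet_of_forall fun q hq => ?_
      refine (hlim q.1 hq.1 q.2 hq.2).norm.eventually_le_const ?_
      linarith [hC q hq]
    obtain ⟨P, hP, Q, hQ, hPQ⟩ := mem_prod_iff.1 h1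
    filter_upwards [hP] with i hi q hq
    exact hPQ (mk_mem_prod hi (subset_of_mem_nhdsSet hQ hq))
  have hmeas' : ∀ i, AEStronglyMeasurable (Contour.density Γ Γ' (H i)) (angles.prod angles) :=
    fun i => by
      have h1 := Γ.continuous_weight.measurable
      have h2 := Γ'.continuous_weight.measurable
      have h3 := (hmeas i).comp ((Γ.continuous_pt.measurable.comp measurable_fst).prodMk
        (Γ'.continuous_pt.measurable.comp measurable_snd))
      exact ((h1.comp measurable_fst).mul ((h2.comp measurable_snd).mul h3)).aestronglyMeasurable
  have hbd' : ∀ᶠ i in l, ∀ᵐ q ∂(angles.prod angles), ‖Contour.density Γ Γ' (H i) q‖ ≤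
      |Γ.radius| * |Γ'.radius| * (C + 1) := by
    filter_upwards [hbd] with i hi
    refine Eventually.of_forall fun q => (norm_density_le _ _ _ _).trans ?_
    gcongr
    exact hi (Γ.pt q.1, Γ'.pt q.2) ⟨pt_mem hr q.1, pt_mem hr' q.2⟩
  rw [integral_integral (integrable_density hr hr' hH₀)]
  refine (tendsto_integral_filter_of_dominated_convergence
    (F := fun i => Contour.density Γ Γ' (H i)) (fun _ => |Γ.radius| * |Γ'.radius| * (C + 1))
    (Eventually.of_forall hmeas') hbd' (integrable_const _)
    (Eventually.of_forall fun q => ?_)).congr' ?_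
  · have h1 : Tendsto (fun i => (i, Γ.pt q.1, Γ'.pt q.2)) l (l ×ˢ 𝓝 (Γ.pt q.1, Γ'.pt q.2)) :=
      tendsto_id.prodMk tendsto_const_nhds
    exact (((hlim _ (pt_mem hr q.1) _ (pt_mem hr' q.2)).comp h1).const_mul _).const_mul _
  · filter_upwards [hbd'] with i hi
    exact (integral_integral ((integrable_const _).mono' (hmeas' i) hi)).symm

theorem measurable_besselI (κ : ℕ) : Measurable (besselI κ) := by
  have h := (differentiable_besselSeries κ).continuous
  have : besselI κ = fun z => (z / 2) ^ κ * besselSeries κ ((z / 2) ^ 2) := by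
    ext z; exact besselI_eq κ z
  rw [this]
  exact (by fun_prop : Continuous fun z : ℂ => (z / 2) ^ κ * besselSeries κ ((z / 2) ^ 2)).measurable

theorem measurable_besselK (κ : ℕ) : Measurable (besselK κ) := by
  unfold besselK
  refine Measurable.mul (by fun_prop) ?_
  have h : StronglyMeasurable (Function.uncurry fun (z : ℂ) (t : ℝ) =>
      (t : ℂ) ^ ((κ : ℤ) - 1) * Complex.exp (-(t : ℂ) - z ^ 2 / (4 * (t : ℂ)))) := by
    refine Measurable.stronglyMeasurable (Measurable.mul ?_ (by fun_prop))
    exact Measurable.pow_const (by fun_prop) _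
  exact h.integral_prod_right.measurable

/-- The argument of the Bessel functions in the interpolating kernel. -/
def besselArg (τ x : ℝ) (v : ℂ) : ℂ := 2 * ((1 - (τ : ℂ) * v) * (x : ℂ) / (τ : ℂ) ^ 2) ^ (1 / 2 : ℂ)

section
variable {ι : Type*} {l : Filter ι} {τ x : ι → ℝ} {v : ι → ℂ} {x₀ : ℝ} {v₀ : ℂ}

theorem tendsto_one_sub_mul (hτ : Tendsto τ l (𝓝[>] 0)) (hv : Tendsto v l (𝓝 v₀)) :
    Tendsto (fun i => 1 - (τ i : ℂ) * v i) l (𝓝 1) := by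
  have h := (((Complex.continuous_ofReal.tendsto 0).comp
    (hτ.mono_right nhdsWithin_le_nhds)).mul hv).const_sub 1
  simpa using h

theorem tendsto_one_sub_mul_cpow (hτ : Tendsto τ l (𝓝[>] 0)) (hv : Tendsto v l (𝓝 v₀)) (a : ℂ) :
    Tendsto (fun i => (1 - (τ i : ℂ) * v i) ^ a) l (𝓝 1) := by
  have h := (tendsto_one_sub_mul hτ hv).cpow (tendsto_const_nhds (x := a)) (by simp)
  simpa using h

theorem eventually_besselArg_eq (hτ : Tendsto τ l (𝓝[>] 0)) (hx : Tendsto x l (𝓝 x₀)) (hx₀ : 0 < x₀)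
    (hv : Tendsto v l (𝓝 v₀)) : ∀ᶠ i in l, 0 < τ i ∧ 0 < x i ∧
      besselArg (τ i) (x i) (v i) =
        ((2 * √(x i) / τ i : ℝ) : ℂ) * (1 - (τ i : ℂ) * v i) ^ (1 / 2 : ℂ) := by
  filter_upwards [hτ self_mem_nhdsWithin, hx.eventually (lt_mem_nhds hx₀),
    (tendsto_one_sub_mul hτ hv).eventually_ne one_ne_zero] with i hi hxi hne
  have hi : 0 < τ i := hi
  refine ⟨hi, hxi, ?_⟩
  have e : (1 - (τ i : ℂ) * v i) * (x i : ℂ) / (τ i : ℂ) ^ 2 =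
      ((x i / τ i ^ 2 : ℝ) : ℂ) * (1 - (τ i : ℂ) * v i) := by push_cast; ring
  rw [besselArg, e, ofReal_mul_cpow (by positivity) hne, ofReal_cpow_half (by positivity),
    Real.sqrt_div hxi.le, Real.sqrt_sq hi.le]
  push_cast; ring

/-- With `g = (1 - τv)^(1/2)`, `g - 1 = -τv/(g + 1)`; the prefactor `2√x/τ` then gives `-2√x v/(g +
1) → -√x v`. -/
theorem tendsto_besselArg_sub (hτ : Tendsto τ l (𝓝[>] 0)) (hx : Tendsto x l (𝓝 x₀)) (hx₀ : 0 < x₀)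
    (hv : Tendsto v l (𝓝 v₀)) :
    Tendsto (fun i => besselArg (τ i) (x i) (v i) - ((2 * √(x i) / τ i : ℝ) : ℂ)) l
      (𝓝 (-(((√x₀ : ℝ) : ℂ) * v₀))) := by
  have hg := tendsto_one_sub_mul_cpow hτ hv (1 / 2)
  have hsq : Tendsto (fun i => ((√(x i) : ℝ) : ℂ)) l (𝓝 ((√x₀ : ℝ) : ℂ)) :=
    (Complex.continuous_ofReal.tendsto _).comp ((Real.continuous_sqrt.tendsto _).comp hx)
  have hlim := ((hsq.mul hv).const_mul (-2)).mul ((hg.add_const 1).inv₀ (by norm_num))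
  have e : -2 * (((√x₀ : ℝ) : ℂ) * v₀) * ((1 : ℂ) + 1)⁻¹ = -(((√x₀ : ℝ) : ℂ) * v₀) := by
    norm_num; ring
  rw [e] at hlim
  refine hlim.congr' ?_
  filter_upwards [eventually_besselArg_eq hτ hx hx₀ hv,
    (hg.add_const 1).eventually_ne (by norm_num : (1 : ℂ) + 1 ≠ 0)] with i hi hne
  obtain ⟨h1, -, h3⟩ := hi
  rw [h3]
  have hs := sq_cpow_half (1 - (τ i : ℂ) * v i)
  set g := (1 - (τ i : ℂ) * v i) ^ (1 / 2 : ℂ)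
  have hτ' : (τ i : ℂ) ≠ 0 := by exact_mod_cast h1.ne'
  push_cast
  field_simp
  linear_combination (-((√(x i) : ℝ) : ℂ)) * hs

theorem tendsto_mul_besselArg (hτ : Tendsto τ l (𝓝[>] 0)) (hx : Tendsto x l (𝓝 x₀)) (hx₀ : 0 < x₀)
    (hv : Tendsto v l (𝓝 v₀)) :
    Tendsto (fun i => τ i * (besselArg (τ i) (x i) (v i)).re) l (𝓝 (2 * √x₀)) := by
  have hg := (Complex.continuous_re.tendsto _).comp (tendsto_one_sub_mul_cpow hτ hv (1 / 2))
  have hsq : Tendsto (fun i => 2 * √(x i)) l (𝓝 (2 * √x₀)) :=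
    ((Real.continuous_sqrt.tendsto _).comp hx).const_mul 2
  have hlim := hsq.mul hg
  rw [Complex.one_re, mul_one] at hlim
  refine hlim.congr' ?_
  filter_upwards [eventually_besselArg_eq hτ hx hx₀ hv] with i hi
  obtain ⟨h1, -, h3⟩ := hi
  rw [h3, Complex.re_ofReal_mul]
  simp only [Function.comp]
  field_simp

theorem tendsto_besselArg_re (hτ : Tendsto τ l (𝓝[>] 0)) (hx : Tendsto x l (𝓝 x₀)) (hx₀ : 0 < x₀)
    (hv : Tendsto v l (𝓝 v₀)) :
    Tendsto (fun i => (besselArg (τ i) (x i) (v i)).re) l atTop := by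
  have h := (tendsto_mul_besselArg hτ hx hx₀ hv).pos_mul_atTop (by positivity)
    (tendsto_inv_nhdsGT_zero.comp hτ)
  refine h.congr' ?_
  filter_upwards [hτ self_mem_nhdsWithin] with i hi
  have hi : 0 < τ i := hi
  simp only [Function.comp]
  field_simp

theorem eventually_abs_besselArg_im_le (hτ : Tendsto τ l (𝓝[>] 0)) (hx : Tendsto x l (𝓝 x₀))
    (hx₀ : 0 < x₀) (hv : Tendsto v l (𝓝 v₀)) :
    ∃ M : ℝ, ∀ᶠ i in l, |(besselArg (τ i) (x i) (v i)).im| ≤ M := by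
  have h := ((Complex.continuous_im.tendsto _).comp (tendsto_besselArg_sub hτ hx hx₀ hv)).abs
  refine ⟨|(-(((√x₀ : ℝ) : ℂ) * v₀)).im| + 1, ?_⟩
  filter_upwards [h.eventually_le_const (lt_add_one _)] with i hi
  simpa only [Function.comp, Complex.sub_im, Complex.ofReal_im, sub_zero] using hi

theorem tendsto_besselI_mul_besselK [l.IsCountablyGenerated] (κ : ℕ) (hτ : Tendsto τ l (𝓝[>] 0))
    (hx : Tendsto x l (𝓝 x₀)) (hx₀ : 0 < x₀) (hv : Tendsto v l (𝓝 v₀))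
    {y : ι → ℝ} {u : ι → ℂ} {y₀ : ℝ} {u₀ : ℂ} (hy : Tendsto y l (𝓝 y₀)) (hy₀ : 0 < y₀)
    (hu : Tendsto u l (𝓝 u₀)) :
    Tendsto (fun i => 2 / (τ i : ℂ) * (besselI κ (besselArg (τ i) (x i) (v i)) *
      besselK κ (besselArg (τ i) (y i) (u i))) *
      ((Real.exp (2 * (√(y i) - √(x i)) / τ i) : ℝ) : ℂ)) l
      (𝓝 (1 / 2 * (((x₀ * y₀) ^ (-(1 / 4) : ℝ) : ℝ) : ℂ) *
        Complex.exp (-((√x₀ : ℝ) * v₀) + (√y₀ : ℝ) * u₀))) := by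
  obtain ⟨M, hM⟩ := eventually_abs_besselArg_im_le hτ hx hx₀ hv
  obtain ⟨M', hM'⟩ := eventually_abs_besselArg_im_le hτ hy hy₀ hu
  have hI := tendsto_sqrt_mul_besselI κ (tendsto_besselArg_re hτ hx hx₀ hv) hM
  have hK := tendsto_sqrt_mul_besselK κ (tendsto_besselArg_re hτ hy hy₀ hu) hM'
  have hrx := (Complex.continuous_ofReal.tendsto _).comp
    ((Real.continuous_sqrt.tendsto _).comp (tendsto_mul_besselArg hτ hx hx₀ hv))
  have hry := (Complex.continuous_ofReal.tendsto _).comp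
    ((Real.continuous_sqrt.tendsto _).comp (tendsto_mul_besselArg hτ hy hy₀ hu))
  have hex := (tendsto_besselArg_sub hτ hx hx₀ hv).cexp
  have hey := (tendsto_besselArg_sub hτ hy hy₀ hu).neg.cexp
  have hx2 : 0 < √(2 * √x₀) := by positivity
  have hy2 : 0 < √(2 * √y₀) := by positivity
  have hne : ((√(2 * √x₀) : ℝ) : ℂ) * ((√(2 * √y₀) : ℝ) : ℂ) ≠ 0 := by
    exact_mod_cast (mul_pos hx2 hy2).ne'
  -- The constants of `I_κ` and `K_κ` multiply to `1/2`, which the leading `2` cancels. Since `√(Re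
  -- z) √(Re w) ~ 2(x₀y₀)^(1/4)/τ`, the factor `1/τ` is absorbed and `½ (x₀y₀)^(-1/4)` remains.
  have hlim := (((hI.mul hK).const_mul 2).mul (hex.mul hey)).mul ((hrx.mul hry).inv₀ hne)
  have e1 : √(2 * √x₀) * √(2 * √y₀) = 2 * (x₀ * y₀) ^ (1 / 4 : ℝ) := by
    rw [← Real.sqrt_mul (by positivity), show 2 * √x₀ * (2 * √y₀) = 2 ^ 2 * (√x₀ * √y₀) by ring,
      Real.sqrt_mul (by positivity), Real.sqrt_sq (by norm_num), ← Real.sqrt_mul hx₀.le,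
      Real.sqrt_eq_rpow, Real.sqrt_eq_rpow, ← Real.rpow_mul (by positivity)]
    norm_num
  have e2 : 2 * (1 / (2 * (Real.pi : ℂ)) * ((√(2 * Real.pi) : ℝ) : ℂ) *
      (1 / 2 * ((√(2 * Real.pi) : ℝ) : ℂ))) = 1 := by
    have h : ((√(2 * Real.pi) : ℝ) : ℂ) * ((√(2 * Real.pi) : ℝ) : ℂ) = 2 * Real.pi := by
      rw [← Complex.ofReal_mul, Real.mul_self_sqrt (by positivity)]; push_cast; ring
    have hpi : (Real.pi : ℂ) ≠ 0 := by exact_mod_cast Real.pi_ne_zero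
    field_simp
    linear_combination h
  have e3 : (((√(2 * √x₀) : ℝ) : ℂ) * ((√(2 * √y₀) : ℝ) : ℂ))⁻¹ =
      1 / 2 * (((x₀ * y₀) ^ (-(1 / 4) : ℝ) : ℝ) : ℂ) := by
    rw [← Complex.ofReal_mul, e1, Real.rpow_neg (by positivity)]
    push_cast
    rw [mul_inv]; norm_num
  have e4 : Complex.exp (-(((√x₀ : ℝ) : ℂ) * v₀)) * Complex.exp (- -(((√y₀ : ℝ) : ℂ) * u₀)) =
      Complex.exp (-((√x₀ : ℝ) * v₀) + (√y₀ : ℝ) * u₀) := by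
    rw [← Complex.exp_add, neg_neg]
  rw [e2, e3, e4, one_mul, mul_comm (Complex.exp _)] at hlim
  refine hlim.congr' ?_
  filter_upwards [eventually_besselArg_eq hτ hx hx₀ hv,
    (tendsto_besselArg_re hτ hx hx₀ hv).eventually_gt_atTop 0,
    (tendsto_besselArg_re hτ hy hy₀ hu).eventually_gt_atTop 0] with i hi hr1 hr2
  have hτi := hi.1
  simp only [Function.comp]
  set z := besselArg (τ i) (x i) (v i)
  set w := besselArg (τ i) (y i) (u i)
  have hz' : ((√z.re : ℝ) : ℂ) ≠ 0 := by exact_mod_cast (Real.sqrt_pos.2 hr1).ne'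
  have hw' : ((√w.re : ℝ) : ℂ) ≠ 0 := by exact_mod_cast (Real.sqrt_pos.2 hr2).ne'
  have ht' : ((√(τ i) : ℝ) : ℂ) * ((√(τ i) : ℝ) : ℂ) = (τ i : ℂ) := by
    rw [← Complex.ofReal_mul, Real.mul_self_sqrt hτi.le]
  have hτ' : (τ i : ℂ) ≠ 0 := by exact_mod_cast hτi.ne'
  have hst : ((√(τ i) : ℝ) : ℂ) ≠ 0 := by exact_mod_cast (Real.sqrt_pos.2 hτi).ne'
  have hE : Complex.exp (-z) * Complex.exp w * (Complex.exp (z - ((2 * √(x i) / τ i : ℝ) : ℂ)) *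
      Complex.exp (-(w - ((2 * √(y i) / τ i : ℝ) : ℂ)))) =
      ((Real.exp (2 * (√(y i) - √(x i)) / τ i) : ℝ) : ℂ) := by
    rw [← Complex.exp_add, ← Complex.exp_add, ← Complex.exp_add, Complex.ofReal_exp]
    congr 1; push_cast; ring
  rw [Real.sqrt_mul hτi.le, Real.sqrt_mul hτi.le, ← hE]
  push_cast
  rw [← ht']
  field_simp

end

variable {n m : ℕ} {p : Fin n → ℝ} {θ : Fin m → ℝ} {Γin Γout : Contour}

theorem Admissible.tendsto_kernelII (h : Admissible p θ Γin Γout) (κ ν : ℕ) {z : ℝ × ℝ}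
    (hx : 0 < z.1) (hy : 0 < z.2) :
    Tendsto (fun q : ℝ × ℝ × ℝ => kernelII κ ν p θ Γin Γout q.1 q.2.1 q.2.2 *
      ((Real.exp (2 * (√q.2.2 - √q.2.1) / q.1) : ℝ) : ℂ)) (𝓝[>] 0 ×ˢ 𝓝 z)
      (𝓝 (1 / 2 * (((z.1 * z.2) ^ (-(1 / 4) : ℝ) : ℝ) : ℂ) *
        kernelIII ν p θ Γin Γout (√z.1) (√z.2))) := by
  let H : ℝ × ℝ × ℝ → ℂ → ℂ → ℂ := fun q v u => 2 / (q.1 : ℂ) *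
    (besselI κ (besselArg q.1 q.2.1 v) * besselK κ (besselArg q.1 q.2.2 u)) *
    ((Real.exp (2 * (√q.2.2 - √q.2.1) / q.1) : ℝ) : ℂ) *
    ((1 - (q.1 : ℂ) * u) ^ ((κ : ℂ) / 2) / (1 - (q.1 : ℂ) * v) ^ ((κ : ℂ) / 2)) *
    commonFactor ν p θ v u
  let H₀ : ℂ → ℂ → ℂ := fun v u => 1 / 2 * (((z.1 * z.2) ^ (-(1 / 4) : ℝ) : ℝ) : ℂ) *
    Complex.exp (-((√z.1 : ℝ) * v) + (√z.2 : ℝ) * u) * commonFactor ν p θ v u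
  have hH : (fun q : ℝ × ℝ × ℝ => kernelII κ ν p θ Γin Γout q.1 q.2.1 q.2.2 *
      ((Real.exp (2 * (√q.2.2 - √q.2.1) / q.1) : ℝ) : ℂ)) =
      fun q => Γout.integral fun v => Γin.integral fun u => H q v u := by
    ext q
    rw [kernelII, mul_right_comm, ← Contour.integral_const_mul]
    congr 1; ext v
    rw [← Contour.integral_const_mul]
    congr 1; ext u
    simp only [H, besselArg]; ring
  have hH₀ : 1 / 2 * (((z.1 * z.2) ^ (-(1 / 4) : ℝ) : ℝ) : ℂ) *
      kernelIII ν p θ Γin Γout (√z.1) (√z.2) =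
      Γout.integral fun v => Γin.integral fun u => H₀ v u := by
    rw [kernelIII, ← Contour.integral_const_mul]
    congr 1; ext v
    rw [← Contour.integral_const_mul]
    congr 1; ext u
    simp only [H₀]; ring
  rw [hH, hH₀]
  refine Contour.tendsto_integral_integral h.radius_out_pos.le h.radius_in_pos.le ?_ ?_ ?_
  · intro q
    have h1 : Measurable fun w : ℂ × ℂ => besselI κ (besselArg q.1 q.2.1 w.1) := by
      refine (measurable_besselI κ).comp ?_
      unfold besselArg; fun_prop
    have h2 : Measurable fun w : ℂ × ℂ => besselK κ (besselArg q.1 q.2.2 w.2) := by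
      refine (measurable_besselK κ).comp ?_
      unfold besselArg; fun_prop
    exact ((((h1.mul h2).const_mul _).mul_const _).mul (by fun_prop)).mul
      (measurable_commonFactor ν p θ)
  · exact ContinuousOn.mul (by fun_prop) (h.continuousOn ν)
  · intro v hv u hu
    have hL : ((𝓝[>] (0 : ℝ) ×ˢ 𝓝 z) ×ˢ 𝓝 (v, u)).IsCountablyGenerated := inferInstance
    have hτ : Tendsto (fun w : (ℝ × ℝ × ℝ) × ℂ × ℂ => w.1.1)
        ((𝓝[>] (0 : ℝ) ×ˢ 𝓝 z) ×ˢ 𝓝 (v, u)) (𝓝[>] 0) := tendsto_fst.comp tendsto_fst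
    have hz : Tendsto (fun w : (ℝ × ℝ × ℝ) × ℂ × ℂ => w.1.2)
        ((𝓝[>] (0 : ℝ) ×ˢ 𝓝 z) ×ˢ 𝓝 (v, u)) (𝓝 z) := tendsto_snd.comp tendsto_fst
    have hw : Tendsto (fun w : (ℝ × ℝ × ℝ) × ℂ × ℂ => w.2)
        ((𝓝[>] (0 : ℝ) ×ˢ 𝓝 z) ×ˢ 𝓝 (v, u)) (𝓝 (v, u)) := tendsto_snd
    generalize (𝓝[>] (0 : ℝ) ×ˢ 𝓝 z) ×ˢ 𝓝 (v, u) = L at hL hτ hz hw ⊢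
    have hx' : Tendsto (fun w : (ℝ × ℝ × ℝ) × ℂ × ℂ => w.1.2.1) L (𝓝 z.1) :=
      (continuous_fst.tendsto z).comp hz
    have hy' : Tendsto (fun w : (ℝ × ℝ × ℝ) × ℂ × ℂ => w.1.2.2) L (𝓝 z.2) :=
      (continuous_snd.tendsto z).comp hz
    have hv' : Tendsto (fun w : (ℝ × ℝ × ℝ) × ℂ × ℂ => w.2.1) L (𝓝 v) :=
      (continuous_fst.tendsto (v, u)).comp hw
    have hu' : Tendsto (fun w : (ℝ × ℝ × ℝ) × ℂ × ℂ => w.2.2) L (𝓝 u) :=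
      (continuous_snd.tendsto (v, u)).comp hw
    have hcont : ContinuousAt (fun q : ℂ × ℂ => commonFactor ν p θ q.1 q.2) (v, u) :=
      ((h.regular hv hu).differentiableAt ν).continuousAt
    have hW : Tendsto (fun w : (ℝ × ℝ × ℝ) × ℂ × ℂ => commonFactor ν p θ w.2.1 w.2.2) L
        (𝓝 (commonFactor ν p θ v u)) := hcont.tendsto.comp hw
    have h2 := (tendsto_one_sub_mul_cpow hτ hu' ((κ : ℂ) / 2)).div
      (tendsto_one_sub_mul_cpow hτ hv' ((κ : ℂ) / 2)) one_ne_zero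
    have h3 := ((tendsto_besselI_mul_besselK κ hτ hx' hx hv' hy' hy hu').mul h2).mul hW
    rw [div_one, mul_one] at h3
    exact h3

theorem Admissible.eventually_admissibleII (h : Admissible p θ Γin Γout) :
    ∀ᶠ τ in 𝓝[>] (0 : ℝ), AdmissibleII p θ τ Γin Γout := by
  obtain ⟨C, hC⟩ := Γin.isCompact_points.exists_bound_of_continuousOn
    (f := fun u : ℂ => u) (by fun_prop)
  have hinv : Tendsto (fun τ : ℝ => τ⁻¹) (𝓝[>] 0) atTop := tendsto_inv_nhdsGT_zero
  filter_upwards [hinv.eventually_gt_atTop C] with τ hτ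
  refine ⟨h, fun u hu => ?_⟩
  rw [one_div]
  exact ((Complex.re_le_norm u).trans (hC u hu)).trans_lt hτ

theorem Admissible.tendstoUniformlyOn_kernelIII (h : Admissible p θ Γin Γout) (κ ν : ℕ)
    {Δin Δout : ℝ → Contour}
    (hΔ : ∀ᶠ τ in 𝓝[>] (0 : ℝ), AdmissibleII p θ τ (Δin τ) (Δout τ)) {C : Set (ℝ × ℝ)}
    (hC : IsCompact C) (hC0 : C ⊆ Ioi 0 ×ˢ Ioi 0) :
    TendstoUniformlyOn
      (fun (τ : ℝ) (z : ℝ × ℝ) => kernelII κ ν p θ (Δin τ) (Δout τ) τ z.1 z.2 *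
        ((Real.exp (2 * (√z.2 - √z.1) / τ) : ℝ) : ℂ))
      (fun z => 1 / 2 * (((z.1 * z.2) ^ (-(1 / 4) : ℝ) : ℝ) : ℂ) *
        kernelIII ν p θ Γin Γout (√z.1) (√z.2)) (𝓝[>] (0 : ℝ)) C := by
  have hmain : TendstoUniformlyOn
      (fun (τ : ℝ) (z : ℝ × ℝ) => kernelII κ ν p θ Γin Γout τ z.1 z.2 *
        ((Real.exp (2 * (√z.2 - √z.1) / τ) : ℝ) : ℂ))
      (fun z => 1 / 2 * (((z.1 * z.2) ^ (-(1 / 4) : ℝ) : ℝ) : ℂ) *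
        kernelIII ν p θ Γin Γout (√z.1) (√z.2)) (𝓝[>] (0 : ℝ)) C := by
    refine tendstoUniformlyOn_of_forall_tendsto hC fun z hz => ?_
    have hmono : 𝓝[>] (0 : ℝ) ×ˢ 𝓝[C] z ≤ 𝓝[>] (0 : ℝ) ×ˢ 𝓝 z :=
      Filter.prod_mono le_rfl nhdsWithin_le_nhds
    exact (h.tendsto_kernelII κ ν (hC0 hz).1 (hC0 hz).2).mono_left hmono
  -- A fixed `Γin` satisfies `Re u < 1/τ` for small `τ`, so contours depending on `τ` can be
  -- replaced by `Γin`, `Γout` through the heat integral.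
  refine hmain.congr ?_
  filter_upwards [hΔ, h.eventually_admissibleII, self_mem_nhdsWithin] with τ h1 h2 hτ z hz
  have hτ : 0 < τ := hτ
  have hdiff := differentiable_besselSeries_comp κ ((1 / τ : ℝ) : ℂ) ((z.1 / τ : ℝ) : ℂ)
  simp only
  rw [h1.kernelII_eq hτ κ ν (hC0 hz).1 (hC0 hz).2, h2.kernelII_eq hτ κ ν (hC0 hz).1 (hC0 hz).2,
    besselHeatIntegral, besselHeatIntegral, h.heatIntegral_eq h1.toAdmissible ν hdiff]
end

end HardEdge

end
open HardEdge in
theorem theorem4 (κ ν n m : ℕ) :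
    -- a) the limit τ → ∞, with parameters π̂_k = π̂_k(τ) ∈ [0, 1/τ) and θ̂_l ≤ 0
    (∀ (θ : Fin m → ℝ) (p : ℝ → Fin n → ℝ) (Γ₀ Γin Γout : Contour) (Δin Δout : ℝ → Contour),
      (∀ l, θ l ≤ 0) →
      (∀ᶠ τ in atTop, ∀ k, 0 ≤ p τ k ∧ p τ k < 1 / τ) →
      Γ₀.Encloses 0 →
      Admissible (Fin.elim0 : Fin 0 → ℝ) θ Γin Γout →
      (∀ᶠ τ in atTop, AdmissibleII (p τ) θ τ (Δin τ) (Δout τ)) →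
      (∀ x y : ℝ, 0 < x → 0 < y →
        HasAbelIntegral (integrandI κ ν θ Γ₀ Γin Γout x y) (kernelI κ ν θ Γ₀ Γin Γout x y)) ∧
      ∀ C : Set (ℝ × ℝ), IsCompact C → C ⊆ Ioi 0 ×ˢ Ioi 0 →
        TendstoUniformlyOn
          (fun (τ : ℝ) (z : ℝ × ℝ) =>
            (τ : ℂ) * kernelII κ ν (p τ) θ (Δin τ) (Δout τ) τ (τ * z.1) (τ * z.2) *
              (((z.2 / z.1) ^ ((κ : ℝ) / 2) : ℝ) : ℂ))
          (fun z => kernelI κ ν θ Γ₀ Γin Γout z.1 z.2) atTop C) ∧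
    -- b) the limit τ → 0+, with fixed parameters π̂_k ≥ 0 and θ̂_l ≤ π̂_k
    (∀ (θ : Fin m → ℝ) (p : Fin n → ℝ) (Γin Γout : Contour) (Δin Δout : ℝ → Contour),
      (∀ k, 0 ≤ p k) →
      (∀ l k, θ l ≤ p k) →
      Admissible p θ Γin Γout →
      (∀ᶠ τ in 𝓝[>] (0 : ℝ), AdmissibleII p θ τ (Δin τ) (Δout τ)) →
      ∀ C : Set (ℝ × ℝ), IsCompact C → C ⊆ Ioi 0 ×ˢ Ioi 0 →
        TendstoUniformlyOn
          (fun (τ : ℝ) (z : ℝ × ℝ) =>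
            kernelII κ ν p θ (Δin τ) (Δout τ) τ z.1 z.2 *
              (Real.exp (2 * (Real.sqrt z.2 - Real.sqrt z.1) / τ) : ℂ))
          (fun z => (1 / 2 : ℂ) * (((z.1 * z.2) ^ (-(1 / 4) : ℝ) : ℝ) : ℂ) *
            kernelIII ν p θ Γin Γout (Real.sqrt z.1) (Real.sqrt z.2))
          (𝓝[>] (0 : ℝ)) C) := by
  refine ⟨fun θ p Γ₀ Γin Γout Δin Δout hθ hp h₀ h hΔ => ⟨fun x y hx hy => ?_,
    fun C hC hC0 => tendstoUniformlyOn_kernelI κ ν n hθ hp h₀ h hΔ hC hC0⟩,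
    fun θ p Γin Γout Δin Δout _ _ h hΔ C hC hC0 => h.tendstoUniformlyOn_kernelIII κ ν hΔ hC hC0⟩
  obtain ⟨_, _, _, H⟩ := exists_tendsto_and_hasAbelIntegral κ ν n hθ h₀ h
  exact (H x y hx hy).1
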